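/- **Conventions.** Two-sorted setting: numbers are elements of $\mathbb N$; strings are finite sets $X\subset\mathbb N$, with $X(i)$ meaning $i\in X$, length $|X|=1+\max X$ ($|\emptyset|=0$), and $\mathrm{bin}(X)=\sum_{i\in X}2^i$. The pairing function is $\langle x,y\rangle=(x+y)(x+y+1)+2y$. A number (string) function has number arguments $\vec x$ and string arguments $\vec X$ and a number (string) value; it is $p$-bounded if its value (the length of its value) is at most a polynomial in $\vec x$, $|\vec X|$. For a collection $\mathcal L$ of functions and relations, a $\Sigma^B_0(\mathcal L)$ formula is a formula over $\mathcal L^2_A\cup\mathcal L$, $\mathcal L^2_A=\{0,1,+,\cdot,|\ |,\in,\le,=_1,=_2\}$, all of whose quantifiers are bounded number quantifiers. A number (string) function is $\Sigma^B_0$-definable from $\mathcal L$ if it is $p$-bounded and its graph (bit graph $F(\vec x,\vec X)(i)$) is represented by a $\Sigma^B_0(\mathcal L)$ formula. It is $AC^0$-reducible to $\mathcal L$ if there are string functions $F_1,\dots,F_n$ ($n\ge 0$), each $F_i$ being $\Sigma^B_0$-definable from $\mathcal L\cup\{F_1,\dots,F_{i-1}\}$, such that it is $\Sigma^B_0$-definable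 from $\mathcal L\cup\{F_1,\dots,F_n\}$. A string function $H$ is $\Sigma^B_0$-bit-definable if $H(\vec x,\vec X)(i)\leftrightarrow i<t(\vec x,\vec X)\wedge\varphi(i,\vec x,\vec X)$ for some $\mathcal L^2_A$ number term $t$ and some $\Sigma^B_0(\mathcal L_A^2)$ formula $\varphi$. $\#L$ is the class of string functions $F$ for which there is a nondeterministic logspace Turing machine (numbers are given in unary, strings by their bits, on read-only input tapes), halting in polynomial time on all inputs, which on input $(\vec x,\vec X)$ has exactly $\mathrm{bin}(F(\vec x,\vec X))$ accepting computations, a computation being a sequence of configurations. $DET=AC^0(\#L)$ is the class of number and string functions that are $AC^0$-reducible to $\#L$. $\#STCON(n,s,t,p,G)$ is the string function giving, in binary, the number of paths of length $\le p$ from $s$ to $t$ in the directed graph on vertices $0,\dots,n-1$ with an edge from $u$ to $v$ iff $G(\langle u,v\rangle)$ (at most one edge from $u$ to $v$; loops are allowed); here $s,t<n$ and $s\ne t$ (otherwise the value is $0$), a path may repeat vertices, and its length is its number of edges. **Claim.** 1. $\#STCON\in\#L$. 2. For every $F\in\#L$ there are a $\Sigma^B_0$-bit-definable string function $H$ and $\mathcal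 L^2_A$ number terms $n,p$ such that, for all $\vec x,\vec X$, $n(\vec x,\vec X)\ge 2$ and $$F(\vec x,\vec X)=\#STCON\bigl(n(\vec x,\vec X),\,0,\,1,\,p(\vec x,\vec X),\,H(\vec x,\vec X)\bigr).$$ 3. $\#STCON$ is complete for $DET$ under $AC^0$ reductions: $\#STCON\in DET$, and every number or string function in $DET$ is $AC^0$-reducible to $\#STCON$. -/

import Mathlib

/-! ## Two-sorted objects

Numbers are elements of `ℕ`, strings are finite subsets of `ℕ`; `X(i)` is `i ∈ X`. -/

namespace TwoSorted

/-- A number function `f(x₁,…,x_a,X₁,…,X_b)`. -/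
abbrev NumFun (a b : ℕ) : Type := (Fin a → ℕ) → (Fin b → Finset ℕ) → ℕ

/-- A string function `F(x₁,…,x_a,X₁,…,X_b)`. -/
abbrev StrFun (a b : ℕ) : Type := (Fin a → ℕ) → (Fin b → Finset ℕ) → Finset ℕ

/-- A relation `R(x₁,…,x_a,X₁,…,X_b)`. -/
abbrev Rel (a b : ℕ) : Type := (Fin a → ℕ) → (Fin b → Finset ℕ) → Prop

/-- A two-sorted function or relation of any arity; a collection of two-sorted functions and
relations is a `Set Obj`. -/
inductive Obj : Type
  | num {a b : ℕ} (f : NumFun a b) : Obj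
  | str {a b : ℕ} (F : StrFun a b) : Obj
  | rel {a b : ℕ} (R : Rel a b) : Obj

/-- The length `|X|`: one more than the largest element of `X`, and `0` if `X` is empty. -/
def strLen (X : Finset ℕ) : ℕ := X.sup (fun i => i + 1)

/-- The number `∑ i, X(i) * 2 ^ i` with binary representation `X`
(least significant bit first). -/
def bin (X : Finset ℕ) : ℕ := ∑ i ∈ X, 2 ^ i

/-- The string that represents the number `m` in binary. -/
def toBits (m : ℕ) : Finset ℕ := m.bitIndices.toFinset

theorem bin_toBits (m : ℕ) : bin (toBits m) = m := by
  simp [bin, toBits]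

/-- The pairing function `⟨x,y⟩ = (x+y)(x+y+1)+2y`. -/
def pair (x y : ℕ) : ℕ := (x + y) * (x + y + 1) + 2 * y

/-! ## Terms and `Σ₀ᴮ` formulas

The vocabulary is `0, 1, +, ·, | |, ∈, ≤, =₁, =₂` together with a symbol for each function and
relation of the collection `L`, which is interpreted by itself. -/

mutual

/-- Number terms over `L` in `a` number variables and `b` string variables. -/
inductive NumTerm (L : Set Obj) (a b : ℕ) : Type
  | var (i : Fin a) : NumTerm L a b
  | zero : NumTerm L a b
  | one : NumTerm L a b
  | add (s t : NumTerm L a b) : NumTerm L a b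
  | mul (s t : NumTerm L a b) : NumTerm L a b
  | len (T : StrTerm L a b) : NumTerm L a b
  | app {m n : ℕ} (f : NumFun m n) (hf : Obj.num f ∈ L)
      (s : Fin m → NumTerm L a b) (T : Fin n → StrTerm L a b) : NumTerm L a b

/-- String terms over `L` in `a` number variables and `b` string variables. -/
inductive StrTerm (L : Set Obj) (a b : ℕ) : Type
  | var (j : Fin b) : StrTerm L a b
  | app {m n : ℕ} (F : StrFun m n) (hF : Obj.str F ∈ L)
      (s : Fin m → NumTerm L a b) (T : Fin n → StrTerm L a b) : StrTerm L a b

end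

mutual

/-- The value of a number term. -/
def NumTerm.eval {L : Set Obj} {a b : ℕ} (x : Fin a → ℕ) (X : Fin b → Finset ℕ) :
    NumTerm L a b → ℕ
  | .var i => x i
  | .zero => 0
  | .one => 1
  | .add s t => s.eval x X + t.eval x X
  | .mul s t => s.eval x X * t.eval x X
  | .len T => strLen (T.eval x X)
  | .app f _ s T => f (fun i => (s i).eval x X) (fun j => (T j).eval x X)

/-- The value of a string term. -/
def StrTerm.eval {L : Set Obj} {a b : ℕ} (x : Fin a → ℕ) (X : Fin b → Finset ℕ) :
    StrTerm L a b → Finset ℕ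
  | .var j => X j
  | .app F _ s T => F (fun i => (s i).eval x X) (fun j => (T j).eval x X)

end

/-- `Σ₀ᴮ(L)` formulas with free number variables `x₀,…,x_{a-1}` and free string variables
`X₀,…,X_{b-1}`: all quantifiers are number quantifiers bounded by a term in which the quantified
variable does not occur. Under a quantifier the new variable has index `0`. -/
inductive Formula (L : Set Obj) (b : ℕ) : ℕ → Type
  | eqNum {a : ℕ} (s t : NumTerm L a b) : Formula L b a
  | le {a : ℕ} (s t : NumTerm L a b) : Formula L b a
  | eqStr {a : ℕ} (S T : StrTerm L a b) : Formula L b a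
  | mem {a : ℕ} (s : NumTerm L a b) (T : StrTerm L a b) : Formula L b a
  | rel {a m n : ℕ} (R : Rel m n) (hR : Obj.rel R ∈ L)
      (s : Fin m → NumTerm L a b) (T : Fin n → StrTerm L a b) : Formula L b a
  | neg {a : ℕ} (φ : Formula L b a) : Formula L b a
  | and {a : ℕ} (φ ψ : Formula L b a) : Formula L b a
  | or {a : ℕ} (φ ψ : Formula L b a) : Formula L b a
  | exLe {a : ℕ} (t : NumTerm L a b) (φ : Formula L b (a + 1)) : Formula L b a
  | allLe {a : ℕ} (t : NumTerm L a b) (φ : Formula L b (a + 1)) : Formula L b a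

/-- Truth of a formula in the standard model. -/
def Formula.Holds {L : Set Obj} {b : ℕ} (X : Fin b → Finset ℕ) :
    {a : ℕ} → Formula L b a → (Fin a → ℕ) → Prop
  | _, .eqNum s t, x => s.eval x X = t.eval x X
  | _, .le s t, x => s.eval x X ≤ t.eval x X
  | _, .eqStr S T, x => S.eval x X = T.eval x X
  | _, .mem s T, x => s.eval x X ∈ T.eval x X
  | _, .rel R _ s T, x => R (fun i => (s i).eval x X) (fun j => (T j).eval x X)
  | _, .neg φ, x => ¬ φ.Holds X x
  | _, .and φ ψ, x => φ.Holds X x ∧ ψ.Holds X x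
  | _, .or φ ψ, x => φ.Holds X x ∨ ψ.Holds X x
  | _, .exLe t φ, x => ∃ y ≤ t.eval x X, φ.Holds X (Fin.cons y x : Fin _ → ℕ)
  | _, .allLe t φ, x => ∀ y ≤ t.eval x X, φ.Holds X (Fin.cons y x : Fin _ → ℕ)

/-! ## Definability and `AC⁰` reducibility -/

/-- `g(x,X)` is bounded by a polynomial in the numbers `xᵢ` and the lengths `|Xⱼ|`. -/
def PolyBounded {a b : ℕ} (g : NumFun a b) : Prop :=
  ∃ p : MvPolynomial (Fin a ⊕ Fin b) ℕ, ∀ x X,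
    g x X ≤ MvPolynomial.eval (Sum.elim x fun j => strLen (X j)) p

/-- `Σ₀ᴮ`-definability from the collection `L`: the graph of a number function, the bit graph of a
string function, or the relation itself, is represented by a `Σ₀ᴮ(L)` formula, and a function is
moreover polynomially bounded. -/
def SigmaDefinable (L : Set Obj) : Obj → Prop
  | @Obj.num a b f => PolyBounded f ∧
      ∃ φ : Formula L b (a + 1), ∀ x X y,
        y = f x X ↔ φ.Holds X (Fin.cons y x : Fin (a + 1) → ℕ)
  | @Obj.str a b F => PolyBounded (fun x X => strLen (F x X)) ∧
      ∃ φ : Formula L b (a + 1), ∀ x X i,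
        i ∈ F x X ↔ φ.Holds X (Fin.cons i x : Fin (a + 1) → ℕ)
  | @Obj.rel a b R => ∃ φ : Formula L b a, ∀ x X, R x X ↔ φ.Holds X x

/-- `Σ₀ᴮ`-bit-definability from `L`: the bit graph is `i < t(x,X) ∧ φ(i,x,X)`, with `φ` a `Σ₀ᴮ(L)`
formula and `t` a number term of the base vocabulary. -/
def SigmaBitDefinable (L : Set Obj) {a b : ℕ} (F : StrFun a b) : Prop :=
  ∃ (t : NumTerm ∅ a b) (φ : Formula L b (a + 1)), ∀ x X i,
    i ∈ F x X ↔ i < t.eval x X ∧ φ.Holds X (Fin.cons i x : Fin (a + 1) → ℕ)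

/-- `AC⁰`-reducibility of `G` to the collection `L`: there are string functions `F₀,…,F_{n-1}` such
that each `Fᵢ` is `Σ₀ᴮ`-definable from `L` and the `Fⱼ` with `j < i`, and `G` is `Σ₀ᴮ`-definable
from `L` and all `Fⱼ`. -/
def AC0Reducible (L : Set Obj) (G : Obj) : Prop :=
  ∃ (n : ℕ) (a b : Fin n → ℕ) (F : ∀ i, StrFun (a i) (b i)),
    (∀ i, SigmaDefinable (L ∪ {O | ∃ j < i, O = Obj.str (F j)}) (Obj.str (F i))) ∧
    SigmaDefinable (L ∪ {O | ∃ j, O = Obj.str (F j)}) G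

/-! ## Nondeterministic logspace machines -/

/-- Contents of a cell of a read-only input tape: an end marker or a bit. -/
inductive InSym : Type
  | leftEnd : InSym
  | bit (v : Bool) : InSym
  | rightEnd : InSym

/-- Head movements. -/
inductive Move : Type
  | left : Move
  | stay : Move
  | right : Move

/-- The words on the input tapes: the number `x` is written in unary, as `x` ones, and the string
`X` as its bits `X(0) X(1) … X(|X|-1)`. -/
def inputWord {a b : ℕ} (x : Fin a → ℕ) (X : Fin b → Finset ℕ) : Fin a ⊕ Fin b → List Bool
  | .inl i => List.replicate (x i) true
  | .inr j => (List.range (strLen (X j))).map fun i => decide (i ∈ X j)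

/-- The length of the input: number arguments count with their value (unary notation). -/
def inputSize {a b : ℕ} (x : Fin a → ℕ) (X : Fin b → Finset ℕ) : ℕ :=
  ∑ i, (inputWord x X i).length

/-- Cell `h` of an input tape: cell `0` holds the left end marker, the cells `1,…,|w|` hold the
word `w`, and cell `|w| + 1` holds the right end marker. -/
def readInput (w : List Bool) : ℕ → InSym
  | 0 => .leftEnd
  | h + 1 => match w[h]? with
    | some v => .bit v
    | none => .rightEnd

/-- Movement of an input head, which never leaves the cells `0,…,|w| + 1`. -/
def moveInput (w : List Bool) (h : ℕ) : Move → ℕ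
  | .left => h - 1
  | .stay => h
  | .right => min (h + 1) (w.length + 1)

/-- A work tape, infinite in both directions. The lists hold the cells visited so far to the left
and to the right of the head, nearest cell first; all other cells are blank. -/
structure WorkTape (Γ : Type) : Type where
  left : List Γ
  head : Γ
  right : List Γ

/-- The number of cells visited so far. -/
def WorkTape.space {Γ : Type} (T : WorkTape Γ) : ℕ := T.left.length + 1 + T.right.length

/-- Write `s` in the scanned cell, then move the head. -/
def WorkTape.update {Γ : Type} (blank : Γ) (T : WorkTape Γ) (s : Γ) : Move → WorkTape Γ
  | .stay => { left := T.left, head := s, right := T.right }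
  | .left => { left := T.left.tail, head := T.left.headD blank, right := s :: T.right }
  | .right => { left := s :: T.left, head := T.right.headD blank, right := T.right.tail }

/-- What a transition does. -/
structure Action (ι State Γ : Type) (k : ℕ) : Type where
  state : State
  write : Fin k → Γ
  workMove : Fin k → Move
  inputMove : ι → Move

/-- A nondeterministic Turing machine for inputs of `a` numbers and `b` strings, with one two-way
read-only input tape for each argument and finitely many work tapes. -/
structure Machine (a b : ℕ) : Type 1 where
  State : Type
  Γ : Type
  finite_state : Finite State
  finite_alphabet : Finite Γ
  tapes : ℕ
  blank : Γ
  start : State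
  accept : State
  trans : State → (Fin a ⊕ Fin b → InSym) → (Fin tapes → Γ) →
    Set (Action (Fin a ⊕ Fin b) State Γ tapes)

namespace Machine

variable {a b : ℕ}

/-- A configuration: state, positions of the input heads, and work tapes. -/
structure Config (M : Machine a b) : Type where
  state : M.State
  inputHead : Fin a ⊕ Fin b → ℕ
  work : Fin M.tapes → WorkTape M.Γ

/-- The initial configuration: blank work tapes, input heads on the left end markers. -/
def init (M : Machine a b) : M.Config where
  state := M.start
  inputHead := fun _ => 0
  work := fun _ => { left := [], head := M.blank, right := [] }

/-- One computation step on input `(x,X)`. The machine halts on entering the accepting state. -/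
def Step (M : Machine a b) (x : Fin a → ℕ) (X : Fin b → Finset ℕ) (c c' : M.Config) : Prop :=
  c.state ≠ M.accept ∧
  ∃ A ∈ M.trans c.state (fun i => readInput (inputWord x X i) (c.inputHead i))
      (fun i => (c.work i).head),
    c' = { state := A.state
           inputHead := fun i => moveInput (inputWord x X i) (c.inputHead i) (A.inputMove i)
           work := fun i => (c.work i).update M.blank (A.write i) (A.workMove i) }

/-- A (partial) computation on input `(x,X)`: a nonempty sequence of configurations that begins
with the initial one and in which each arises from the preceding one by a step. -/
def IsComputation (M : Machine a b) (x : Fin a → ℕ) (X : Fin b → Finset ℕ)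
    (l : List M.Config) : Prop :=
  l.head? = some M.init ∧ l.IsChain (M.Step x X)

/-- The accepting computations: those whose last configuration is in the accepting state. -/
def acceptingComputations (M : Machine a b) (x : Fin a → ℕ) (X : Fin b → Finset ℕ) :
    Set (List M.Config) :=
  {l | M.IsComputation x X l ∧ ∃ c, l.getLast? = some c ∧ c.state = M.accept}

/-- On every input, every computation visits at most `O(log N)` work tape cells, where `N` is
the length of the input. -/
def Logspace (M : Machine a b) : Prop :=
  ∃ K : ℕ, ∀ x X l, M.IsComputation x X l → ∀ c ∈ l,
    ∑ i, (c.work i).space ≤ K * (Nat.log 2 (inputSize x X) + 1)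

/-- On every input, every computation halts within polynomially many steps. -/
def Polytime (M : Machine a b) : Prop :=
  ∃ k : ℕ, ∀ x X l, M.IsComputation x X l → l.length ≤ inputSize x X ^ k + k

end Machine

/-! ## The classes `#L` and `DET` -/

/-- `#L`: the string functions whose value, read in binary, is the number of accepting
computations of a nondeterministic logspace machine that halts in polynomial time. -/
def SharpL : Set Obj :=
  {G | ∃ (a b : ℕ) (F : StrFun a b) (M : Machine a b), G = Obj.str F ∧ M.Logspace ∧ M.Polytime ∧
    ∀ x X, (M.acceptingComputations x X).encard = (bin (F x X) : ℕ∞)}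

/-- `DET`: the number and string functions that are `AC⁰`-reducible to `#L`. -/
def DET : Set Obj :=
  {G | ((∃ (a b : ℕ) (f : NumFun a b), G = Obj.num f) ∨
      ∃ (a b : ℕ) (F : StrFun a b), G = Obj.str F) ∧ AC0Reducible SharpL G}

/-- `G` is complete for the class `C` under `AC⁰` reductions. -/
def AC0Complete (G : Obj) (C : Set Obj) : Prop :=
  G ∈ C ∧ ∀ G' ∈ C, AC0Reducible {G} G'

/-! ## The function `#STCON` -/

/-- The paths of length at most `p` from `s` to `t` in the directed graph on `{0,…,n-1}` with an
edge from `u` to `v` when `G(⟨u,v⟩)`. A path is its sequence of vertices, which may repeat; its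
length is its number of edges. -/
def stPaths (n s t p : ℕ) (G : Finset ℕ) : Set (List (Fin n)) :=
  {l | l.head?.map Fin.val = some s ∧ l.getLast?.map Fin.val = some t ∧
    l.IsChain (fun u v => pair u v ∈ G) ∧ l.length ≤ p + 1}

theorem stPaths_finite (n s t p : ℕ) (G : Finset ℕ) : (stPaths n s t p G).Finite :=
  (List.finite_length_le (Fin n) (p + 1)).subset fun _ hl => hl.2.2.2

open Classical in
/-- `#STCON(n,s,t,p,G)`: the number of paths of length at most `p` from `s` to `t`, in binary.
If `s`, `t` are not two distinct vertices, the value is `0` (the empty string). -/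
noncomputable def sharpSTCON : StrFun 4 1 := fun x X =>
  if x 1 < x 0 ∧ x 2 < x 0 ∧ x 1 ≠ x 2 then
    toBits (stPaths (x 0) (x 1) (x 2) (x 3) (X 0)).ncard
  else ∅

end TwoSorted

/-!
# `#STCON` is complete for `DET`

*Every function of `#L` counts paths* (`exists_eq_sharpSTCON`). The accepting computations of a
machine are the paths in its configuration graph, with an extra source `0` before the initial
configuration and an extra sink `1` behind the accepting ones (`encard_stPaths_eq`). The edge
relation has to be a `Σ₀ᴮ` formula of the base vocabulary. To this end each side of a work tape is
regarded as a stack, coded as a number whose digits in base `g + 1` are the `g` symbols, with the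
digit `0` left out (`stackCode`). Stacks of logarithmic height have polynomially bounded codes, and
push and pop are affine maps; hence no bits of numbers have to be extracted, and a step of the
machine is an arithmetic relation between tuples of bounded numbers (`Machine.TupleStep`). Tuples
become vertices by iterated pairing. The bounds are known for reachable configurations only, but no
others occur on paths from `0`.

*`#STCON` belongs to `#L`* (`sharpSTCON_mem_sharpL`). A machine guesses a path vertex by vertex, and
at each visit of `t` after the first edge it branches between accepting and going on. A vertex is
stored as the position of an input head or in a binary counter on a work tape. To look up an edge
`⟨u,v⟩` the head on the graph moves along the row of `u`; since `⟨u,v+1⟩ - ⟨u,v⟩ = 2 (u + v + 2)`, a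
counter that holds `u + v` is all that this takes. The machine is compiled from a program with
counter instructions (`pathProgram`, `compile`). A single statement (`HasRuns`, `ProgramRuns`) about
a configuration gives the number of its accepting runs together with bounds for time and
space; it satisfies a rule for each instruction, and these are combined backwards along the program.
The number obtained for the initial configuration obeys the recursion of the number of paths on the
first edge (`walkCount`, `ncard_stPaths`).

*Completeness* (`ac0Complete_sharpSTCON`). A formula uses finitely many symbols, so an `AC⁰`
reduction to the infinite class `#L` uses finitely many functions of `#L`. Each of them is `#STCON`
with number terms and a `Σ₀ᴮ`-definable string substituted, and the definitions of these can be
executed before the others (`AC0Reducible.trans`).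
-/

namespace TwoSorted

/-! ### Substitution in terms, change of vocabulary -/

section Terms

variable {L L' : Set Obj} {a a' b : ℕ}

mutual

/-- Substitution of number terms for the number variables, into a larger vocabulary. -/
def NumTerm.subst (hL : L ⊆ L') (ρ : Fin a → NumTerm L' a' b) : NumTerm L a b → NumTerm L' a' b
  | .var i => ρ i
  | .zero => .zero
  | .one => .one
  | .add s t => .add (s.subst hL ρ) (t.subst hL ρ)
  | .mul s t => .mul (s.subst hL ρ) (t.subst hL ρ)
  | .len T => .len (T.subst hL ρ)
  | .app f hf s T => .app f (hL hf) (fun i => (s i).subst hL ρ) (fun j => (T j).subst hL ρ)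

/-- Substitution of number terms for the number variables, into a larger vocabulary. -/
def StrTerm.subst (hL : L ⊆ L') (ρ : Fin a → NumTerm L' a' b) : StrTerm L a b → StrTerm L' a' b
  | .var j => .var j
  | .app F hF s T => .app F (hL hF) (fun i => (s i).subst hL ρ) (fun j => (T j).subst hL ρ)

end

mutual

theorem NumTerm.eval_subst (hL : L ⊆ L') (ρ : Fin a → NumTerm L' a' b) (x : Fin a' → ℕ)
    (X : Fin b → Finset ℕ) :
    ∀ t : NumTerm L a b, (t.subst hL ρ).eval x X = t.eval (fun i => (ρ i).eval x X) X
  | .var i => by simp only [NumTerm.subst, NumTerm.eval]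
  | .zero => by simp only [NumTerm.subst, NumTerm.eval]
  | .one => by simp only [NumTerm.subst, NumTerm.eval]
  | .add s t => by
      simp only [NumTerm.subst, NumTerm.eval, NumTerm.eval_subst hL ρ x X s,
        NumTerm.eval_subst hL ρ x X t]
  | .mul s t => by
      simp only [NumTerm.subst, NumTerm.eval, NumTerm.eval_subst hL ρ x X s,
        NumTerm.eval_subst hL ρ x X t]
  | .len T => by
      simp only [NumTerm.subst, NumTerm.eval, StrTerm.eval_subst hL ρ x X T]
  | .app f hf s T => by
      simp only [NumTerm.subst, NumTerm.eval]
      congr 1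
      · exact funext fun i => NumTerm.eval_subst hL ρ x X (s i)
      · exact funext fun j => StrTerm.eval_subst hL ρ x X (T j)

theorem StrTerm.eval_subst (hL : L ⊆ L') (ρ : Fin a → NumTerm L' a' b) (x : Fin a' → ℕ)
    (X : Fin b → Finset ℕ) :
    ∀ T : StrTerm L a b, (T.subst hL ρ).eval x X = T.eval (fun i => (ρ i).eval x X) X
  | .var j => by simp only [StrTerm.subst, StrTerm.eval]
  | .app F hF s T => by
      simp only [StrTerm.subst, StrTerm.eval]
      congr 1
      · exact funext fun i => NumTerm.eval_subst hL ρ x X (s i)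
      · exact funext fun j => StrTerm.eval_subst hL ρ x X (T j)

end

theorem NumTerm.exists_mono (hL : L ⊆ L') (t : NumTerm L a b) :
    ∃ t' : NumTerm L' a b, ∀ x X, t'.eval x X = t.eval x X :=
  ⟨t.subst hL .var, fun x X => by simp only [NumTerm.eval_subst, NumTerm.eval]⟩

theorem StrTerm.exists_mono (hL : L ⊆ L') (T : StrTerm L a b) :
    ∃ T' : StrTerm L' a b, ∀ x X, T'.eval x X = T.eval x X :=
  ⟨T.subst hL .var, fun x X => by simp only [StrTerm.eval_subst, NumTerm.eval]⟩

theorem Formula.exists_mono (hL : L ⊆ L') (φ : Formula L b a) :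
    ∃ φ' : Formula L' b a, ∀ X x, φ'.Holds X x ↔ φ.Holds X x := by
  induction φ with
  | eqNum s t =>
    obtain ⟨s', hs⟩ := s.exists_mono hL
    obtain ⟨t', ht⟩ := t.exists_mono hL
    exact ⟨.eqNum s' t', fun X x => by simp only [Formula.Holds, hs, ht]⟩
  | le s t =>
    obtain ⟨s', hs⟩ := s.exists_mono hL
    obtain ⟨t', ht⟩ := t.exists_mono hL
    exact ⟨.le s' t', fun X x => by simp only [Formula.Holds, hs, ht]⟩
  | eqStr s t =>
    obtain ⟨s', hs⟩ := s.exists_mono hL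
    obtain ⟨t', ht⟩ := t.exists_mono hL
    exact ⟨.eqStr s' t', fun X x => by simp only [Formula.Holds, hs, ht]⟩
  | mem s t =>
    obtain ⟨s', hs⟩ := s.exists_mono hL
    obtain ⟨t', ht⟩ := t.exists_mono hL
    exact ⟨.mem s' t', fun X x => by simp only [Formula.Holds, hs, ht]⟩
  | rel R hR s T =>
    choose s' hs using fun i => (s i).exists_mono hL
    choose T' hT using fun i => (T i).exists_mono hL
    exact ⟨.rel R (hL hR) s' T', fun X x => by simp only [Formula.Holds, hs, hT]⟩
  | neg φ ih =>
    obtain ⟨φ', h⟩ := ih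
    exact ⟨.neg φ', fun X x => by simp only [Formula.Holds, h]⟩
  | and φ ψ ih₁ ih₂ =>
    obtain ⟨φ', h₁⟩ := ih₁
    obtain ⟨ψ', h₂⟩ := ih₂
    exact ⟨.and φ' ψ', fun X x => by simp only [Formula.Holds, h₁, h₂]⟩
  | or φ ψ ih₁ ih₂ =>
    obtain ⟨φ', h₁⟩ := ih₁
    obtain ⟨ψ', h₂⟩ := ih₂
    exact ⟨.or φ' ψ', fun X x => by simp only [Formula.Holds, h₁, h₂]⟩
  | exLe t φ ih =>
    obtain ⟨t', ht⟩ := t.exists_mono hL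
    obtain ⟨φ', h⟩ := ih
    exact ⟨.exLe t' φ', fun X x => by simp only [Formula.Holds, h, ht]⟩
  | allLe t φ ih =>
    obtain ⟨t', ht⟩ := t.exists_mono hL
    obtain ⟨φ', h⟩ := ih
    exact ⟨.allLe t' φ', fun X x => by simp only [Formula.Holds, h, ht]⟩

theorem SigmaDefinable.mono (hL : L ⊆ L') {O : Obj} (h : SigmaDefinable L O) :
    SigmaDefinable L' O := by
  cases O with
  | num f =>
    obtain ⟨hp, φ, hφ⟩ := h
    obtain ⟨φ', h'⟩ := φ.exists_mono hL
    exact ⟨hp, φ', fun x X y => (hφ x X y).trans (h' _ _).symm⟩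
  | str F =>
    obtain ⟨hp, φ, hφ⟩ := h
    obtain ⟨φ', h'⟩ := φ.exists_mono hL
    exact ⟨hp, φ', fun x X y => (hφ x X y).trans (h' _ _).symm⟩
  | rel R =>
    obtain ⟨φ, hφ⟩ := h
    obtain ⟨φ', h'⟩ := φ.exists_mono hL
    exact ⟨φ', fun x X => (hφ x X).trans (h' _ _).symm⟩

/-! ### A formula uses finitely many symbols -/

mutual

theorem NumTerm.exists_finite_vocabulary : ∀ t : NumTerm L a b,
    ∃ S ⊆ L, S.Finite ∧ ∃ t' : NumTerm S a b, ∀ x X, t'.eval x X = t.eval x X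
  | .var i => ⟨∅, Set.empty_subset _, Set.finite_empty, .var i, fun x X => by
      simp only [NumTerm.eval]⟩
  | .zero => ⟨∅, Set.empty_subset _, Set.finite_empty, .zero, fun x X => by
      simp only [NumTerm.eval]⟩
  | .one => ⟨∅, Set.empty_subset _, Set.finite_empty, .one, fun x X => by
      simp only [NumTerm.eval]⟩
  | .add s t => by
      obtain ⟨S, hS, fS, s', hs⟩ := NumTerm.exists_finite_vocabulary s
      obtain ⟨T, hT, fT, t', ht⟩ := NumTerm.exists_finite_vocabulary t
      obtain ⟨s'', hs'⟩ := s'.exists_mono (Set.subset_union_left (t := T))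
      obtain ⟨t'', ht'⟩ := t'.exists_mono (Set.subset_union_right (s := S))
      exact ⟨S ∪ T, Set.union_subset hS hT, fS.union fT, .add s'' t'', fun x X => by
        simp only [NumTerm.eval, hs', ht', hs, ht]⟩
  | .mul s t => by
      obtain ⟨S, hS, fS, s', hs⟩ := NumTerm.exists_finite_vocabulary s
      obtain ⟨T, hT, fT, t', ht⟩ := NumTerm.exists_finite_vocabulary t
      obtain ⟨s'', hs'⟩ := s'.exists_mono (Set.subset_union_left (t := T))
      obtain ⟨t'', ht'⟩ := t'.exists_mono (Set.subset_union_right (s := S))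
      exact ⟨S ∪ T, Set.union_subset hS hT, fS.union fT, .mul s'' t'', fun x X => by
        simp only [NumTerm.eval, hs', ht', hs, ht]⟩
  | .len T => by
      obtain ⟨S, hS, fS, T', hT⟩ := StrTerm.exists_finite_vocabulary T
      exact ⟨S, hS, fS, .len T', fun x X => by simp only [NumTerm.eval, hT]⟩
  | .app f hf s T => by
      choose S hS fS s' hs using fun i => NumTerm.exists_finite_vocabulary (s i)
      choose U hU fU T' hT using fun i => StrTerm.exists_finite_vocabulary (T i)
      have hf' : Obj.num f ∈ {Obj.num f} ∪ ((⋃ i, S i) ∪ ⋃ i, U i) := .inl rfl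
      choose s'' hs' using fun i => (s' i).exists_mono
        (((Set.subset_iUnion S i).trans Set.subset_union_left).trans
          (Set.subset_union_right (s := {Obj.num f}) (t := (⋃ i, S i) ∪ ⋃ i, U i)))
      choose T'' hT' using fun i => (T' i).exists_mono
        (((Set.subset_iUnion U i).trans Set.subset_union_right).trans
          (Set.subset_union_right (s := {Obj.num f}) (t := (⋃ i, S i) ∪ ⋃ i, U i)))
      refine ⟨_, ?_, ?_, .app f hf' s'' T'', fun x X => by
        simp only [NumTerm.eval, hs', hT', hs, hT]⟩
      · exact Set.union_subset (Set.singleton_subset_iff.2 hf)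
          (Set.union_subset (Set.iUnion_subset hS) (Set.iUnion_subset hU))
      · exact (Set.finite_singleton _).union
          ((Set.finite_iUnion fS).union (Set.finite_iUnion fU))

theorem StrTerm.exists_finite_vocabulary : ∀ T : StrTerm L a b,
    ∃ S ⊆ L, S.Finite ∧ ∃ T' : StrTerm S a b, ∀ x X, T'.eval x X = T.eval x X
  | .var j => ⟨∅, Set.empty_subset _, Set.finite_empty, .var j, fun x X => by
      simp only [StrTerm.eval]⟩
  | .app F hF s T => by
      choose S hS fS s' hs using fun i => NumTerm.exists_finite_vocabulary (s i)
      choose U hU fU T' hT using fun i => StrTerm.exists_finite_vocabulary (T i)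
      have hF' : Obj.str F ∈ {Obj.str F} ∪ ((⋃ i, S i) ∪ ⋃ i, U i) := .inl rfl
      choose s'' hs' using fun i => (s' i).exists_mono
        (((Set.subset_iUnion S i).trans Set.subset_union_left).trans
          (Set.subset_union_right (s := {Obj.str F}) (t := (⋃ i, S i) ∪ ⋃ i, U i)))
      choose T'' hT' using fun i => (T' i).exists_mono
        (((Set.subset_iUnion U i).trans Set.subset_union_right).trans
          (Set.subset_union_right (s := {Obj.str F}) (t := (⋃ i, S i) ∪ ⋃ i, U i)))
      refine ⟨_, ?_, ?_, .app F hF' s'' T'', fun x X => by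
        simp only [StrTerm.eval, hs', hT', hs, hT]⟩
      · exact Set.union_subset (Set.singleton_subset_iff.2 hF)
          (Set.union_subset (Set.iUnion_subset hS) (Set.iUnion_subset hU))
      · exact (Set.finite_singleton _).union
          ((Set.finite_iUnion fS).union (Set.finite_iUnion fU))

end

theorem Formula.exists_finite_vocabulary (φ : Formula L b a) :
    ∃ S ⊆ L, S.Finite ∧ ∃ φ' : Formula S b a, ∀ X x, φ'.Holds X x ↔ φ.Holds X x := by
  induction φ with
  | eqNum s t =>
    obtain ⟨S, hS, fS, s', hs⟩ := s.exists_finite_vocabulary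
    obtain ⟨T, hT, fT, t', ht⟩ := t.exists_finite_vocabulary
    obtain ⟨s'', hs'⟩ := s'.exists_mono (Set.subset_union_left (t := T))
    obtain ⟨t'', ht'⟩ := t'.exists_mono (Set.subset_union_right (s := S))
    exact ⟨S ∪ T, Set.union_subset hS hT, fS.union fT, .eqNum s'' t'', fun x X => by
      simp only [Formula.Holds, hs', ht', hs, ht]⟩
  | le s t =>
    obtain ⟨S, hS, fS, s', hs⟩ := s.exists_finite_vocabulary
    obtain ⟨T, hT, fT, t', ht⟩ := t.exists_finite_vocabulary
    obtain ⟨s'', hs'⟩ := s'.exists_mono (Set.subset_union_left (t := T))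
    obtain ⟨t'', ht'⟩ := t'.exists_mono (Set.subset_union_right (s := S))
    exact ⟨S ∪ T, Set.union_subset hS hT, fS.union fT, .le s'' t'', fun x X => by
      simp only [Formula.Holds, hs', ht', hs, ht]⟩
  | eqStr s t =>
    obtain ⟨S, hS, fS, s', hs⟩ := s.exists_finite_vocabulary
    obtain ⟨T, hT, fT, t', ht⟩ := t.exists_finite_vocabulary
    obtain ⟨s'', hs'⟩ := s'.exists_mono (Set.subset_union_left (t := T))
    obtain ⟨t'', ht'⟩ := t'.exists_mono (Set.subset_union_right (s := S))
    exact ⟨S ∪ T, Set.union_subset hS hT, fS.union fT, .eqStr s'' t'', fun x X => by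
      simp only [Formula.Holds, hs', ht', hs, ht]⟩
  | mem s t =>
    obtain ⟨S, hS, fS, s', hs⟩ := s.exists_finite_vocabulary
    obtain ⟨T, hT, fT, t', ht⟩ := t.exists_finite_vocabulary
    obtain ⟨s'', hs'⟩ := s'.exists_mono (Set.subset_union_left (t := T))
    obtain ⟨t'', ht'⟩ := t'.exists_mono (Set.subset_union_right (s := S))
    exact ⟨S ∪ T, Set.union_subset hS hT, fS.union fT, .mem s'' t'', fun x X => by
      simp only [Formula.Holds, hs', ht', hs, ht]⟩
  | rel R hR s T =>
    choose S hS fS s' hs using fun i => NumTerm.exists_finite_vocabulary (s i)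
    choose U hU fU T' hT using fun i => StrTerm.exists_finite_vocabulary (T i)
    have hR' : Obj.rel R ∈ {Obj.rel R} ∪ ((⋃ i, S i) ∪ ⋃ i, U i) := .inl rfl
    choose s'' hs' using fun i => (s' i).exists_mono
      (((Set.subset_iUnion S i).trans Set.subset_union_left).trans
        (Set.subset_union_right (s := {Obj.rel R}) (t := (⋃ i, S i) ∪ ⋃ i, U i)))
    choose T'' hT' using fun i => (T' i).exists_mono
      (((Set.subset_iUnion U i).trans Set.subset_union_right).trans
        (Set.subset_union_right (s := {Obj.rel R}) (t := (⋃ i, S i) ∪ ⋃ i, U i)))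
    refine ⟨_, ?_, ?_, .rel R hR' s'' T'', fun x X => by
      simp only [Formula.Holds, hs', hT', hs, hT]⟩
    · exact Set.union_subset (Set.singleton_subset_iff.2 hR)
        (Set.union_subset (Set.iUnion_subset hS) (Set.iUnion_subset hU))
    · exact (Set.finite_singleton _).union
        ((Set.finite_iUnion fS).union (Set.finite_iUnion fU))
  | neg φ ih =>
    obtain ⟨S, hS, fS, φ', h⟩ := ih
    exact ⟨S, hS, fS, .neg φ', fun X x => by simp only [Formula.Holds, h]⟩
  | and φ ψ ih₁ ih₂ =>
    obtain ⟨S, hS, fS, φ₁, h₁⟩ := ih₁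
    obtain ⟨T, hT, fT, ψ₁, h₂⟩ := ih₂
    obtain ⟨φ₂, h₁'⟩ := φ₁.exists_mono (Set.subset_union_left (t := T))
    obtain ⟨ψ₂, h₂'⟩ := ψ₁.exists_mono (Set.subset_union_right (s := S))
    exact ⟨S ∪ T, Set.union_subset hS hT, fS.union fT, .and φ₂ ψ₂, fun x X => by
      simp only [Formula.Holds, h₁, h₁', h₂, h₂']⟩
  | or φ ψ ih₁ ih₂ =>
    obtain ⟨S, hS, fS, φ₁, h₁⟩ := ih₁
    obtain ⟨T, hT, fT, ψ₁, h₂⟩ := ih₂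
    obtain ⟨φ₂, h₁'⟩ := φ₁.exists_mono (Set.subset_union_left (t := T))
    obtain ⟨ψ₂, h₂'⟩ := ψ₁.exists_mono (Set.subset_union_right (s := S))
    exact ⟨S ∪ T, Set.union_subset hS hT, fS.union fT, .or φ₂ ψ₂, fun x X => by
      simp only [Formula.Holds, h₁, h₁', h₂, h₂']⟩
  | exLe t φ ih =>
    obtain ⟨S, hS, fS, φ₁, h₁⟩ := ih
    obtain ⟨T, hT, fT, t₁, ht⟩ := t.exists_finite_vocabulary
    obtain ⟨φ₂, h₁'⟩ := φ₁.exists_mono (Set.subset_union_left (t := T))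
    obtain ⟨t₂, ht'⟩ := t₁.exists_mono (Set.subset_union_right (s := S))
    exact ⟨S ∪ T, Set.union_subset hS hT, fS.union fT, .exLe t₂ φ₂, fun x X => by
      simp only [Formula.Holds, h₁, h₁', ht, ht']⟩
  | allLe t φ ih =>
    obtain ⟨S, hS, fS, φ₁, h₁⟩ := ih
    obtain ⟨T, hT, fT, t₁, ht⟩ := t.exists_finite_vocabulary
    obtain ⟨φ₂, h₁'⟩ := φ₁.exists_mono (Set.subset_union_left (t := T))
    obtain ⟨t₂, ht'⟩ := t₁.exists_mono (Set.subset_union_right (s := S))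
    exact ⟨S ∪ T, Set.union_subset hS hT, fS.union fT, .allLe t₂ φ₂, fun x X => by
      simp only [Formula.Holds, h₁, h₁', ht, ht']⟩

/-- A `Σ₀ᴮ` definition from an arbitrary collection is one from a finite subcollection. -/
theorem SigmaDefinable.exists_finite_vocabulary {O : Obj} (h : SigmaDefinable L O) :
    ∃ S ⊆ L, S.Finite ∧ SigmaDefinable S O := by
  cases O with
  | num f =>
    obtain ⟨hp, φ, hφ⟩ := h
    obtain ⟨S, hS, fS, φ', h'⟩ := φ.exists_finite_vocabulary
    exact ⟨S, hS, fS, hp, φ', fun x X y => (hφ x X y).trans (h' _ _).symm⟩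
  | str F =>
    obtain ⟨hp, φ, hφ⟩ := h
    obtain ⟨S, hS, fS, φ', h'⟩ := φ.exists_finite_vocabulary
    exact ⟨S, hS, fS, hp, φ', fun x X y => (hφ x X y).trans (h' _ _).symm⟩
  | rel R =>
    obtain ⟨φ, hφ⟩ := h
    obtain ⟨S, hS, fS, φ', h'⟩ := φ.exists_finite_vocabulary
    exact ⟨S, hS, fS, φ', fun x X => (hφ x X).trans (h' _ _).symm⟩

end Terms


/-! ### Chains of definitions -/

/-- A string function together with its arities. -/
abbrev SomeStrFun : Type := Σ p : ℕ × ℕ, StrFun p.1 p.2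

/-- The object given by a string function with its arities. -/
def SomeStrFun.obj (F : SomeStrFun) : Obj := .str F.2

/-- The objects that occur in a list of string functions. -/
def objects (l : List SomeStrFun) : Set Obj := {O | ∃ F ∈ l, O = F.obj}

theorem objects_mono {l m : List SomeStrFun} (h : l ⊆ m) : objects l ⊆ objects m :=
  fun _ ⟨F, hF, hO⟩ => ⟨F, h hF, hO⟩

/-- A chain of definitions over `L`, latest definition first: each function of the list is
`Σ₀ᴮ`-definable from `L` and the functions after it in the list. -/
inductive DefChain (L : Set Obj) : List SomeStrFun → Prop
  | nil : DefChain L []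
  | cons {F : SomeStrFun} {l : List SomeStrFun} (hl : DefChain L l)
      (hF : SigmaDefinable (L ∪ objects l) F.obj) : DefChain L (F :: l)

theorem DefChain.append {L : Set Obj} {l m : List SomeStrFun} (hm : DefChain L m)
    (hl : DefChain L l) : DefChain L (m ++ l) := by
  induction hm with
  | nil => exact hl
  | cons _ hF ih =>
    exact ih.cons (hF.mono (Set.union_subset_union_right _
      (objects_mono (List.subset_append_left _ _))))

/-- The functions of a chain, in the indexed form in which `AC⁰`-reducibility refers to them:
earlier definitions have larger indices. -/
theorem DefChain.sigmaDefinable {L : Set Obj} {l : List SomeStrFun} (hl : DefChain L l) :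
    ∀ i : Fin l.length,
      SigmaDefinable (L ∪ {O | ∃ j > i, O = (l.get j).obj}) (l.get i).obj := by
  induction hl with
  | nil => exact fun i => i.elim0
  | @cons F l _ hF ih =>
    intro i
    induction i using Fin.cases with
    | zero =>
      refine hF.mono (Set.union_subset_union_right _ ?_)
      rintro _ ⟨G, hG, rfl⟩
      obtain ⟨j, rfl⟩ := List.get_of_mem hG
      exact ⟨j.succ, Fin.succ_pos j, rfl⟩
    | succ i =>
      refine (ih i).mono (Set.union_subset_union_right _ ?_)
      rintro _ ⟨j, hj, rfl⟩
      exact ⟨j.succ, Fin.succ_lt_succ_iff.2 hj, rfl⟩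

theorem ac0Reducible_iff_exists_defChain {L : Set Obj} {G : Obj} :
    AC0Reducible L G ↔ ∃ l, DefChain L l ∧ SigmaDefinable (L ∪ objects l) G := by
  constructor
  · rintro ⟨n, a, b, F, hF, hG⟩
    have key : ∀ m ≤ n, ∃ l, DefChain L l ∧
        ∀ O, O ∈ objects l ↔ ∃ j : Fin n, j.val < m ∧ O = .str (F j) := by
      intro m hm
      induction m with
      | zero => exact ⟨[], .nil, fun O => by simp [objects]⟩
      | succ m ih =>
        obtain ⟨l, hl, hO⟩ := ih (by omega)
        refine ⟨⟨(_, _), F ⟨m, hm⟩⟩ :: l, hl.cons ((hF ⟨m, hm⟩).mono ?_), fun O => ?_⟩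
        · refine Set.union_subset_union_right _ ?_
          rintro O ⟨j, hj, rfl⟩
          exact (hO _).2 ⟨j, hj, rfl⟩
        · constructor
          · rintro ⟨G, hG, rfl⟩
            rcases List.mem_cons.1 hG with rfl | hG
            · exact ⟨⟨m, hm⟩, Nat.lt_succ_self m, rfl⟩
            · obtain ⟨j, hj, h⟩ := (hO _).1 ⟨G, hG, rfl⟩
              exact ⟨j, by omega, h⟩
          · rintro ⟨j, hj, rfl⟩
            rcases Nat.lt_succ_iff_lt_or_eq.1 hj with hj | hj
            · exact objects_mono (List.subset_cons_self _ _) ((hO _).2 ⟨j, hj, rfl⟩)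
            · obtain rfl : j = ⟨m, hm⟩ := Fin.ext hj
              exact ⟨_, List.mem_cons_self, rfl⟩
    obtain ⟨l, hl, hO⟩ := key n le_rfl
    refine ⟨l, hl, hG.mono (Set.union_subset_union_right _ ?_)⟩
    rintro O ⟨j, rfl⟩
    exact (hO _).2 ⟨j, j.2, rfl⟩
  · rintro ⟨l, hl, hG⟩
    refine ⟨l.length, fun i => (l.get i.rev).1.1, fun i => (l.get i.rev).1.2,
      fun i => (l.get i.rev).2, fun i => ?_, ?_⟩
    · refine (hl.sigmaDefinable i.rev).mono (Set.union_subset_union_right _ ?_)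
      rintro O ⟨j, hj, rfl⟩
      exact ⟨j.rev, Fin.rev_lt_iff.1 hj, (congrArg (fun k => (l.get k).obj) j.rev_rev).symm⟩
    · refine hG.mono (Set.union_subset_union_right _ ?_)
      rintro O ⟨F, hF, rfl⟩
      obtain ⟨j, rfl⟩ := List.get_of_mem hF
      exact ⟨j.rev, (congrArg (fun k => (l.get k).obj) j.rev_rev).symm⟩

/-- Reducibility to `L` implies reducibility to `L'` if every member of `L` is a string function
that occurs in a chain of definitions over `L'`. The reason is that only finitely many members of
`L` occur in a given chain, and the chains that define these can be executed before it. -/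
theorem AC0Reducible.trans {L L' : Set Obj}
    (hL : ∀ O ∈ L, ∃ l, DefChain L' l ∧ O ∈ objects l) {G : Obj} (hG : AC0Reducible L G) :
    AC0Reducible L' G := by
  -- one chain over `L'` for finitely many members of `L`
  have hfin : ∀ S : Set Obj, S.Finite → S ⊆ L → ∃ l, DefChain L' l ∧ S ⊆ objects l := by
    intro S hS
    induction S, hS using Set.Finite.induction_on with
    | empty => exact fun _ => ⟨[], .nil, Set.empty_subset _⟩
    | insert _ _ ih =>
      intro h
      obtain ⟨l, hl, hS⟩ := ih ((Set.subset_insert _ _).trans h)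
      obtain ⟨m, hm, hO⟩ := hL _ (h (Set.mem_insert _ _))
      exact ⟨m ++ l, hm.append hl, Set.insert_subset
        (objects_mono (List.subset_append_left _ _) hO)
        (hS.trans (objects_mono (List.subset_append_right _ _)))⟩
  -- one definition from `L` and the functions of `l`, if `l` is already available over `L'`
  have hstep : ∀ {l l' : List SomeStrFun} {O : Obj}, DefChain L' l' → l ⊆ l' →
      SigmaDefinable (L ∪ objects l) O →
      ∃ m, DefChain L' m ∧ l ⊆ m ∧ SigmaDefinable (L' ∪ objects m) O := by
    intro l l' O hl' hll hO
    obtain ⟨S, hS, fS, hO⟩ := hO.exists_finite_vocabulary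
    obtain ⟨m, hm, hSm⟩ := hfin (S ∩ L) (fS.inter_of_left _) Set.inter_subset_right
    refine ⟨m ++ l', hm.append hl',
      List.Subset.trans hll (List.subset_append_right _ _), hO.mono fun P hP => .inr ?_⟩
    rcases hS hP with h | h
    · exact objects_mono (List.subset_append_left _ _) (hSm ⟨hP, h⟩)
    · exact objects_mono (List.Subset.trans hll (List.subset_append_right _ _)) h
  obtain ⟨l, hl, hG⟩ := ac0Reducible_iff_exists_defChain.1 hG
  have hchain : ∃ l', DefChain L' l' ∧ l ⊆ l' := by
    clear hG
    induction hl with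
    | nil => exact ⟨[], .nil, List.Subset.refl _⟩
    | @cons F l _ hF ih =>
      obtain ⟨l', hl', hll⟩ := ih
      obtain ⟨m, hm, hlm, hF⟩ := hstep hl' hll hF
      exact ⟨F :: m, hm.cons hF, List.cons_subset_cons _ hlm⟩
  obtain ⟨l', hl', hll⟩ := hchain
  obtain ⟨m, hm, -, hG⟩ := hstep hl' hll hG
  exact ac0Reducible_iff_exists_defChain.2 ⟨m, hm, hG⟩

/-! ### Polynomial bounds -/

/-- In the base vocabulary number terms are polynomials, since the only string terms are
variables. -/
theorem NumTerm.exists_mvPolynomial {a b : ℕ} : ∀ t : NumTerm ∅ a b,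
    ∃ p : MvPolynomial (Fin a ⊕ Fin b) ℕ, ∀ x X,
      t.eval x X = MvPolynomial.eval (Sum.elim x fun j => strLen (X j)) p
  | .var i => ⟨.X (.inl i), fun x X => by simp [NumTerm.eval]⟩
  | .zero => ⟨0, fun x X => by simp [NumTerm.eval]⟩
  | .one => ⟨1, fun x X => by simp [NumTerm.eval]⟩
  | .add s t => by
      obtain ⟨p, hp⟩ := exists_mvPolynomial s
      obtain ⟨q, hq⟩ := exists_mvPolynomial t
      exact ⟨p + q, fun x X => by simp [NumTerm.eval, hp, hq]⟩
  | .mul s t => by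
      obtain ⟨p, hp⟩ := exists_mvPolynomial s
      obtain ⟨q, hq⟩ := exists_mvPolynomial t
      exact ⟨p * q, fun x X => by simp [NumTerm.eval, hp, hq]⟩
  | .len (.var j) => ⟨.X (.inr j), fun x X => by simp [NumTerm.eval, StrTerm.eval]⟩

theorem strLen_le_iff {X : Finset ℕ} {k : ℕ} : strLen X ≤ k ↔ ∀ i ∈ X, i < k := by
  simp [strLen]

theorem lt_strLen_of_mem {X : Finset ℕ} {i : ℕ} (h : i ∈ X) : i < strLen X :=
  strLen_le_iff.1 le_rfl i h

theorem strLen_toBits_le {m k : ℕ} (h : m < 2 ^ k) : strLen (toBits m) ≤ k := by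
  rw [strLen_le_iff]
  intro i hi
  have := Nat.two_pow_le_of_mem_bitIndices (List.mem_toFinset.1 hi)
  exact (Nat.pow_lt_pow_iff_right (by norm_num)).1 (this.trans_lt h)

theorem toBits_bin (X : Finset ℕ) : toBits (bin X) = X :=
  Finset.toFinset_bitIndices_sum_two_pow X

theorem ncard_stPaths_le (n s t p : ℕ) (G : Finset ℕ) :
    (stPaths n s t p G).ncard ≤ (n + 1) ^ (p + 1) := by
  have h := Set.ncard_le_ncard_of_injOn (s := stPaths n s t p G)
    (t := (Set.univ : Set (Fin (p + 1) → Option (Fin n))))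
    -- a path is determined by its vertices at the places `0,…,p`
    (fun l i => l[i.val]?) (fun _ _ => Set.mem_univ _) ?_
  · simpa [Set.ncard_univ] using h
  · intro l hl m hm hlm
    refine List.ext_getElem? fun i => ?_
    by_cases hi : i < p + 1
    · exact congrFun hlm ⟨i, hi⟩
    · rw [List.getElem?_eq_none (by have := hl.2.2.2; omega),
        List.getElem?_eq_none (by have := hm.2.2.2; omega)]

theorem strLen_sharpSTCON_le (x : Fin 4 → ℕ) (X : Fin 1 → Finset ℕ) :
    strLen (sharpSTCON x X) ≤ x 0 * (x 3 + 1) + 1 := by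
  unfold sharpSTCON
  split_ifs
  · refine strLen_toBits_le ((ncard_stPaths_le _ _ _ _ _).trans_lt ?_)
    calc (x 0 + 1) ^ (x 3 + 1) ≤ (2 ^ x 0) ^ (x 3 + 1) :=
          Nat.pow_le_pow_left (Nat.lt_two_pow_self) _
      _ = 2 ^ (x 0 * (x 3 + 1)) := (pow_mul _ _ _).symm
      _ < 2 ^ (x 0 * (x 3 + 1) + 1) := Nat.pow_lt_pow_right (by norm_num) (Nat.lt_succ_self _)
  · simp [strLen]

/-! ### Reductions to `#STCON` -/

theorem SigmaBitDefinable.sigmaDefinable {a b : ℕ} {H : StrFun a b}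
    (h : SigmaBitDefinable ∅ H) : SigmaDefinable ∅ (.str H) := by
  obtain ⟨t, φ, h⟩ := h
  obtain ⟨p, hp⟩ := t.exists_mvPolynomial
  refine ⟨⟨p, fun x X => ?_⟩, ?_⟩
  · rw [← hp, strLen_le_iff]
    exact fun i hi => ((h x X i).1 hi).1
  · refine ⟨.and (.le (.add (.var 0) .one)
      (t.subst (Set.Subset.refl _) fun i => .var i.succ)) φ, fun x X i => ?_⟩
    rw [h]
    simp [Formula.Holds, NumTerm.eval, NumTerm.eval_subst]

theorem sharpSTCON_sigmaDefinable {L : Set Obj} (hL : Obj.str sharpSTCON ∈ L) :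
    SigmaDefinable L (.str sharpSTCON) := by
  refine ⟨⟨.X (.inl 0) * (.X (.inl 3) + 1) + 1, fun x X => ?_⟩,
    .mem (.var 0) (.app sharpSTCON hL (fun i => .var i.succ) .var), fun x X i => ?_⟩
  · simpa using strLen_sharpSTCON_le x X
  · simp [Formula.Holds, NumTerm.eval, StrTerm.eval]

theorem sigmaDefinable_of_eq_sharpSTCON {L : Set Obj} {a b : ℕ} {F H : StrFun a b}
    {n p : NumTerm ∅ a b} (hL : Obj.str sharpSTCON ∈ L) (hH : Obj.str H ∈ L)
    (hF : ∀ x X, F x X = sharpSTCON ![n.eval x X, 0, 1, p.eval x X] ![H x X]) :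
    SigmaDefinable L (.str F) := by
  constructor
  · obtain ⟨q, hq⟩ := n.exists_mvPolynomial
    obtain ⟨r, hr⟩ := p.exists_mvPolynomial
    refine ⟨q * (r + 1) + 1, fun x X => ?_⟩
    have := strLen_sharpSTCON_le ![n.eval x X, 0, 1, p.eval x X] ![H x X]
    simp only [hF]
    simpa [hq, hr] using this
  · refine ⟨.mem (.var 0) (.app sharpSTCON hL
      ![n.subst (Set.empty_subset _) fun i => .var i.succ, .zero, .one,
        p.subst (Set.empty_subset _) fun i => .var i.succ]
      ![.app H hH (fun i => .var i.succ) .var]), fun x X i => ?_⟩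
    simp only [Formula.Holds, NumTerm.eval, StrTerm.eval, hF, Fin.cons_zero]
    refine iff_of_eq (congrArg (i ∈ ·) (congrArg₂ sharpSTCON ?_ ?_))
    · funext k
      fin_cases k <;> simp [NumTerm.eval, NumTerm.eval_subst]
    · funext k
      fin_cases k
      simp [StrTerm.eval, NumTerm.eval]

/-- If `F` arises from `#STCON` by substituting number terms and a `Σ₀ᴮ`-bit-definable `H`, then
`H` followed by `F` is a chain of definitions over `#STCON`. -/
theorem exists_defChain_sharpSTCON {a b : ℕ} {F H : StrFun a b} {n p : NumTerm ∅ a b}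
    (hH : SigmaBitDefinable ∅ H)
    (hF : ∀ x X, F x X = sharpSTCON ![n.eval x X, 0, 1, p.eval x X] ![H x X]) :
    ∃ l, DefChain {.str sharpSTCON} l ∧ Obj.str F ∈ objects l :=
  ⟨[⟨(a, b), F⟩, ⟨(a, b), H⟩],
    .cons (.cons .nil (hH.sigmaDefinable.mono (Set.empty_subset _)))
      (sigmaDefinable_of_eq_sharpSTCON (.inl rfl)
        (.inr ⟨⟨(a, b), H⟩, List.mem_cons_self, rfl⟩) hF),
    ⟨(a, b), F⟩, List.mem_cons_self, rfl⟩

/-- `#STCON` is complete for `DET` once it belongs to `#L` and every function of `#L` is obtained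
from it by substituting number terms and a `Σ₀ᴮ`-bit-definable string function. -/
theorem ac0Complete_sharpSTCON (hmem : Obj.str sharpSTCON ∈ SharpL)
    (h : ∀ {a b : ℕ} (F : StrFun a b), Obj.str F ∈ SharpL →
      ∃ (H : StrFun a b) (n p : NumTerm ∅ a b), SigmaBitDefinable ∅ H ∧
        ∀ x X, 2 ≤ n.eval x X ∧
          F x X = sharpSTCON ![n.eval x X, 0, 1, p.eval x X] ![H x X]) :
    AC0Complete (.str sharpSTCON) DET := by
  refine ⟨⟨.inr ⟨_, _, _, rfl⟩, ?_⟩, fun G hG => hG.2.trans fun O hO => ?_⟩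
  · exact ac0Reducible_iff_exists_defChain.2 ⟨[], .nil, sharpSTCON_sigmaDefinable (.inl hmem)⟩
  · obtain ⟨a, b, F, _, rfl, -⟩ := id hO
    obtain ⟨H, n, p, hH, hF⟩ := h F hO
    exact exists_defChain_sharpSTCON hH fun x X => (hF x X).2


/-! ### Definable relations of environments

To avoid de Bruijn indices, relations of an environment `V → ℕ`, with an arbitrary type `V` of
variables, and of the strings are considered; definability of a relation means that each
substitution instance of it is expressed by a formula. -/

section Definability

variable {b : ℕ} {V : Type}

/-- Functions given by number terms of the base vocabulary, under every substitution of terms for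
the variables in `V`. -/
def TermDefinable (f : (V → ℕ) → (Fin b → Finset ℕ) → ℕ) : Prop :=
  ∀ ⦃a : ℕ⦄ (g : V → NumTerm ∅ a b), ∃ t : NumTerm ∅ a b, ∀ x X,
    t.eval x X = f (fun v => (g v).eval x X) X

/-- Relations expressed by `Σ₀ᴮ` formulas of the base vocabulary, under every substitution of terms
for the variables in `V`. -/
def RelDefinable (P : (V → ℕ) → (Fin b → Finset ℕ) → Prop) : Prop :=
  ∀ ⦃a : ℕ⦄ (g : V → NumTerm ∅ a b), ∃ φ : Formula ∅ b a, ∀ x X,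
    φ.Holds X x ↔ P (fun v => (g v).eval x X) X

namespace TermDefinable

variable {f g : (V → ℕ) → (Fin b → Finset ℕ) → ℕ}

theorem var (v : V) : TermDefinable (b := b) fun x _ => x v :=
  fun _ h => ⟨h v, fun _ _ => rfl⟩

theorem strLen (j : Fin b) : TermDefinable (V := V) fun _ X => strLen (X j) :=
  fun _ _ => ⟨.len (.var j), fun x X => by simp only [NumTerm.eval, StrTerm.eval]⟩

theorem add (hf : TermDefinable f) (hg : TermDefinable g) :
    TermDefinable fun x X => f x X + g x X := fun _ h => by
  obtain ⟨s, hs⟩ := hf h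
  obtain ⟨t, ht⟩ := hg h
  exact ⟨.add s t, fun x X => by simp only [NumTerm.eval, hs, ht]⟩

theorem mul (hf : TermDefinable f) (hg : TermDefinable g) :
    TermDefinable fun x X => f x X * g x X := fun _ h => by
  obtain ⟨s, hs⟩ := hf h
  obtain ⟨t, ht⟩ := hg h
  exact ⟨.mul s t, fun x X => by simp only [NumTerm.eval, hs, ht]⟩

theorem const (n : ℕ) : TermDefinable (V := V) (b := b) fun _ _ => n := by
  induction n with
  | zero => exact fun _ _ => ⟨.zero, fun x X => by simp only [NumTerm.eval]⟩
  | succ n ih => exact ih.add fun _ _ => ⟨.one, fun x X => by simp only [NumTerm.eval]⟩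

theorem pow (hf : TermDefinable f) (n : ℕ) : TermDefinable fun x X => f x X ^ n := by
  induction n with
  | zero => simpa using const 1
  | succ n ih => simpa only [pow_succ] using ih.mul hf

theorem sum {ι : Type} (s : Finset ι) {f : ι → (V → ℕ) → (Fin b → Finset ℕ) → ℕ}
    (hf : ∀ i, TermDefinable (f i)) : TermDefinable fun x X => ∑ i ∈ s, f i x X := by
  induction s using Finset.cons_induction with
  | empty => simpa using const 0
  | cons i s hi ih => simpa only [Finset.sum_cons] using (hf i).add ih

theorem pair (hf : TermDefinable f) (hg : TermDefinable g) :
    TermDefinable fun x X => pair (f x X) (g x X) :=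
  ((hf.add hg).mul ((hf.add hg).add (const 1))).add ((const 2).mul hg)

theorem subst {W : Type} (hf : TermDefinable f) {h : V → (W → ℕ) → (Fin b → Finset ℕ) → ℕ}
    (hh : ∀ v, TermDefinable (h v)) : TermDefinable fun x X => f (fun v => h v x X) X := by
  intro a g
  choose t ht using fun v => hh v g
  obtain ⟨s, hs⟩ := hf t
  exact ⟨s, fun x X => by simp only [hs, ht]⟩

theorem weaken (hf : TermDefinable f) :
    TermDefinable (V := Option V) fun x X => f (fun v => x (some v)) X :=
  hf.subst fun v => var (some v)

theorem exists_numTerm {a : ℕ} {f : (Fin a → ℕ) → (Fin b → Finset ℕ) → ℕ}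
    (hf : TermDefinable f) : ∃ t : NumTerm ∅ a b, ∀ x X, t.eval x X = f x X := by
  obtain ⟨t, ht⟩ := hf .var
  exact ⟨t, fun x X => by simp only [ht, NumTerm.eval]⟩

end TermDefinable

namespace RelDefinable

variable {f g : (V → ℕ) → (Fin b → Finset ℕ) → ℕ} {P Q : (V → ℕ) → (Fin b → Finset ℕ) → Prop}

theorem congr (hP : RelDefinable P) (h : ∀ x X, Q x X ↔ P x X) : RelDefinable Q := by
  have : Q = P := by
    funext x X
    exact propext (h x X)
  exact this ▸ hP

theorem eq (hf : TermDefinable f) (hg : TermDefinable g) :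
    RelDefinable fun x X => f x X = g x X := fun _ h => by
  obtain ⟨s, hs⟩ := hf h
  obtain ⟨t, ht⟩ := hg h
  exact ⟨.eqNum s t, fun x X => by simp only [Formula.Holds, hs, ht]⟩

theorem le (hf : TermDefinable f) (hg : TermDefinable g) :
    RelDefinable fun x X => f x X ≤ g x X := fun _ h => by
  obtain ⟨s, hs⟩ := hf h
  obtain ⟨t, ht⟩ := hg h
  exact ⟨.le s t, fun x X => by simp only [Formula.Holds, hs, ht]⟩

theorem mem (hf : TermDefinable f) (j : Fin b) : RelDefinable fun x X => f x X ∈ X j :=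
  fun _ h => by
    obtain ⟨s, hs⟩ := hf h
    exact ⟨.mem s (.var j), fun x X => by simp only [Formula.Holds, StrTerm.eval, hs]⟩

theorem not (hP : RelDefinable P) : RelDefinable fun x X => ¬ P x X := fun _ h => by
  obtain ⟨φ, hφ⟩ := hP h
  exact ⟨.neg φ, fun x X => by simp only [Formula.Holds, hφ]⟩

theorem and (hP : RelDefinable P) (hQ : RelDefinable Q) :
    RelDefinable fun x X => P x X ∧ Q x X := fun _ h => by
  obtain ⟨φ, hφ⟩ := hP h
  obtain ⟨ψ, hψ⟩ := hQ h
  exact ⟨.and φ ψ, fun x X => by simp only [Formula.Holds, hφ, hψ]⟩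

theorem or (hP : RelDefinable P) (hQ : RelDefinable Q) :
    RelDefinable fun x X => P x X ∨ Q x X := fun _ h => by
  obtain ⟨φ, hφ⟩ := hP h
  obtain ⟨ψ, hψ⟩ := hQ h
  exact ⟨.or φ ψ, fun x X => by simp only [Formula.Holds, hφ, hψ]⟩

theorem const (p : Prop) : RelDefinable (V := V) (b := b) fun _ _ => p := by
  by_cases h : p
  · exact (eq (.const 0) (.const 0)).congr fun _ _ => by simp [h]
  · exact (eq (.const 0) (.const 1)).congr fun _ _ => by simp [h]

theorem exists_finset {ι : Type} (s : Finset ι) {P : ι → (V → ℕ) → (Fin b → Finset ℕ) → Prop}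
    (hP : ∀ i, RelDefinable (P i)) : RelDefinable fun x X => ∃ i ∈ s, P i x X := by
  induction s using Finset.cons_induction with
  | empty => exact (const False).congr fun _ _ => by simp
  | cons i s hi ih => exact ((hP i).or ih).congr fun _ _ => by simp

theorem exists_finite {ι : Type} [Finite ι] {P : ι → (V → ℕ) → (Fin b → Finset ℕ) → Prop}
    (hP : ∀ i, RelDefinable (P i)) : RelDefinable fun x X => ∃ i, P i x X := by
  have := Fintype.ofFinite ι
  exact (exists_finset Finset.univ hP).congr fun _ _ => by simp

theorem forall_finite {ι : Type} [Finite ι] {P : ι → (V → ℕ) → (Fin b → Finset ℕ) → Prop}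
    (hP : ∀ i, RelDefinable (P i)) : RelDefinable fun x X => ∀ i, P i x X :=
  (exists_finite fun i => (hP i).not).not.congr fun _ _ => by simp

theorem subst {W : Type} (hP : RelDefinable P) {h : V → (W → ℕ) → (Fin b → Finset ℕ) → ℕ}
    (hh : ∀ v, TermDefinable (h v)) : RelDefinable fun x X => P (fun v => h v x X) X := by
  intro a g
  choose t ht using fun v => hh v g
  obtain ⟨φ, hφ⟩ := hP t
  exact ⟨φ, fun x X => by simp only [hφ, ht]⟩

theorem exists_le {P : ℕ → (V → ℕ) → (Fin b → Finset ℕ) → Prop} (hf : TermDefinable f)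
    (hP : RelDefinable (V := Option V) fun x X => P (x none) (fun v => x (some v)) X) :
    RelDefinable fun x X => ∃ y ≤ f x X, P y x X := by
  intro a g
  obtain ⟨t, ht⟩ := hf g
  obtain ⟨φ, hφ⟩ := hP (a := a + 1) fun v =>
    v.elim (.var 0) fun v => (g v).subst (Set.Subset.refl _) fun i => .var i.succ
  refine ⟨.exLe t φ, fun x X => ?_⟩
  simp only [Formula.Holds, ht, hφ, Option.elim, NumTerm.eval, NumTerm.eval_subst, Fin.cons_zero,
    Fin.cons_succ]

/-- Bounded quantification over tuples. -/
theorem exists_fin_le {d : ℕ} {P : (Fin d → ℕ) → (V → ℕ) → (Fin b → Finset ℕ) → Prop}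
    (hf : TermDefinable f)
    (hP : RelDefinable (V := Fin d ⊕ V) fun x X =>
      P (fun i => x (.inl i)) (fun v => x (.inr v)) X) :
    RelDefinable fun x X => ∃ w, (∀ i, w i ≤ f x X) ∧ P w x X := by
  induction d generalizing V with
  | zero =>
    have h := hP.subst (h := Sum.elim Fin.elim0 fun v x _ => x v)
      (by rintro (i | v); exacts [i.elim0, .var v])
    refine h.congr fun x X => ?_
    constructor
    · rintro ⟨w, -, hw⟩
      convert hw
      rfl
    · intro hw
      exact ⟨_, fun i => i.elim0, hw⟩
  | succ d ih =>
    have h := exists_le (P := fun y x X => ∃ w : Fin d → ℕ, (∀ i, w i ≤ f x X) ∧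
      P (Fin.cons y w : Fin (d + 1) → ℕ) x X) hf
      (ih (f := fun x X => f (fun v => x (some v)) X)
        (P := fun w x X => P (Fin.cons (x none) w : Fin (d + 1) → ℕ) (fun v => x (some v)) X)
        hf.weaken ?_)
    · refine h.congr fun x X => ?_
      constructor
      · rintro ⟨w, hw, h⟩
        exact ⟨w 0, hw 0, Fin.tail w, fun i => hw i.succ, by rwa [Fin.cons_self_tail]⟩
      · rintro ⟨y, hy, w, hw, h⟩
        exact ⟨Fin.cons y w, Fin.cases hy hw, h⟩
    · have h := hP.subst (W := Fin d ⊕ Option V)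
        (h := Sum.elim (Fin.cons (fun x _ => x (.inr none)) fun i x _ => x (.inl i))
          fun v x _ => x (.inr (some v))) ?_
      · refine h.congr fun x X => iff_of_eq ?_
        congr 1
        funext i
        cases i using Fin.cases <;> simp
      · rintro (i | v)
        · cases i using Fin.cases
          · simpa using TermDefinable.var (Sum.inr none)
          · simpa using TermDefinable.var (Sum.inl _)
        · simpa using TermDefinable.var (Sum.inr (some v))

theorem exists_fintype_le {ι : Type} [Fintype ι]
    {P : (ι → ℕ) → (V → ℕ) → (Fin b → Finset ℕ) → Prop} (hf : TermDefinable f)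
    (hP : RelDefinable (V := ι ⊕ V) fun x X =>
      P (fun i => x (.inl i)) (fun v => x (.inr v)) X) :
    RelDefinable fun x X => ∃ w, (∀ i, w i ≤ f x X) ∧ P w x X := by
  set e := Fintype.equivFin ι
  have h := exists_fin_le (P := fun w x X => P (fun i => w (e i)) x X) hf
    (hP.subst (h := Sum.elim (fun i x _ => x (Sum.inl (e i))) fun v x _ => x (Sum.inr v))
      (by rintro (i | v); exacts [.var _, .var _]))
  refine h.congr fun x X => ?_
  constructor
  · rintro ⟨w, hw, h⟩
    exact ⟨fun i => w (e.symm i), fun i => hw _, by simpa using h⟩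
  · rintro ⟨w, hw, h⟩
    exact ⟨fun i => w (e i), fun i => hw _, h⟩

end RelDefinable

end Definability

/-! ### Coding tuples -/

theorem pair_lt_pair {x y x' y' : ℕ} (h : x + y < x' + y') : pair x y < pair x' y' := by
  unfold pair
  nlinarith [Nat.mul_le_mul h (Nat.succ_le_succ h)]

theorem pair_injective {x y x' y' : ℕ} (h : pair x y = pair x' y') : x = x' ∧ y = y' := by
  rcases lt_trichotomy (x + y) (x' + y') with hlt | heq | hlt
  · exact absurd h (pair_lt_pair hlt).ne
  · unfold pair at h
    rw [heq] at h
    omega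
  · exact absurd h (pair_lt_pair hlt).ne'

theorem pair_mono {x y x' y' : ℕ} (hx : x ≤ x') (hy : y ≤ y') : pair x y ≤ pair x' y' := by
  unfold pair
  gcongr

/-- The code of a tuple of numbers, by iterated pairing. -/
def tupleCode : {d : ℕ} → (Fin d → ℕ) → ℕ
  | 0, _ => 0
  | _ + 1, w => pair (w 0) (tupleCode fun i => w i.succ)

theorem tupleCode_injective {d : ℕ} : Function.Injective (tupleCode (d := d)) := by
  induction d with
  | zero => exact fun _ _ _ => Subsingleton.elim _ _
  | succ d ih =>
    intro w w' h
    obtain ⟨h0, h1⟩ := pair_injective h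
    have := ih h1
    funext i
    cases i using Fin.cases with
    | zero => exact h0
    | succ i => exact congrFun this i

theorem tupleCode_mono {d : ℕ} {w w' : Fin d → ℕ} (h : ∀ i, w i ≤ w' i) :
    tupleCode w ≤ tupleCode w' := by
  induction d with
  | zero => exact le_rfl
  | succ d ih => exact pair_mono (h 0) (ih fun i => h i.succ)

/-- The code of a finite family of numbers. -/
noncomputable def familyCode {ι : Type} [Fintype ι] (w : ι → ℕ) : ℕ :=
  tupleCode fun i => w ((Fintype.equivFin ι).symm i)

theorem familyCode_injective {ι : Type} [Fintype ι] :
    Function.Injective (familyCode (ι := ι)) := by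
  intro w w' h
  funext i
  simpa using congrFun (tupleCode_injective h) (Fintype.equivFin ι i)

theorem familyCode_mono {ι : Type} [Fintype ι] {w w' : ι → ℕ} (h : ∀ i, w i ≤ w' i) :
    familyCode w ≤ familyCode w' :=
  tupleCode_mono fun _ => h _

theorem TermDefinable.tupleCode {b : ℕ} {V : Type} {d : ℕ}
    {w : Fin d → (V → ℕ) → (Fin b → Finset ℕ) → ℕ} (hw : ∀ i, TermDefinable (w i)) :
    TermDefinable fun x X => tupleCode fun i => w i x X := by
  induction d with
  | zero => exact .const 0
  | succ d ih => exact (hw 0).pair (ih fun i => hw i.succ)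

theorem TermDefinable.familyCode {b : ℕ} {V ι : Type} [Fintype ι]
    {w : ι → (V → ℕ) → (Fin b → Finset ℕ) → ℕ} (hw : ∀ i, TermDefinable (w i)) :
    TermDefinable fun x X => familyCode fun i => w i x X :=
  .tupleCode fun _ => hw _


/-! ### Counting paths in a graph that encodes a transition system -/

/-- Membership in `stPaths` in terms of the underlying numbers; in the definition of `stPaths` the
relation between vertices is lifted along the coercion to `ℕ` in the list monad. -/
theorem mem_stPaths {n s t p : ℕ} {G : Finset ℕ} {l : List (Fin n)} :
    l ∈ stPaths n s t p G ↔ l.head?.map Fin.val = some s ∧ l.getLast?.map Fin.val = some t ∧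
      (l.map Fin.val).IsChain (fun u v => pair u v ∈ G) ∧ l.length ≤ p + 1 := by
  have h : (do let a ← l; pure a.val) = l.map Fin.val := by
    rw [bind_pure_comp]
    rfl
  unfold stPaths
  rw [Set.mem_ofPred_eq, h]

theorem isChain_forall_of_head {C : Type} {R : C → C → Prop} {P : C → Prop}
    (hP : ∀ c c', P c → R c c' → P c') {l : List C} {c₀ : C} (h0 : l.head? = some c₀)
    (hl : l.IsChain R) (hc : P c₀) : ∀ c ∈ l, P c := by
  induction l generalizing c₀ with
  | nil => simp
  | cons d l ih =>
    obtain rfl : d = c₀ := by simpa using h0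
    intro c hcl
    rcases List.mem_cons.1 hcl with rfl | hcl
    · exact hc
    · cases l with
      | nil => simp at hcl
      | cons e l =>
        rw [List.isChain_cons_cons] at hl
        exact ih rfl hl.2 (hP _ _ hc hl.1) c hcl

/-- A graph on `{0,…,n-1}` that encodes a transition system with initial state `c₀`: a state `c`
is the vertex `vert c ≥ 2`, the vertex `0` has an edge to `c₀` only, and the states satisfying
`acc` have an edge to the vertex `1`, which has no successors. If all computations are short, the
paths from `0` to `1` correspond to the computations that end in a state satisfying `acc`. -/
theorem encard_stPaths_eq {C : Type} {R : C → C → Prop} {c₀ : C} {acc : C → Prop} {n p : ℕ}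
    {G : Finset ℕ} {vert : C → ℕ} (hn : 2 ≤ n) (hinj : Function.Injective vert)
    (hvert : ∀ c, 2 ≤ vert c)
    (hlen : ∀ l : List C, l.head? = some c₀ → l.IsChain R → l.length + 1 ≤ p)
    (hlt : ∀ l : List C, l.head? = some c₀ → l.IsChain R → ∀ c ∈ l, vert c < n)
    (h0 : ∀ v, pair 0 v ∈ G ↔ v = vert c₀) (h1 : ∀ v, pair 1 v ∉ G)
    (hG : ∀ (l : List C) (c : C), (l ++ [c]).head? = some c₀ → (l ++ [c]).IsChain R →
      ∀ v, pair (vert c) v ∈ G ↔ (acc c ∧ v = 1) ∨ ∃ c', R c c' ∧ v = vert c') :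
    (stPaths n 0 1 p G).encard =
      {l : List C | (l.head? = some c₀ ∧ l.IsChain R) ∧
        ∃ c, l.getLast? = some c ∧ acc c}.encard := by
  have hfinj : Function.Injective (fun l : List C => 0 :: (l.map vert ++ [1])) := by
    intro l m h
    have h' : l.map vert = m.map vert := by simpa using h
    exact List.map_injective_iff.2 hinj h'
  rw [← hfinj.encard_image, ← (List.map_injective_iff.2 Fin.val_injective).encard_image]
  congr 1
  -- the tail of a path starting in the vertex of a reachable state
  have key : ∀ (m : List ℕ) (pre : List C) (c : C), (pre ++ [c]).head? = some c₀ →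
      (pre ++ [c]).IsChain R → m.head? = some (vert c) → m.getLast? = some 1 →
      m.IsChain (fun u v => pair u v ∈ G) →
      ∃ l : List C, m = l.map vert ++ [1] ∧ (pre ++ l).head? = some c₀ ∧ (pre ++ l).IsChain R ∧
        ∃ c, (pre ++ l).getLast? = some c ∧ acc c := by
    intro m
    induction m with
    | nil => intro pre c _ _ h; simp at h
    | cons u m ih =>
      intro pre c hp0 hp hu hlast hm
      obtain rfl : u = vert c := by simpa using hu
      cases m with
      | nil =>
        have : vert c = 1 := by simpa using hlast
        have := hvert c
        omega
      | cons v m =>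
        rw [List.isChain_cons_cons] at hm
        rcases (hG pre c hp0 hp v).1 hm.1 with ⟨hacc, rfl⟩ | ⟨c', hcc', rfl⟩
        · cases m with
          | nil => exact ⟨[c], rfl, hp0, hp, c, by simp, hacc⟩
          | cons w m => exact absurd (List.isChain_cons_cons.1 hm.2).1 (h1 w)
        · obtain ⟨l, hl, hl0, hlc, hla⟩ := ih (pre ++ [c]) c'
            (by cases pre <;> simpa using hp0)
            (by
              rw [List.isChain_append]
              exact ⟨hp, by simp, by simpa using hcc'⟩)
            rfl (by simpa using hlast) hm.2
          exact ⟨c :: l, by simp [hl], by simpa using hl0, by simpa using hlc, by simpa using hla⟩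
  ext m
  constructor
  · rintro ⟨l, hl, rfl⟩
    obtain ⟨hl0, hl1, hc, -⟩ := mem_stPaths.1 hl
    cases l with
    | nil => simp at hl0
    | cons u l =>
      have hu : u.val = 0 := by simpa using hl0
      cases l with
      | nil =>
        have : u.val = 1 := by simpa using hl1
        omega
      | cons v l =>
        rw [List.map_cons, List.map_cons, List.isChain_cons_cons, hu] at hc
        have hv := (h0 _).1 hc.1
        obtain ⟨l', h, h0', h1', h2'⟩ := key ((v :: l).map Fin.val) [] c₀ rfl (by simp)
          (by simp [hv]) (by rw [List.getLast?_map]; simpa using hl1) hc.2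
        refine ⟨l', ⟨⟨h0', h1'⟩, h2'⟩, ?_⟩
        simp only [List.map_cons, hu]
        rw [← h, List.map_cons]
  · rintro ⟨l, ⟨⟨hl0, hlc⟩, c, hlast, hacc⟩, rfl⟩
    have hlt' : ∀ v ∈ 0 :: (l.map vert ++ [1]), v < n := by
      intro v hv
      rcases List.mem_cons.1 hv with rfl | hv
      · omega
      · rcases List.mem_append.1 hv with hv | hv
        · obtain ⟨c, hc, rfl⟩ := List.mem_map.1 hv
          exact hlt l hl0 hlc c hc
        · obtain rfl : v = 1 := by simpa using hv
          omega
    obtain ⟨m, hm⟩ : ∃ m : List (Fin n), m.map Fin.val = 0 :: (l.map vert ++ [1]) :=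
      ⟨(0 :: (l.map vert ++ [1])).pmap Fin.mk hlt', by
        rw [List.map_pmap]; simp only [List.pmap_eq_map, List.map_id']⟩
    refine ⟨m, mem_stPaths.2 ⟨?_, ?_, ?_, ?_⟩, hm⟩
    · rw [← List.head?_map, hm]
      rfl
    · rw [← List.getLast?_map, hm, ← List.cons_append, List.getLast?_append]
      rfl
    · rw [hm]
      have hl' : (l.map vert).IsChain (fun u v => pair u v ∈ G) := by
        rw [List.isChain_map, List.isChain_iff_forall_rel_of_append_cons_cons]
        rintro c c' pre suf rfl
        have h1 : (pre ++ [c]).IsChain R := by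
          have : (pre ++ [c] ++ (c' :: suf)).IsChain R := by simpa using hlc
          exact this.left_of_append
        refine (hG pre c ?_ h1 _).2 (.inr ⟨c', ?_, rfl⟩)
        · cases pre <;> simpa using hl0
        · exact (List.isChain_cons_cons.1 hlc.right_of_append).1
      rw [List.isChain_cons, List.isChain_append]
      refine ⟨fun y hy => ?_, hl', by simp, fun u hu v hv => ?_⟩
      · cases l with
        | nil => simp at hl0
        | cons d l =>
          obtain rfl : d = c₀ := by simpa using hl0
          obtain rfl : vert d = y := by simpa using hy
          exact (h0 _).2 rfl
      · obtain rfl : 1 = v := by simpa using hv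
        obtain rfl : vert c = u := by
          rw [List.getLast?_map, hlast] at hu
          simpa using hu
        obtain ⟨pre, rfl⟩ := List.getLast?_eq_some_iff.1 hlast
        exact (hG pre c hl0 hlc _).2 (.inl ⟨hacc, rfl⟩)
    -- the vertices `0` and `1` are added to a computation, so there is one more edge than states
    · have h := congrArg List.length hm
      have := hlen l hl0 hlc
      simp at h
      omega


/-! ### Configurations as tuples of numbers -/

/-- The number of an element of a finite type. -/
noncomputable def finCode {α : Type} [Finite α] (s : α) : ℕ := (Finite.equivFin α s).val

theorem finCode_lt {α : Type} [Finite α] (s : α) : finCode s < Nat.card α :=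
  (Finite.equivFin α s).isLt

theorem finCode_injective {α : Type} [Finite α] : Function.Injective (finCode (α := α)) :=
  fun _ _ h => (Finite.equivFin α).injective (Fin.ext h)

/-- The code of a stack over a finite alphabet with `g` symbols: the top of the stack is the least
significant digit in base `g + 1`. The digit `0` is not used, so that stacks of different heights
have different codes. -/
noncomputable def stackCode {Γ : Type} [Finite Γ] : List Γ → ℕ
  | [] => 0
  | s :: l => finCode s + 1 + (Nat.card Γ + 1) * stackCode l

theorem digit_eq {g s s' m m' : ℕ} (hs : s < g) (hs' : s' < g)
    (h : s + 1 + (g + 1) * m = s' + 1 + (g + 1) * m') : s = s' ∧ m = m' := by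
  have h1 : ∀ r k, r < g → (r + 1 + (g + 1) * k) / (g + 1) = k := fun r k hr => by
    rw [Nat.add_mul_div_left _ _ (Nat.succ_pos g), Nat.div_eq_of_lt (by omega), zero_add]
  have hm : m = m' := by rw [← h1 s m hs, h, h1 s' m' hs']
  subst hm
  exact ⟨by omega, rfl⟩

theorem stackCode_injective {Γ : Type} [Finite Γ] : Function.Injective (stackCode (Γ := Γ)) := by
  intro l
  induction l with
  | nil =>
    intro m h
    cases m with
    | nil => rfl
    | cons s m => simp only [stackCode] at h; omega
  | cons s l ih =>
    intro m h
    cases m with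
    | nil => simp only [stackCode] at h; omega
    | cons s' m =>
      obtain ⟨h1, h2⟩ := digit_eq (finCode_lt s) (finCode_lt s') h
      rw [finCode_injective h1, ih h2]

theorem stackCode_lt {Γ : Type} [Finite Γ] (l : List Γ) :
    stackCode l < (Nat.card Γ + 1) ^ l.length := by
  induction l with
  | nil => simp [stackCode]
  | cons s l ih =>
    have := finCode_lt s
    rw [List.length_cons, pow_succ']
    calc stackCode (s :: l) < (Nat.card Γ + 1) * (stackCode l + 1) := by
          simp only [stackCode]; linarith
      _ ≤ _ := Nat.mul_le_mul_left _ ih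

/-- The arithmetic relation between the code `r` of a stack, its top `s`, which is the blank for the
empty stack, and the code `r'` of the rest; `g` is the number of symbols. -/
def IsPop (g blank r s r' : ℕ) : Prop :=
  (r = 0 ∧ s = blank ∧ r' = 0) ∨ (s < g ∧ r = s + 1 + (g + 1) * r')

theorem isPop_stackCode {Γ : Type} [Finite Γ] {blank : Γ} {l : List Γ} {s r' : ℕ} :
    IsPop (Nat.card Γ) (finCode blank) (stackCode l) s r' ↔
      s = finCode (l.headD blank) ∧ r' = stackCode l.tail := by
  cases l with
  | nil =>
    simp only [IsPop, stackCode, List.headD_nil, List.tail_nil]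
    constructor
    · rintro (h | h)
      · exact h.2
      · omega
    · exact fun h => .inl ⟨trivial, h⟩
  | cons t l =>
    simp only [IsPop, stackCode, List.headD_cons, List.tail_cons]
    constructor
    · rintro (h | h)
      · omega
      · exact (digit_eq (finCode_lt t) h.1 h.2).imp Eq.symm Eq.symm
    · rintro ⟨rfl, rfl⟩
      exact .inr ⟨finCode_lt t, rfl⟩

/-- The arithmetic relation between the codes `l, r` of the two sides of a tape and the codes
`l', s', r'` of the tape after writing `s` and moving. -/
def IsTapeUpdate (g blank : ℕ) (s : ℕ) (l r l' s' r' : ℕ) : Move → Prop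
  | .stay => l' = l ∧ s' = s ∧ r' = r
  | .left => r' = s + 1 + (g + 1) * r ∧ IsPop g blank l s' l'
  | .right => l' = s + 1 + (g + 1) * l ∧ IsPop g blank r s' r'

theorem isTapeUpdate_iff {Γ : Type} [Finite Γ] {blank s : Γ} {T : WorkTape Γ} {m : Move}
    {l' s' r' : ℕ} :
    IsTapeUpdate (Nat.card Γ) (finCode blank) (finCode s) (stackCode T.left) (stackCode T.right)
        l' s' r' m ↔
      l' = stackCode (T.update blank s m).left ∧ s' = finCode (T.update blank s m).head ∧
        r' = stackCode (T.update blank s m).right := by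
  cases m with
  | stay => rfl
  | left =>
    simp only [IsTapeUpdate, isPop_stackCode, WorkTape.update, stackCode]
    tauto
  | right => simp only [IsTapeUpdate, isPop_stackCode, WorkTape.update, stackCode]

instance Machine.instFiniteState {a b : ℕ} (M : Machine a b) : Finite M.State := M.finite_state

instance Machine.instFiniteAlphabet {a b : ℕ} (M : Machine a b) : Finite M.Γ := M.finite_alphabet

instance : Finite Move :=
  Finite.of_surjective (fun i : Fin 3 => ![Move.left, .stay, .right] i) fun m => by
    cases m
    exacts [⟨0, rfl⟩, ⟨1, rfl⟩, ⟨2, rfl⟩]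

instance : Finite InSym :=
  Finite.of_surjective (fun o : Option (Option Bool) =>
    o.elim InSym.leftEnd fun o => o.elim .rightEnd .bit) fun m => by
    cases m with
    | leftEnd => exact ⟨none, rfl⟩
    | bit v => exact ⟨some (some v), rfl⟩
    | rightEnd => exact ⟨some none, rfl⟩

instance {ι S Γ : Type} {k : ℕ} [Finite ι] [Finite S] [Finite Γ] : Finite (Action ι S Γ k) :=
  Finite.of_injective
    (fun A => (A.state, A.write, A.workMove, A.inputMove)) fun A B h => by
      cases A; cases B; simpa using h

namespace Machine

variable {a b : ℕ} (M : Machine a b)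

/-- Indices of the numbers that describe a configuration: the state, the positions of the input
heads, and the left side, scanned symbol and right side of each work tape. -/
abbrev Index : Type := Unit ⊕ (Fin a ⊕ Fin b) ⊕ (Fin M.tapes × Fin 3)

variable {M}

/-- The tuple of numbers that describes a configuration. -/
noncomputable def Config.toTuple (c : M.Config) : M.Index → ℕ :=
  Sum.elim (fun _ => finCode c.state) (Sum.elim c.inputHead fun j =>
    ![stackCode (c.work j.1).left, finCode (c.work j.1).head, stackCode (c.work j.1).right] j.2)

theorem Config.toTuple_injective : Function.Injective (Config.toTuple (M := M)) := by
  intro c d h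
  have hs := finCode_injective (congrFun h (.inl ()))
  have hh : c.inputHead = d.inputHead := funext fun i => congrFun h (.inr (.inl i))
  have hw : c.work = d.work := by
    funext j
    have h0 := stackCode_injective (congrFun h (.inr (.inr (j, 0))))
    have h1 := finCode_injective (congrFun h (.inr (.inr (j, 1))))
    have h2 := stackCode_injective (congrFun h (.inr (.inr (j, 2))))
    cases hc : c.work j
    cases hd : d.work j
    rw [hc, hd] at h0 h1 h2
    congr
  cases c
  cases d
  congr

variable (M)

/-- The arithmetic relation between the tuples of a configuration and of its successors. -/
def TupleStep (x : Fin a → ℕ) (X : Fin b → Finset ℕ) (u w : M.Index → ℕ) : Prop :=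
  ∃ (q : M.State) (σ : Fin a ⊕ Fin b → InSym) (γ : Fin M.tapes → M.Γ)
    (A : Action (Fin a ⊕ Fin b) M.State M.Γ M.tapes),
    (q ≠ M.accept ∧ A ∈ M.trans q σ γ) ∧ u (.inl ()) = finCode q ∧ w (.inl ()) = finCode A.state ∧
    (∀ i, readInput (inputWord x X i) (u (.inr (.inl i))) = σ i ∧
      w (.inr (.inl i)) = moveInput (inputWord x X i) (u (.inr (.inl i))) (A.inputMove i)) ∧
    ∀ j, u (.inr (.inr (j, 1))) = finCode (γ j) ∧
      IsTapeUpdate (Nat.card M.Γ) (finCode M.blank) (finCode (A.write j)) (u (.inr (.inr (j, 0))))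
        (u (.inr (.inr (j, 2)))) (w (.inr (.inr (j, 0)))) (w (.inr (.inr (j, 1))))
        (w (.inr (.inr (j, 2)))) (A.workMove j)

variable {M}

theorem tupleStep_toTuple {x : Fin a → ℕ} {X : Fin b → Finset ℕ} {c : M.Config}
    {w : M.Index → ℕ} :
    M.TupleStep x X c.toTuple w ↔ ∃ c', M.Step x X c c' ∧ w = c'.toTuple := by
  constructor
  · rintro ⟨q, σ, γ, A, ⟨hq, hA⟩, h1, h2, h3, h4⟩
    obtain rfl : c.state = q := finCode_injective h1
    obtain rfl : (fun i => readInput (inputWord x X i) (c.inputHead i)) = σ :=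
      funext fun i => (h3 i).1
    obtain rfl : (fun j => (c.work j).head) = γ := funext fun j => finCode_injective (h4 j).1
    refine ⟨_, ⟨hq, A, hA, rfl⟩, ?_⟩
    funext i
    rcases i with i | i | ⟨j, k⟩
    · exact h2
    · exact (h3 i).2
    · obtain ⟨e0, e1, e2⟩ := isTapeUpdate_iff.1 (h4 j).2
      fin_cases k
      exacts [e0, e1, e2]
  · rintro ⟨c', ⟨hq, A, hA, rfl⟩, rfl⟩
    exact ⟨_, _, _, A, ⟨hq, hA⟩, rfl, rfl, fun i => ⟨rfl, rfl⟩, fun j =>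
      ⟨rfl, isTapeUpdate_iff.2 ⟨rfl, rfl, rfl⟩⟩⟩

end Machine

/-! ### The step relation is definable -/

section StepDefinable

variable {a b : ℕ} {V : Type} {y : Fin a → (V → ℕ) → (Fin b → Finset ℕ) → ℕ}

theorem TermDefinable.length_inputWord (hy : ∀ i, TermDefinable (y i)) (i : Fin a ⊕ Fin b) :
    TermDefinable fun x X => (inputWord (fun i => y i x X) X i).length := by
  cases i with
  | inl i => simpa [inputWord] using hy i
  | inr j => simpa [inputWord] using TermDefinable.strLen j

theorem TermDefinable.inputSize (hy : ∀ i, TermDefinable (y i)) :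
    TermDefinable fun x X => inputSize (fun i => y i x X) X :=
  .sum _ fun i => .length_inputWord hy i

variable {h : (V → ℕ) → (Fin b → Finset ℕ) → ℕ}

theorem readInput_eq_leftEnd {w : List Bool} {h : ℕ} : readInput w h = .leftEnd ↔ h = 0 := by
  cases h with
  | zero => simp [readInput]
  | succ h => cases hw : w[h]? <;> simp [readInput, hw]

theorem readInput_eq_rightEnd {w : List Bool} {h : ℕ} :
    readInput w h = .rightEnd ↔ w.length + 1 ≤ h := by
  cases h with
  | zero => simp [readInput]
  | succ h =>
    cases hw : w[h]? with
    | none =>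
      have := List.getElem?_eq_none_iff.1 hw
      simpa [readInput, hw] using this
    | some v =>
      have := (List.getElem?_eq_some_iff.1 hw).1
      simp [readInput, hw]
      omega

theorem readInput_eq_bit {w : List Bool} {h : ℕ} {v : Bool} :
    readInput w h = .bit v ↔ ∃ k ≤ h, h = k + 1 ∧ w[k]? = some v := by
  cases h with
  | zero => simp [readInput]
  | succ h =>
    constructor
    · intro hr
      refine ⟨h, Nat.le_succ h, rfl, ?_⟩
      cases hw : w[h]? <;> simp [readInput, hw] at hr
      rw [hr]
    · rintro ⟨k, -, hk, hw⟩
      obtain rfl : h = k := Nat.succ_injective hk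
      simp [readInput, hw]

theorem RelDefinable.readInput (hy : ∀ i, TermDefinable (y i)) (hh : TermDefinable h)
    (i : Fin a ⊕ Fin b) (s : InSym) :
    RelDefinable fun x X => readInput (inputWord (fun i => y i x X) X i) (h x X) = s := by
  cases s with
  | leftEnd => exact (RelDefinable.eq hh (.const 0)).congr fun _ _ => readInput_eq_leftEnd
  | rightEnd =>
    exact (RelDefinable.le ((TermDefinable.length_inputWord hy i).add (.const 1)) hh).congr
      fun _ _ => readInput_eq_rightEnd
  | bit v =>
    have hlt : ∀ {f : (Option V → ℕ) → (Fin b → Finset ℕ) → ℕ}, TermDefinable f →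
        RelDefinable fun x X => x none + 1 ≤ f x X := fun hf =>
      .le ((TermDefinable.var _).add (.const 1)) hf
    have hw : RelDefinable (V := Option V) fun x X =>
        (inputWord (fun i => y i (fun v => x (some v)) X) X i)[x none]? = some v := by
      cases i with
      | inl i =>
        refine ((hlt (hy i).weaken).and (.const (v = true))).congr
          fun x X => ?_
        simp only [inputWord, List.getElem?_replicate]
        split_ifs with h <;> simp [h, eq_comm]
      | inr j =>
        have hget : ∀ (x : Option V → ℕ) (X : Fin b → Finset ℕ),
            (inputWord (fun i => y i (fun v => x (some v)) X) X (.inr j))[x none]? = some v ↔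
              x none + 1 ≤ strLen (X j) ∧ (x none ∈ X j ↔ v = true) := fun x X => by
          by_cases h : x none < strLen (X j)
          · cases v <;> simp [inputWord, h]
          · simp [inputWord, h]
        cases v with
        | true => exact ((hlt (.strLen j)).and (.mem (.var none) j)).congr fun x X => by simp [hget]
        | false =>
          exact ((hlt (.strLen j)).and (RelDefinable.mem (.var none) j).not).congr fun x X => by
            simp [hget]
    refine (RelDefinable.exists_le (P := fun k x X => h x X = k + 1 ∧
      (inputWord (fun i => y i x X) X i)[k]? = some v) hh
      ((RelDefinable.eq hh.weaken ((TermDefinable.var none).add (.const 1))).and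
        hw)).congr fun _ _ => readInput_eq_bit

theorem RelDefinable.moveInput (hy : ∀ i, TermDefinable (y i)) (hh : TermDefinable h)
    {k : (V → ℕ) → (Fin b → Finset ℕ) → ℕ} (hk : TermDefinable k) (i : Fin a ⊕ Fin b)
    (m : Move) :
    RelDefinable fun x X =>
      k x X = moveInput (inputWord (fun i => y i x X) X i) (h x X) m := by
  cases m with
  | stay => exact .eq hk hh
  | left =>
    refine ((RelDefinable.eq hh (hk.add (.const 1))).or
      ((RelDefinable.eq hh (.const 0)).and (.eq hk (.const 0)))).congr fun x X => ?_
    simp only [TwoSorted.moveInput]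
    omega
  | right =>
    have hl := (TermDefinable.length_inputWord hy i).add (.const 1)
    have hh1 := hh.add (.const 1)
    refine (((RelDefinable.eq hk hh1).and (.le hh1 hl)).or
      ((RelDefinable.eq hk hl).and (.le hl hh1))).congr fun x X => ?_
    simp only [TwoSorted.moveInput]
    omega

theorem RelDefinable.isPop {g blank : ℕ} {r s r' : (V → ℕ) → (Fin b → Finset ℕ) → ℕ}
    (hr : TermDefinable r) (hs : TermDefinable s) (hr' : TermDefinable r') :
    RelDefinable fun x X => IsPop g blank (r x X) (s x X) (r' x X) :=
  ((RelDefinable.eq hr (.const 0)).and ((RelDefinable.eq hs (.const blank)).and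
    (.eq hr' (.const 0)))).or ((RelDefinable.le (hs.add (.const 1)) (.const g)).and
      (.eq hr ((hs.add (.const 1)).add ((TermDefinable.const (g + 1)).mul hr'))))

theorem RelDefinable.isTapeUpdate {g blank s : ℕ}
    {l r l' s' r' : (V → ℕ) → (Fin b → Finset ℕ) → ℕ} (hl : TermDefinable l)
    (hr : TermDefinable r) (hl' : TermDefinable l') (hs' : TermDefinable s')
    (hr' : TermDefinable r') (m : Move) :
    RelDefinable fun x X =>
      IsTapeUpdate g blank s (l x X) (r x X) (l' x X) (s' x X) (r' x X) m := by
  have hpush : ∀ {f : (V → ℕ) → (Fin b → Finset ℕ) → ℕ}, TermDefinable f →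
      TermDefinable fun x X => s + 1 + (g + 1) * f x X := fun hf =>
    (TermDefinable.const (s + 1)).add ((TermDefinable.const (g + 1)).mul hf)
  cases m with
  | stay => exact (RelDefinable.eq hl' hl).and ((RelDefinable.eq hs' (.const s)).and (.eq hr' hr))
  | left => exact (RelDefinable.eq hr' (hpush hr)).and (.isPop hl hs' hl')
  | right => exact (RelDefinable.eq hl' (hpush hl)).and (.isPop hr hs' hr')

theorem RelDefinable.tupleStep {M : Machine a b} (hy : ∀ i, TermDefinable (y i))
    {u w : M.Index → (V → ℕ) → (Fin b → Finset ℕ) → ℕ} (hu : ∀ i, TermDefinable (u i))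
    (hw : ∀ i, TermDefinable (w i)) :
    RelDefinable fun x X =>
      M.TupleStep (fun i => y i x X) X (fun i => u i x X) (fun i => w i x X) :=
  .exists_finite fun _ => .exists_finite fun _ => .exists_finite fun _ => .exists_finite fun _ =>
    (RelDefinable.const _).and <| (RelDefinable.eq (hu _) (.const _)).and <|
      (RelDefinable.eq (hw _) (.const _)).and <| RelDefinable.and
        (.forall_finite fun i => (RelDefinable.readInput hy (hu _) i _).and
          (.moveInput hy (hu _) (hw _) i _))
        (.forall_finite fun _ => (RelDefinable.eq (hu _) (.const _)).and
          (.isTapeUpdate (hu _) (hu _) (hw _) (hw _) (hw _) _))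

end StepDefinable


/-! ### The configuration graph -/

namespace Machine

variable {a b : ℕ} (M : Machine a b)

/-- A bound, polynomial in the length `N` of the input, for the numbers that describe the
configurations of a machine which visits at most `K * (log₂ N + 1)` cells. -/
noncomputable def tupleBound (K N : ℕ) : ℕ :=
  (2 * N + 2) ^ (Nat.card M.Γ * K) + (N + 1) + Nat.card M.State + Nat.card M.Γ

variable {M}

theorem length_inputWord_le (x : Fin a → ℕ) (X : Fin b → Finset ℕ) (i : Fin a ⊕ Fin b) :
    (inputWord x X i).length ≤ inputSize x X :=
  Finset.single_le_sum (f := fun i => (inputWord x X i).length) (fun _ _ => Nat.zero_le _)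
    (Finset.mem_univ i)

theorem moveInput_le {w : List Bool} {h : ℕ} (hh : h ≤ w.length + 1) (m : Move) :
    moveInput w h m ≤ w.length + 1 := by
  cases m <;> simp only [moveInput] <;> omega

/-- In base `g + 1` a stack of `O(log N)` symbols has a code that is polynomial in `N`. -/
theorem stackCode_le_of_length_le {Γ : Type} [Finite Γ] {l : List Γ} {K N : ℕ}
    (h : l.length ≤ K * (Nat.log 2 N + 1)) :
    stackCode l ≤ (2 * N + 2) ^ (Nat.card Γ * K) := by
  have hlog : 2 ^ (Nat.log 2 N + 1) ≤ 2 * N + 2 := by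
    rcases Nat.eq_zero_or_pos N with rfl | hN
    · simp
    · have := Nat.pow_log_le_self 2 hN.ne'
      rw [pow_succ]
      omega
  calc stackCode l ≤ (Nat.card Γ + 1) ^ l.length := (stackCode_lt l).le
    _ ≤ (2 ^ Nat.card Γ) ^ (K * (Nat.log 2 N + 1)) :=
      (Nat.pow_le_pow_left Nat.lt_two_pow_self _).trans
        (Nat.pow_le_pow_right (Nat.two_pow_pos _) h)
    _ = (2 ^ (Nat.log 2 N + 1)) ^ (Nat.card Γ * K) := by
      rw [← pow_mul, ← pow_mul]
      congr 1
      ring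
    _ ≤ _ := Nat.pow_le_pow_left hlog _

theorem toTuple_le_tupleBound {K : ℕ} {x : Fin a → ℕ} {X : Fin b → Finset ℕ}
    {l : List M.Config} (hl : M.IsComputation x X l) {c : M.Config} (hc : c ∈ l)
    (hK : ∑ j, (c.work j).space ≤ K * (Nat.log 2 (inputSize x X) + 1)) (i : M.Index) :
    c.toTuple i ≤ M.tupleBound K (inputSize x X) := by
  have hhead : ∀ c ∈ l, ∀ i, c.inputHead i ≤ (inputWord x X i).length + 1 := by
    refine isChain_forall_of_head ?_ hl.1 hl.2 fun _ => Nat.zero_le _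
    rintro c c' hc ⟨-, A, -, rfl⟩ i
    exact moveInput_le (hc i) _
  unfold tupleBound
  rcases i with i | i | ⟨j, k⟩
  · have := finCode_lt c.state
    change finCode c.state ≤ _
    omega
  · have := (hhead c hc i).trans (Nat.succ_le_succ (length_inputWord_le x X i))
    change c.inputHead i ≤ _
    omega
  · have hj : (c.work j).space ≤ K * (Nat.log 2 (inputSize x X) + 1) :=
      (Finset.single_le_sum (f := fun j => (c.work j).space) (fun _ _ => Nat.zero_le _)
        (Finset.mem_univ j)).trans hK
    unfold WorkTape.space at hj
    have hl := stackCode_le_of_length_le (l := (c.work j).left) (hj.trans' (by omega))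
    have hr := stackCode_le_of_length_le (l := (c.work j).right) (hj.trans' (by omega))
    have hs := finCode_lt (c.work j).head
    fin_cases k
    · change stackCode (c.work j).left ≤ _
      omega
    · change finCode (c.work j).head ≤ _
      omega
    · change stackCode (c.work j).right ≤ _
      omega

variable (M)

/-- The edges of the configuration graph. A tuple `w` is the vertex `familyCode w + 2`; there is an
edge from `0` to the initial configuration and from each accepting configuration to `1`. -/
def Edge (B : ℕ) (x : Fin a → ℕ) (X : Fin b → Finset ℕ) (u v : ℕ) : Prop :=
  (u = 0 ∧ v = familyCode M.init.toTuple + 2) ∨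
    ∃ w : M.Index → ℕ, (∀ i, w i ≤ B) ∧ u = familyCode w + 2 ∧
      ((w (.inl ()) = finCode M.accept ∧ v = 1) ∨
        ∃ w' : M.Index → ℕ, (∀ i, w' i ≤ B) ∧ v = familyCode w' + 2 ∧ M.TupleStep x X w w')

/-- The number of vertices of the configuration graph. -/
noncomputable def graphSize (B : ℕ) : ℕ := familyCode (fun _ : M.Index => B) + 3

open Classical in
/-- The string that encodes the configuration graph. -/
noncomputable def graph (B : ℕ) (x : Fin a → ℕ) (X : Fin b → Finset ℕ) : Finset ℕ :=
  {i ∈ Finset.range (pair (M.graphSize B) (M.graphSize B)) |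
    ∃ u ≤ i, ∃ v ≤ i, i = pair u v ∧ M.Edge B x X u v}

variable {M} {B : ℕ} {x : Fin a → ℕ} {X : Fin b → Finset ℕ}

theorem vert_lt_graphSize {w : M.Index → ℕ} (hw : ∀ i, w i ≤ B) :
    familyCode w + 2 < M.graphSize B := by
  have := familyCode_mono hw
  unfold graphSize
  omega

theorem le_pair (u v : ℕ) : u ≤ pair u v ∧ v ≤ pair u v := by
  unfold pair
  constructor <;> nlinarith

theorem pair_mem_graph (hinit : ∀ i, M.init.toTuple i ≤ B) {u v : ℕ} :
    pair u v ∈ M.graph B x X ↔ M.Edge B x X u v := by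
  simp only [graph, Finset.mem_filter, Finset.mem_range]
  constructor
  · rintro ⟨-, u', -, v', -, h, hE⟩
    obtain ⟨rfl, rfl⟩ := pair_injective h
    exact hE
  · intro hE
    refine ⟨?_, u, (le_pair u v).1, v, (le_pair u v).2, rfl, hE⟩
    have hlt : u < M.graphSize B ∧ v < M.graphSize B := by
      rcases hE with ⟨rfl, rfl⟩ | ⟨w, hw, rfl, ⟨-, rfl⟩ | ⟨w', hw', rfl, -⟩⟩
      · exact ⟨by unfold graphSize; omega, vert_lt_graphSize hinit⟩
      · exact ⟨vert_lt_graphSize hw, by unfold graphSize; omega⟩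
      · exact ⟨vert_lt_graphSize hw, vert_lt_graphSize hw'⟩
    exact pair_lt_pair (by omega)

/-- Accepting computations of a logspace machine are paths from `0` to `1` in its configuration
graph. -/
theorem encard_acceptingComputations_eq {K p : ℕ}
    (hspace : ∀ l, M.IsComputation x X l → ∀ c ∈ l,
      ∑ i, (c.work i).space ≤ K * (Nat.log 2 (inputSize x X) + 1))
    (htime : ∀ l, M.IsComputation x X l → l.length + 1 ≤ p)
    (hB : B = M.tupleBound K (inputSize x X)) :
    (stPaths (M.graphSize B) 0 1 p (M.graph B x X)).encard =
      (M.acceptingComputations x X).encard := by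
  have hle : ∀ l, M.IsComputation x X l → ∀ c ∈ l, ∀ i, c.toTuple i ≤ B := fun l hl c hc i =>
    hB ▸ toTuple_le_tupleBound hl hc (hspace l hl c hc) i
  have hinit : ∀ i, M.init.toTuple i ≤ B :=
    hle [M.init] ⟨rfl, List.isChain_singleton _⟩ _ (List.mem_singleton_self _)
  refine encard_stPaths_eq (vert := fun c : M.Config => familyCode c.toTuple + 2)
    (R := M.Step x X) (c₀ := M.init) (acc := fun c => c.state = M.accept)
    (by unfold graphSize; omega) ?_ (fun _ => Nat.le_add_left _ _) (fun l h0 h1 => htime l ⟨h0, h1⟩)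
    (fun l h0 h1 c hc => vert_lt_graphSize (hle l ⟨h0, h1⟩ c hc)) ?_ ?_ ?_
  · intro c d h
    exact Config.toTuple_injective (familyCode_injective (Nat.add_right_cancel h))
  · intro v
    rw [pair_mem_graph hinit]
    constructor
    · rintro (h | ⟨w, -, h, -⟩)
      · exact h.2
      · omega
    · exact fun h => .inl ⟨rfl, h⟩
  · intro v hv
    rcases (pair_mem_graph hinit).1 hv with ⟨h, -⟩ | ⟨w, -, h, -⟩ <;> omega
  · intro l c h0 h1 v
    have hc := hle _ ⟨h0, h1⟩ c (by simp)
    rw [pair_mem_graph hinit]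
    constructor
    · rintro (⟨h, -⟩ | ⟨w, -, h, hv⟩)
      · omega
      · obtain rfl : c.toTuple = w := familyCode_injective (Nat.add_right_cancel h)
        rcases hv with ⟨hs, hv⟩ | ⟨w', -, hv, hw'⟩
        · exact .inl ⟨finCode_injective hs, hv⟩
        · obtain ⟨c', hcc', rfl⟩ := tupleStep_toTuple.1 hw'
          exact .inr ⟨c', hcc', hv⟩
    · rintro (⟨hs, rfl⟩ | ⟨c', hcc', rfl⟩)
      · exact .inr ⟨c.toTuple, hc, rfl, .inl ⟨congrArg finCode hs, rfl⟩⟩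
      · refine .inr ⟨c.toTuple, hc, rfl, .inr ⟨c'.toTuple, ?_, rfl,
          tupleStep_toTuple.2 ⟨c', hcc', rfl⟩⟩⟩
        refine hle (l ++ [c] ++ [c']) ⟨?_, ?_⟩ c' (by simp)
        · rw [List.head?_append, h0]
          rfl
        · rw [List.isChain_append]
          exact ⟨h1, List.isChain_singleton _, by simpa using hcc'⟩

end Machine

section EdgeDefinable

variable {a b : ℕ} {V : Type} {y : Fin a → (V → ℕ) → (Fin b → Finset ℕ) → ℕ} {M : Machine a b}

theorem TermDefinable.tupleBound (hy : ∀ i, TermDefinable (y i)) (K : ℕ) :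
    TermDefinable fun x X => M.tupleBound K (TwoSorted.inputSize (fun i => y i x X) X) :=
  have h := TermDefinable.inputSize hy
  (((((TermDefinable.const 2).mul h).add (.const 2)).pow _).add (h.add (.const 1))
    |>.add (.const _)).add (.const _)

theorem TermDefinable.graphSize {B : (V → ℕ) → (Fin b → Finset ℕ) → ℕ} (hB : TermDefinable B) :
    TermDefinable fun x X => M.graphSize (B x X) :=
  (TermDefinable.familyCode fun _ => hB).add (.const 3)

theorem RelDefinable.edge {B u v : (V → ℕ) → (Fin b → Finset ℕ) → ℕ}
    (hy : ∀ i, TermDefinable (y i)) (hB : TermDefinable B) (hu : TermDefinable u)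
    (hv : TermDefinable v) :
    RelDefinable fun x X => M.Edge (B x X) (fun i => y i x X) X (u x X) (v x X) := by
  refine ((RelDefinable.eq hu (.const 0)).and (.eq hv (.const _))).or ?_
  refine .exists_fintype_le (P := fun w x X => u x X = familyCode w + 2 ∧
    ((w (.inl ()) = finCode M.accept ∧ v x X = 1) ∨ ∃ w' : M.Index → ℕ, (∀ i, w' i ≤ B x X) ∧
      v x X = familyCode w' + 2 ∧ M.TupleStep (fun i => y i x X) X w w')) hB ?_
  have hr : ∀ {W : Type} {f : (V → ℕ) → (Fin b → Finset ℕ) → ℕ}, TermDefinable f →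
      TermDefinable (V := W ⊕ V) fun x X => f (fun v => x (Sum.inr v)) X := fun hf =>
    hf.subst fun v => .var (Sum.inr v)
  have hr2 : ∀ {W W' : Type} {f : (V → ℕ) → (Fin b → Finset ℕ) → ℕ}, TermDefinable f →
      TermDefinable (V := W ⊕ W' ⊕ V) fun x X => f (fun v => x (Sum.inr (Sum.inr v))) X :=
    fun hf => hf.subst fun v => .var (Sum.inr (Sum.inr v))
  refine (RelDefinable.eq (hr hu) ((TermDefinable.familyCode fun i => .var _).add
    (.const 2))).and (((RelDefinable.eq (.var _) (.const _)).and (.eq (hr hv) (.const 1))).or ?_)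
  refine .exists_fintype_le (P := fun w' x X =>
    v (fun v => x (.inr v)) X = familyCode w' + 2 ∧
      M.TupleStep (fun i => y i (fun v => x (.inr v)) X) X (fun i => x (.inl i)) w') (hr hB) ?_
  exact (RelDefinable.eq (hr2 hv) ((TermDefinable.familyCode fun i => .var _).add
    (.const 2))).and (.tupleStep (fun i => hr2 (hy i)) (fun i => .var _) (fun i => .var _))

theorem Machine.sigmaBitDefinable_graph {B : (Fin a → ℕ) → (Fin b → Finset ℕ) → ℕ}
    (hB : TermDefinable B) :
    SigmaBitDefinable ∅ (fun x X => M.graph (B x X) x X) := by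
  have hn := hB.graphSize (M := M)
  obtain ⟨t, ht⟩ := (hn.pair hn).exists_numTerm
  have hu : RelDefinable (V := Option (Fin a)) fun z X => ∃ u ≤ z none, ∃ v ≤ z none,
      z none = pair u v ∧ M.Edge (B (fun i => z (some i)) X) (fun i => z (some i)) X u v := by
    refine .exists_le (P := fun u z X => ∃ v ≤ z none,
      z none = pair u v ∧ M.Edge (B (fun i => z (some i)) X) (fun i => z (some i)) X u v)
      (.var _) ?_
    refine .exists_le (P := fun v z X => z (some none) = pair (z none) v ∧
      M.Edge (B (fun i => z (some (some i))) X) (fun i => z (some (some i))) X (z none) v)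
      (.var _) ?_
    exact (RelDefinable.eq (.var _) (.pair (.var _) (.var _))).and
      (.edge (fun i => .var _) (hB.subst fun i => .var _) (.var _) (.var _))
  obtain ⟨φ, hφ⟩ := hu fun v => v.elim (.var 0) fun i => .var i.succ
  refine ⟨t, φ, fun x X i => ?_⟩
  rw [hφ, ht]
  simp [Machine.graph, NumTerm.eval]

end EdgeDefinable

/-- The value of a function of `#L` is the number of paths in the configuration graph. -/
theorem exists_eq_sharpSTCON {a b : ℕ} (F : StrFun a b) (hF : Obj.str F ∈ SharpL) :
    ∃ (H : StrFun a b) (n p : NumTerm ∅ a b), SigmaBitDefinable ∅ H ∧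
      ∀ x X, 2 ≤ n.eval x X ∧
        F x X = sharpSTCON ![n.eval x X, 0, 1, p.eval x X] ![H x X] := by
  obtain ⟨a', b', F', M, hFF', ⟨K, hK⟩, ⟨k, hk⟩, hM⟩ := hF
  obtain ⟨rfl, rfl, hFF'⟩ := Obj.str.inj hFF'
  obtain rfl := eq_of_heq hFF'
  have hvar : ∀ i : Fin a, TermDefinable (b := b) fun x _ => x i := .var
  have hB := TermDefinable.tupleBound (M := M) hvar K
  obtain ⟨n, hn⟩ := (hB.graphSize (M := M)).exists_numTerm
  obtain ⟨p, hp⟩ := ((((TermDefinable.inputSize hvar).pow k).add (.const k)).add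
    (.const 1)).exists_numTerm
  have hn2 : ∀ x X, 2 < n.eval x X := fun x X => by
    rw [hn]
    unfold Machine.graphSize
    omega
  refine ⟨_, n, p, Machine.sigmaBitDefinable_graph (M := M) hB, fun x X => ⟨(hn2 x X).le, ?_⟩⟩
  have h := Machine.encard_acceptingComputations_eq (hK x X)
    (fun l hl => Nat.succ_le_succ (hk x X l hl)) rfl
  rw [hM, ← (stPaths_finite _ _ _ _ _).cast_ncard_eq, Nat.cast_inj] at h
  have := hn2 x X
  have hval : ∀ (p' : ℕ) (G : Finset ℕ), sharpSTCON ![n.eval x X, 0, 1, p'] ![G] =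
      toBits (stPaths (n.eval x X) 0 1 p' G).ncard := fun _ _ =>
    if_pos ⟨(Nat.zero_lt_two.trans this), Nat.one_lt_two.trans this, Nat.zero_ne_one⟩
  rw [hval, hn, hp, ← toBits_bin (F x X), ← h]


/-! ### Counting the accepting runs of a transition system -/

section Runs

variable {C : Type} (R : C → C → Prop) (acc : C → Prop) (Ok : C → Prop)

/-- The finite sequences of states that start in `c`, follow the transitions, and end in an
accepting state. -/
def acceptingRuns (c : C) : Set (List C) :=
  {l | (l.head? = some c ∧ l.IsChain R) ∧ ∃ d, l.getLast? = some d ∧ acc d}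

/-- There are exactly `m` accepting runs from `c`, all runs from `c` have at most `T` states, and
all states reached satisfy `Ok`. -/
structure HasRuns (c : C) (m T : ℕ) : Prop where
  encard_eq : (acceptingRuns R acc c).encard = m
  length_le : ∀ l : List C, l.head? = some c → l.IsChain R → l.length ≤ T
  ok : ∀ l : List C, l.head? = some c → l.IsChain R → ∀ d ∈ l, Ok d

variable {R acc Ok}

theorem eq_singleton_or_exists_cons {c : C} {l : List C} (h0 : l.head? = some c)
    (hl : l.IsChain R) :
    l = [c] ∨ ∃ d l', R c d ∧ l'.head? = some d ∧ l'.IsChain R ∧ l = c :: l' := by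
  cases l with
  | nil => simp at h0
  | cons e l =>
    obtain rfl : e = c := by simpa using h0
    cases l with
    | nil => exact .inl rfl
    | cons d l =>
      rw [List.isChain_cons_cons] at hl
      exact .inr ⟨d, d :: l, hl.1, rfl, hl.2, rfl⟩

theorem acceptingRuns_eq_iUnion {c : C} (hc : ¬ acc c) :
    acceptingRuns R acc c = ⋃ d ∈ {d | R c d}, (List.cons c) '' acceptingRuns R acc d := by
  ext l
  simp only [Set.mem_iUnion, Set.mem_image]
  constructor
  · rintro ⟨⟨h0, hl⟩, e, he, hacc⟩
    rcases eq_singleton_or_exists_cons h0 hl with rfl | ⟨d, l', hd, h0', hl', rfl⟩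
    · obtain rfl : c = e := by simpa using he
      exact absurd hacc hc
    · refine ⟨d, hd, l', ⟨⟨h0', hl'⟩, e, ?_, hacc⟩, rfl⟩
      rwa [List.getLast?_cons_of_ne_nil (by rintro rfl; simp at h0')] at he
  · rintro ⟨d, hd, l', ⟨⟨h0', hl'⟩, e, he, hacc⟩, rfl⟩
    refine ⟨⟨rfl, ?_⟩, e, ?_, hacc⟩
    · rw [List.isChain_cons]
      refine ⟨fun y hy => ?_, hl'⟩
      rw [h0'] at hy
      obtain rfl : d = y := by simpa using hy
      exact hd
    · rwa [List.getLast?_cons_of_ne_nil (by rintro rfl; simp at h0')]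

namespace HasRuns

theorem mono {c : C} {m T T' : ℕ} (h : HasRuns R acc Ok c m T) (hT : T ≤ T') :
    HasRuns R acc Ok c m T' :=
  ⟨h.encard_eq, fun l h0 hl => (h.length_le l h0 hl).trans hT, h.ok⟩

theorem of_forall_not {c : C} (hc : ∀ d, ¬ R c d) (hok : Ok c) {m : ℕ}
    (hm : (acceptingRuns R acc c).encard = m) : HasRuns R acc Ok c m 1 := by
  have key : ∀ l : List C, l.head? = some c → l.IsChain R → l = [c] := fun l h0 hl =>
    (eq_singleton_or_exists_cons h0 hl).resolve_right fun ⟨d, _, hd, _⟩ => hc d hd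
  refine ⟨hm, fun l h0 hl => by simp [key l h0 hl], fun l h0 hl d hd => ?_⟩
  obtain rfl : d = c := by simpa [key l h0 hl] using hd
  exact hok

theorem accept {c : C} (hc : ∀ d, ¬ R c d) (hok : Ok c) (hacc : acc c) :
    HasRuns R acc Ok c 1 1 := by
  refine of_forall_not hc hok ?_
  have : acceptingRuns R acc c = {[c]} := by
    ext l
    constructor
    · rintro ⟨⟨h0, hl⟩, -⟩
      exact (eq_singleton_or_exists_cons h0 hl).resolve_right fun ⟨d, _, hd, _⟩ => hc d hd
    · rintro rfl
      exact ⟨⟨rfl, List.isChain_singleton _⟩, c, rfl, hacc⟩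
  rw [this, Set.encard_singleton, Nat.cast_one]

theorem reject {c : C} (hc : ∀ d, ¬ R c d) (hok : Ok c) (hacc : ¬ acc c) :
    HasRuns R acc Ok c 0 1 := by
  refine of_forall_not hc hok ?_
  rw [acceptingRuns_eq_iUnion hacc]
  simp [hc]

theorem encard_image_cons (c d : C) {m T : ℕ} (h : HasRuns R acc Ok d m T) :
    (List.cons c '' acceptingRuns R acc d).encard = m := by
  rw [(List.cons_injective).encard_image, h.encard_eq]

theorem step {c d : C} {m T : ℕ} (hc : ¬ acc c) (hok : Ok c) (hR : ∀ e, R c e ↔ e = d)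
    (h : HasRuns R acc Ok d m T) : HasRuns R acc Ok c m (T + 1) := by
  refine ⟨?_, fun l h0 hl => ?_, fun l h0 hl e he => ?_⟩
  · rw [acceptingRuns_eq_iUnion hc]
    simp only [hR]
    simpa using encard_image_cons c d h
  · rcases eq_singleton_or_exists_cons h0 hl with rfl | ⟨e, l', he, h0', hl', rfl⟩
    · simp
    · obtain rfl := (hR e).1 he
      exact Nat.succ_le_succ (h.length_le l' h0' hl')
  · rcases eq_singleton_or_exists_cons h0 hl with rfl | ⟨e', l', he', h0', hl', rfl⟩
    · obtain rfl : e = c := by simpa using he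
      exact hok
    · obtain rfl := (hR e').1 he'
      rcases List.mem_cons.1 he with rfl | he
      · exact hok
      · exact h.ok l' h0' hl' e he

theorem branch {c d₁ d₂ : C} {m₁ m₂ T : ℕ} (hc : ¬ acc c) (hok : Ok c) (hne : d₁ ≠ d₂)
    (hR : ∀ e, R c e ↔ e = d₁ ∨ e = d₂) (h₁ : HasRuns R acc Ok d₁ m₁ T)
    (h₂ : HasRuns R acc Ok d₂ m₂ T) : HasRuns R acc Ok c (m₁ + m₂) (T + 1) := by
  refine ⟨?_, fun l h0 hl => ?_, fun l h0 hl e he => ?_⟩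
  · rw [acceptingRuns_eq_iUnion hc]
    have : {d | R c d} = {d₁, d₂} := Set.ext fun e => by simp [hR]
    rw [this, Set.biUnion_pair, Set.encard_union_eq, encard_image_cons c d₁ h₁,
      encard_image_cons c d₂ h₂, Nat.cast_add]
    rw [Set.disjoint_left]
    rintro _ ⟨l, ⟨⟨hl, -⟩, -⟩, rfl⟩ ⟨l', ⟨⟨hl', -⟩, -⟩, h⟩
    obtain rfl := List.cons_injective h
    exact hne (Option.some_injective _ (hl.symm.trans hl'))
  · rcases eq_singleton_or_exists_cons h0 hl with rfl | ⟨e, l', he, h0', hl', rfl⟩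
    · simp
    · rcases (hR e).1 he with rfl | rfl
      · exact Nat.succ_le_succ (h₁.length_le l' h0' hl')
      · exact Nat.succ_le_succ (h₂.length_le l' h0' hl')
  · rcases eq_singleton_or_exists_cons h0 hl with rfl | ⟨e', l', he', h0', hl', rfl⟩
    · obtain rfl : e = c := by simpa using he
      exact hok
    · rcases List.mem_cons.1 he with rfl | he
      · exact hok
      · rcases (hR e').1 he' with rfl | rfl
        · exact h₁.ok l' h0' hl' e he
        · exact h₂.ok l' h0' hl' e he

end HasRuns

end Runs

/-! ### Counter programs -/

/-- Instructions of a program with `k` counters and a read-only input head for each `i : ι`. -/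
inductive Instr (ι Q : Type) (k : ℕ) : Type
  /-- Read the scanned input symbols, then go on in a state and move the heads, or halt. -/
  | io (f : (ι → InSym) → Option (Q × (ι → Move))) : Instr ι Q k
  /-- Guess one of two states. -/
  | branch (q₁ q₂ : Q) : Instr ι Q k
  /-- Increment counter `j`. -/
  | inc (j : Fin k) (q : Q) : Instr ι Q k
  /-- Go to `q₀` if counter `j` is `0`; otherwise decrement it and go to `q₁`. -/
  | dec (j : Fin k) (q₀ q₁ : Q) : Instr ι Q k

/-- The phases in which a machine executes an instruction on a counter. -/
inductive Phase : Type
  | run : Phase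
  | carry : Phase
  | back : Phase
  | undo : Phase

instance : Finite Phase :=
  Finite.of_surjective (fun i : Fin 4 => ![Phase.run, .carry, .back, .undo] i) fun m => by
    cases m
    exacts [⟨0, rfl⟩, ⟨1, rfl⟩, ⟨2, rfl⟩, ⟨3, rfl⟩]

section Compile

variable {a b k : ℕ} {Q : Type}

/-- What the machine does on the tape of counter `j` when it increments the counter: it leaves the
home cell to the right, turns ones into zeros up to the first cell that is not a one, writes a one
there, and returns to the home cell, which is the only blank cell on its way. -/
def incAction (q q' : Q) : Phase → Option Bool → (Q × Phase) × Option Bool × Move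
  | .run, s => ((q, .carry), s, .right)
  | .carry, some true => ((q, .carry), some false, .right)
  | .carry, _ => ((q, .back), some true, .left)
  | .back, none => ((q', .run), none, .stay)
  | .back, some v => ((q, .back), some v, .left)
  | .undo, s => ((q, .undo), s, .stay)

/-- What the machine does on the tape of counter `j` when it decrements the counter: it turns zeros
into ones up to the first cell that is not a zero. If this is a one, it is turned into a zero;
if it is blank, the counter was `0`, and the zeros are restored on the way back. -/
def decAction (q q₀ q₁ : Q) : Phase → Option Bool → (Q × Phase) × Option Bool × Move
  | .run, s => ((q, .carry), s, .right)
  | .carry, some false => ((q, .carry), some true, .right)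
  | .carry, some true => ((q, .back), some false, .left)
  | .carry, none => ((q, .undo), none, .left)
  | .back, none => ((q₁, .run), none, .stay)
  | .back, some v => ((q, .back), some v, .left)
  | .undo, none => ((q₀, .run), none, .stay)
  | .undo, some _ => ((q, .undo), some false, .left)

/-- The action that works on tape `j` only. -/
def tapeAction {ι S Γ : Type} (j : Fin k) (γ : Fin k → Γ) (r : S × Γ × Move) :
    Action ι S Γ k where
  state := r.1
  write := Function.update γ j r.2.1
  workMove := Function.update (fun _ => .stay) j r.2.2
  inputMove := fun _ => .stay

/-- The transitions of the machine that executes a counter program. -/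
def programTrans {ι : Type} (P : Q → Instr ι Q k) (s : Q × Phase) (σ : ι → InSym)
    (γ : Fin k → Option Bool) : Set (Action ι (Q × Phase) (Option Bool) k) :=
  match P s.1 with
  | .io f => {A | ∃ r, f σ = some r ∧ A = ⟨(r.1, .run), γ, fun _ => .stay, r.2⟩}
  | .branch q₁ q₂ => {A | A = ⟨(q₁, .run), γ, fun _ => .stay, fun _ => .stay⟩ ∨
      A = ⟨(q₂, .run), γ, fun _ => .stay, fun _ => .stay⟩}
  | .inc j q => {tapeAction j γ (incAction s.1 q s.2 (γ j))}
  | .dec j q₀ q₁ => {tapeAction j γ (decAction s.1 q₀ q₁ s.2 (γ j))}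

/-- The machine that executes a counter program. Each counter is kept in binary on a work tape of
its own, least significant bit first, to the right of the initial cell, which stays blank. -/
def compile (a b : ℕ) [Finite Q] (P : Q → Instr (Fin a ⊕ Fin b) Q k) (start acc : Q) :
    Machine a b where
  State := Q × Phase
  Γ := Option Bool
  finite_state := inferInstance
  finite_alphabet := inferInstance
  tapes := k
  blank := none
  start := (start, .run)
  accept := (acc, .run)
  trans := programTrans P

variable [Finite Q] {P : Q → Instr (Fin a ⊕ Fin b) Q k} {start acc : Q}
  {x : Fin a → ℕ} {X : Fin b → Finset ℕ}

/-- A configuration of the machine that executes a program. -/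
abbrev cfg (P : Q → Instr (Fin a ⊕ Fin b) Q k) (start acc : Q) (q : Q) (ph : Phase)
    (h : Fin a ⊕ Fin b → ℕ) (w : Fin k → WorkTape (Option Bool)) :
    (compile a b P start acc).Config :=
  ⟨(q, ph), h, w⟩

theorem compile_step_iff {q : Q} {ph : Phase} {h : Fin a ⊕ Fin b → ℕ}
    {w : Fin k → WorkTape (Option Bool)} {c' : (compile a b P start acc).Config} :
    (compile a b P start acc).Step x X (cfg P start acc q ph h w) c' ↔
      (q, ph) ≠ (acc, Phase.run) ∧ ∃ A ∈ programTrans P (q, ph)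
        (fun i => readInput (inputWord x X i) (h i)) (fun i => (w i).head),
        c' = cfg P start acc A.state.1 A.state.2
          (fun i => moveInput (inputWord x X i) (h i) (A.inputMove i))
          (fun i => (w i).update none (A.write i) (A.workMove i)) :=
  Iff.rfl

/-- A step that works on one tape is deterministic and changes this tape only. -/
theorem step_iff_of_trans_eq_tapeAction {q : Q} {ph : Phase} {h : Fin a ⊕ Fin b → ℕ}
    {w : Fin k → WorkTape (Option Bool)} {j : Fin k} {r : (Q × Phase) × Option Bool × Move}
    (hq : (q, ph) ≠ (acc, Phase.run))
    (ht : programTrans P (q, ph)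
      (fun i => readInput (inputWord x X i) (h i)) (fun i => (w i).head) =
        {tapeAction j (fun i => (w i).head) r})
    (c' : (compile a b P start acc).Config) :
    (compile a b P start acc).Step x X (cfg P start acc q ph h w) c' ↔
      c' = cfg P start acc r.1.1 r.1.2 h
        (Function.update w j ((w j).update none r.2.1 r.2.2)) := by
  have hwork : (fun i => (w i).update none ((tapeAction (ι := Fin a ⊕ Fin b) j
      (fun i => (w i).head) r).write i) ((tapeAction (ι := Fin a ⊕ Fin b) j
      (fun i => (w i).head) r).workMove i)) =
      Function.update w j ((w j).update none r.2.1 r.2.2) := by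
    funext i
    by_cases hi : i = j
    · subst hi
      simp [tapeAction]
    · simp [tapeAction, hi, WorkTape.update]
  rw [compile_step_iff, ht]
  simp only [Set.mem_singleton_iff, exists_eq_left, hwork]
  exact ⟨fun h => h.2, fun h => ⟨hq, h⟩⟩

end Compile


/-! ### Execution of counter instructions -/

/-- The number with the binary digits `l`, least significant digit first. -/
def bitsVal : List Bool → ℕ
  | [] => 0
  | v :: l => v.toNat + 2 * bitsVal l

/-- The tape holds a counter with value `v` and at most `W` binary digits: the head is on the home
cell, and the digits, which may have leading zeros, are followed by at most one visited blank. -/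
def IsCounter (W : ℕ) (T : WorkTape (Option Bool)) (v : ℕ) : Prop :=
  ∃ (l : List Bool) (e : ℕ), T = ⟨[], none, l.map some ++ List.replicate e none⟩ ∧
    bitsVal l = v ∧ l.length ≤ W ∧ e ≤ 1

/-- A tape whose head has moved from the home cell across the digits `M`, nearest digit first, to
the first cell of `r`. -/
def carryTape (M : List Bool) (r : List (Option Bool)) : WorkTape (Option Bool) :=
  ⟨M.map some ++ [none], r.headD none, r.tail⟩

/-- A tape whose head is on the first of the digits `M`, or on the home cell if there are none;
further to the left come the other digits `M` and the home cell, to the right `r`. -/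
def backTape (M : List Bool) (r : List (Option Bool)) : WorkTape (Option Bool) :=
  ⟨(M.map some ++ [none]).tail, (M.map some ++ [none]).headD none, r⟩

theorem IsCounter.space_le {W : ℕ} {T : WorkTape (Option Bool)} {v : ℕ} (h : IsCounter W T v) :
    T.space ≤ W + 2 := by
  obtain ⟨l, e, rfl, -, hl, he⟩ := h
  simp only [WorkTape.space, List.length_nil, List.length_append, List.length_map,
    List.length_replicate]
  omega

theorem space_carryTape_le {M : List Bool} {r : List (Option Bool)} {n : ℕ}
    (h : M.length + max r.length 1 + 1 ≤ n) : (carryTape M r).space ≤ n := by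
  simp only [WorkTape.space, carryTape, List.length_append, List.length_map, List.length_tail,
    List.length_singleton]
  omega

theorem space_backTape_le {M : List Bool} {r : List (Option Bool)} {n : ℕ}
    (h : M.length + r.length + 1 ≤ n) : (backTape M r).space ≤ n := by
  simp only [WorkTape.space, backTape, List.length_tail, List.length_append, List.length_map,
    List.length_singleton]
  omega

section Execution

variable {a b k : ℕ} {Q : Type} [Finite Q]

/-- `HasRuns` for a configuration of the machine that executes a program, where work tapes may have
at most `W + 2` cells. -/
abbrev MachineRuns (P : Q → Instr (Fin a ⊕ Fin b) Q k) (start acc : Q) (x : Fin a → ℕ)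
    (X : Fin b → Finset ℕ) (W : ℕ) (q : Q) (ph : Phase) (h : Fin a ⊕ Fin b → ℕ)
    (w : Fin k → WorkTape (Option Bool)) (m T : ℕ) : Prop :=
  HasRuns ((compile a b P start acc).Step x X) (fun c => c.state = (acc, Phase.run))
    (fun c => ∀ j, (c.work j).space ≤ W + 2) (cfg P start acc q ph h w) m T

variable {P : Q → Instr (Fin a ⊕ Fin b) Q k} {start acc : Q} {x : Fin a → ℕ}
  {X : Fin b → Finset ℕ} {W : ℕ} {q : Q} {h : Fin a ⊕ Fin b → ℕ}
  {w : Fin k → WorkTape (Option Bool)} {j : Fin k} {m T : ℕ}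
  {act : Phase → Option Bool → (Q × Phase) × Option Bool × Move}

/-- In state `q` the machine works on tape `j` as told by `act`. -/
def ActsOn (P : Q → Instr (Fin a ⊕ Fin b) Q k) (acc : Q) (q : Q) (j : Fin k)
    (act : Phase → Option Bool → (Q × Phase) × Option Bool × Move) : Prop :=
  q ≠ acc ∧ ∀ ph σ γ, programTrans P (q, ph) σ γ = {tapeAction j γ (act ph (γ j))}

/-- A step on tape `j`, whose contents are `t`. -/
theorem MachineRuns.tape_step (hact : ActsOn P acc q j act)
    (hw : ∀ i, (w i).space ≤ W + 2) {t : WorkTape (Option Bool)} (ht : t.space ≤ W + 2)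
    {ph ph' : Phase} {q' : Q} {s : Option Bool} {mv : Move}
    (hr : act ph t.head = ((q', ph'), s, mv))
    (H : MachineRuns P start acc x X W q' ph' h (Function.update w j (t.update none s mv)) m T) :
    MachineRuns P start acc x X W q ph h (Function.update w j t) m (T + 1) := by
  have hq : (q, ph) ≠ (acc, Phase.run) := fun e => hact.1 (congrArg Prod.fst e)
  have hok : ∀ i : Fin k, (Function.update w j t i).space ≤ W + 2 := by
    intro i
    by_cases hi : i = j
    · subst hi
      simpa using ht
    · simpa [hi] using hw i
  refine HasRuns.step hq hok
    (step_iff_of_trans_eq_tapeAction (j := j) (r := ((q', ph'), s, mv)) hq ?_) ?_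
  · rw [hact.2]
    simp [hr]
  · simpa using H

/-- The head returns to the home cell and applies `g` to the digits it crosses. -/
theorem MachineRuns.return_home (hact : ActsOn P acc q j act)
    (hw : ∀ i, (w i).space ≤ W + 2) {ph : Phase} {q' : Q} {g : Bool → Bool}
    (h0 : act ph none = ((q', .run), none, .stay))
    (h1 : ∀ v, act ph (some v) = ((q, ph), some (g v), .left)) {M : List Bool} :
    ∀ {r : List (Option Bool)}, M.length + r.length + 1 ≤ W + 2 →
    MachineRuns P start acc x X W q' .run h
      (Function.update w j ⟨[], none, (M.map g).reverse.map some ++ r⟩) m T →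
    MachineRuns P start acc x X W q ph h (Function.update w j (backTape M r)) m
      (T + M.length + 1) := by
  induction M with
  | nil => exact fun hr H => H.tape_step hact hw (space_backTape_le hr) h0
  | cons v M ih =>
    intro r hr H
    refine MachineRuns.tape_step hact hw (space_backTape_le hr) (h1 v)
      (ih (r := some (g v) :: r) ?_ ?_)
    · simp only [List.length_cons] at hr ⊢
      omega
    · simpa using H

theorem MachineRuns.carry_advance (hact : ActsOn P acc q j act)
    (hw : ∀ i, (w i).space ≤ W + 2) {M : List Bool} {r : List (Option Bool)} {v : Bool}
    (hc : act .carry (r.headD none) = ((q, .carry), some v, .right))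
    (hr : M.length + max r.length 1 + 1 ≤ W + 2)
    (H : MachineRuns P start acc x X W q .carry h
      (Function.update w j (carryTape (v :: M) r.tail)) m T) :
    MachineRuns P start acc x X W q .carry h (Function.update w j (carryTape M r)) m (T + 1) :=
  MachineRuns.tape_step hact hw (space_carryTape_le hr) hc H

/-- The head turns at the first cell of `r`, writes `s` there, and returns to the home cell. -/
theorem MachineRuns.carry_return (hact : ActsOn P acc q j act)
    (hw : ∀ i, (w i).space ≤ W + 2) {ph : Phase} {q' : Q} {g : Bool → Bool}
    {M : List Bool} {r : List (Option Bool)} {s : Option Bool}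
    (hc : act .carry (r.headD none) = ((q, ph), s, .left))
    (h0 : act ph none = ((q', .run), none, .stay))
    (h1 : ∀ v, act ph (some v) = ((q, ph), some (g v), .left))
    (hr : M.length + max r.length 1 + 1 ≤ W + 2)
    (H : MachineRuns P start acc x X W q' .run h
      (Function.update w j ⟨[], none, (M.map g).reverse.map some ++ s :: r.tail⟩) m T) :
    MachineRuns P start acc x X W q .carry h (Function.update w j (carryTape M r)) m
      (T + M.length + 2) := by
  refine MachineRuns.tape_step hact hw (space_carryTape_le hr) hc
    (MachineRuns.return_home hact hw h0 h1 (r := s :: r.tail) ?_ H)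
  simp only [List.length_cons, List.length_tail]
  omega

/-- The carry phase of an increment. The digits `M` have been rewritten, `l` are left; if the carry
runs over all of `l`, the counter gets a new digit. -/
theorem MachineRuns.carry_inc {q' : Q} (hact : ActsOn P acc q j (incAction q q'))
    (hw : ∀ i, (w i).space ≤ W + 2) {e : ℕ} (he : e ≤ 1) {l : List Bool} :
    ∀ {M : List Bool}, M.length + l.length ≤ W → bitsVal l + 1 < 2 ^ (W - M.length) →
    (∀ l' e', bitsVal l' = bitsVal l + 1 → M.length + l'.length ≤ W → e' ≤ 1 →
      MachineRuns P start acc x X W q' .run h (Function.update w j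
        ⟨[], none, (M.reverse ++ l').map some ++ List.replicate e' none⟩) m T) →
    MachineRuns P start acc x X W q .carry h (Function.update w j
      (carryTape M (l.map some ++ List.replicate e none))) m
      (T + 2 * l.length + M.length + 2) := by
  induction l with
  | nil =>
    intro M hM hval H
    have hM1 : M.length + 1 ≤ W := by
      by_contra hlt
      rw [show W - M.length = 0 by omega] at hval
      omega
    refine MachineRuns.carry_return hact hw (s := some true) (g := id) (q' := q') (ph := .back)
      ?_ rfl (fun _ => rfl) ?_ ?_
    · obtain rfl | rfl : e = 0 ∨ e = 1 := by omega
      all_goals rfl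
    · simp
      omega
    · have := H [true] (e - 1) rfl hM1 (by omega)
      simpa using this
  | cons v l ih =>
    intro M hM hval H
    have hlen : M.length + max ((v :: l).map some ++ List.replicate e none).length 1 + 1 ≤
        W + 2 := by
      simp only [List.length_append, List.length_map, List.length_replicate, List.length_cons]
        at hM ⊢
      omega
    cases v with
    | false =>
      refine (MachineRuns.carry_return hact hw (s := some true) (g := id) (q' := q') (ph := .back)
        rfl rfl (fun _ => rfl) hlen ?_ (T := T)).mono (by omega)
      have := H (true :: l) e (by simp [bitsVal]; omega) hM he
      simpa using this
    | true =>
      refine (MachineRuns.carry_advance hact hw (v := false) rfl hlen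
        (ih (M := false :: M) ?_ ?_ ?_)).mono ?_
      · simp only [List.length_cons] at hM ⊢
        omega
      · simp only [bitsVal, Bool.toNat_true, List.length_cons] at hval hM ⊢
        rw [show W - M.length = W - (M.length + 1) + 1 by omega, pow_succ] at hval
        omega
      · intro l' e' hv hl he'
        have := H (false :: l') e' (by simp [bitsVal, hv]; omega)
          (by simp only [List.length_cons] at hl ⊢; omega) he'
        simpa using this
      · simp only [List.length_cons]
        omega

/-- The carry phase of a decrement of the counter value `0`, which is undone on the way back. The
digits `M` have been turned into ones. -/
theorem MachineRuns.carry_dec_zero {q₀ q₁ : Q}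
    (hact : ActsOn P acc q j (decAction q q₀ q₁)) (hw : ∀ i, (w i).space ≤ W + 2)
    {e : ℕ} (he : e ≤ 1) {l : List Bool} :
    ∀ {M : List Bool}, M.length + l.length ≤ W → bitsVal l = 0 →
    MachineRuns P start acc x X W q₀ .run h (Function.update w j
        ⟨[], none, ((M.map fun _ => false).reverse ++ l).map some ++ List.replicate 1 none⟩) m T →
    MachineRuns P start acc x X W q .carry h (Function.update w j
      (carryTape M (l.map some ++ List.replicate e none))) m
      (T + 2 * l.length + M.length + 2) := by
  induction l with
  | nil =>
    intro M hM hval H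
    refine MachineRuns.carry_return hact hw (s := none) (g := fun _ => false) (q' := q₀)
      (ph := .undo) ?_ rfl (fun _ => rfl) ?_ ?_
    · obtain rfl | rfl : e = 0 ∨ e = 1 := by omega
      all_goals rfl
    · simp at hM ⊢
      omega
    · obtain rfl | rfl : e = 0 ∨ e = 1 := by omega
      all_goals simpa using H
  | cons v l ih =>
    intro M hM hval H
    have hlen : M.length + max ((v :: l).map some ++ List.replicate e none).length 1 + 1 ≤
        W + 2 := by
      simp only [List.length_append, List.length_map, List.length_replicate, List.length_cons]
        at hM ⊢
      omega
    cases v with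
    | true => simp [bitsVal] at hval
    | false =>
      refine (MachineRuns.carry_advance hact hw (v := true) rfl hlen
        (ih (M := true :: M) ?_ ?_ ?_)).mono ?_
      · simp only [List.length_cons] at hM ⊢
        omega
      · simpa [bitsVal] using hval
      · simpa using H
      · simp only [List.length_cons]
        omega

/-- The carry phase of a decrement of a positive counter value. -/
theorem MachineRuns.carry_dec_succ {q₀ q₁ : Q}
    (hact : ActsOn P acc q j (decAction q q₀ q₁)) (hw : ∀ i, (w i).space ≤ W + 2)
    {e : ℕ} (he : e ≤ 1) {l : List Bool} :
    ∀ {M : List Bool}, M.length + l.length ≤ W → bitsVal l ≠ 0 →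
    (∀ l', bitsVal l' = bitsVal l - 1 → l'.length = l.length →
      MachineRuns P start acc x X W q₁ .run h (Function.update w j
        ⟨[], none, (M.reverse ++ l').map some ++ List.replicate e none⟩) m T) →
    MachineRuns P start acc x X W q .carry h (Function.update w j
      (carryTape M (l.map some ++ List.replicate e none))) m
      (T + 2 * l.length + M.length + 2) := by
  induction l with
  | nil => exact fun _ hval => absurd rfl hval
  | cons v l ih =>
    intro M hM hval H
    have hlen : M.length + max ((v :: l).map some ++ List.replicate e none).length 1 + 1 ≤
        W + 2 := by
      simp only [List.length_append, List.length_map, List.length_replicate, List.length_cons]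
        at hM ⊢
      omega
    cases v with
    | true =>
      refine (MachineRuns.carry_return hact hw (s := some false) (g := id) (q' := q₁) (ph := .back)
        rfl rfl (fun _ => rfl) hlen ?_ (T := T)).mono (by omega)
      have := H (false :: l) (by simp [bitsVal]) rfl
      simpa using this
    | false =>
      refine (MachineRuns.carry_advance hact hw (v := true) rfl hlen
        (ih (M := true :: M) ?_ ?_ ?_)).mono ?_
      · simp only [List.length_cons] at hM ⊢
        omega
      · simpa [bitsVal] using hval
      · intro l' hv hl
        have h0 : bitsVal l ≠ 0 := by simpa [bitsVal] using hval
        have := H (true :: l') (by simp [bitsVal, hv]; omega) (by simp [hl])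
        simpa using this
      · simp only [List.length_cons]
        omega

/-- All configurations with state `q`, head positions `h` and counters `c` of at most `W` binary
digits have exactly `m` accepting runs, and all their runs have at most `T` program steps. A program
step takes at most `2 * W + 3` machine steps: the head crosses the at most `W` digits of a counter
and the cell behind them, and returns. -/
def ProgramRuns (P : Q → Instr (Fin a ⊕ Fin b) Q k) (start acc : Q) (x : Fin a → ℕ)
    (X : Fin b → Finset ℕ) (W : ℕ) (q : Q) (h : Fin a ⊕ Fin b → ℕ) (c : Fin k → ℕ) (m T : ℕ) :
    Prop :=
  ∀ w, (∀ j, IsCounter W (w j) (c j)) →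
    MachineRuns P start acc x X W q .run h w m (T * (2 * W + 3) + 1)

namespace ProgramRuns

variable {c : Fin k → ℕ}

theorem mono (H : ProgramRuns P start acc x X W q h c m T) {T' : ℕ} (hT : T ≤ T') :
    ProgramRuns P start acc x X W q h c m T' := fun w hw =>
  (H w hw).mono (by gcongr)

theorem isCounter_update {v : ℕ} {t : WorkTape (Option Bool)}
    (hw : ∀ j, IsCounter W (w j) (c j)) (ht : IsCounter W t v) (i : Fin k) :
    IsCounter W (Function.update w j t i) (Function.update c j v i) := by
  by_cases hi : i = j
  · subst hi
    simpa using ht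
  · simpa [hi] using hw i

theorem accept : ProgramRuns P start acc x X W acc h c 1 0 := fun _ hw =>
  HasRuns.mono (T := 1) (HasRuns.accept (fun _ H => H.1 rfl) (fun j => (hw j).space_le) rfl)
    (Nat.le_add_left _ _)

theorem reject (hq : q ≠ acc)
    {f : (Fin a ⊕ Fin b → InSym) → Option (Q × (Fin a ⊕ Fin b → Move))}
    (hP : P q = .io f) (hf : f (fun i => readInput (inputWord x X i) (h i)) = none) :
    ProgramRuns P start acc x X W q h c 0 0 := fun w hw => by
  have hacc : (q, Phase.run) ≠ (acc, Phase.run) := fun H => hq (Prod.ext_iff.1 H).1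
  refine HasRuns.mono (T := 1) (HasRuns.reject (fun d => ?_) (fun j => (hw j).space_le) hacc)
    (Nat.le_add_left _ _)
  rw [compile_step_iff]
  simp [programTrans, hP, hf]

theorem io (hq : q ≠ acc) {f : (Fin a ⊕ Fin b → InSym) → Option (Q × (Fin a ⊕ Fin b → Move))}
    {q' : Q} {mv : Fin a ⊕ Fin b → Move} (hP : P q = .io f)
    (hf : f (fun i => readInput (inputWord x X i) (h i)) = some (q', mv))
    (H : ProgramRuns P start acc x X W q' (fun i => moveInput (inputWord x X i) (h i) (mv i)) c
      m T) :
    ProgramRuns P start acc x X W q h c m (T + 1) := fun w hw => by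
  have hacc : (q, Phase.run) ≠ (acc, Phase.run) := fun H => hq (Prod.ext_iff.1 H).1
  refine HasRuns.mono (T := T * (2 * W + 3) + 1 + 1)
    (HasRuns.step hacc (fun j => (hw j).space_le) (fun e => ?_) (H w hw))
    (by rw [Nat.add_one_mul T]; omega)
  rw [compile_step_iff]
  simp [programTrans, hP, hf, hq, WorkTape.update]

theorem branch (hq : q ≠ acc) {q₁ q₂ : Q} {m₁ m₂ : ℕ} (hP : P q = .branch q₁ q₂) (hne : q₁ ≠ q₂)
    (H₁ : ProgramRuns P start acc x X W q₁ h c m₁ T)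
    (H₂ : ProgramRuns P start acc x X W q₂ h c m₂ T) :
    ProgramRuns P start acc x X W q h c (m₁ + m₂) (T + 1) := fun w hw => by
  have hacc : (q, Phase.run) ≠ (acc, Phase.run) := fun H => hq (Prod.ext_iff.1 H).1
  refine HasRuns.mono (T := T * (2 * W + 3) + 1 + 1)
    (HasRuns.branch hacc (fun j => (hw j).space_le) ?_ (fun e => ?_) (H₁ w hw) (H₂ w hw))
    (by rw [Nat.add_one_mul T]; omega)
  · intro H
    exact hne (Prod.ext_iff.1 (Machine.Config.mk.inj H).1).1
  rw [compile_step_iff]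
  simp [programTrans, hP, hq, WorkTape.update, moveInput, or_and_right, exists_or]

/-- The first step of a counter instruction takes the head from the home cell to the first
digit. -/
theorem of_carry (hact : ActsOn P acc q j act) (hrun : act .run none = ((q, .carry), none, .right))
    (hw : ∀ i, IsCounter W (w i) (c i)) {T' : ℕ}
    (H : ∀ l e, bitsVal l = c j → l.length ≤ W → e ≤ 1 →
      MachineRuns P start acc x X W q .carry h (Function.update w j
        (carryTape [] (l.map some ++ List.replicate e none))) m (T' + 2 * l.length + 0 + 2))
    (hT : T' + 2 * W + 3 ≤ T) :
    MachineRuns P start acc x X W q .run h w m T := by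
  obtain ⟨l, e, hl, hv, hlW, he⟩ := hw j
  have h1 : w = Function.update w j (w j) := by simp
  rw [h1, hl]
  refine (MachineRuns.tape_step hact (fun i => (hw i).space_le) ?_ hrun
    (H l e hv hlW he)).mono (by omega)
  exact hl ▸ (hw j).space_le

theorem inc (hq : q ≠ acc) {q' : Q} (hP : P q = .inc j q') (hlt : c j + 1 < 2 ^ W)
    (H : ProgramRuns P start acc x X W q' h (Function.update c j (c j + 1)) m T) :
    ProgramRuns P start acc x X W q h c m (T + 1) := fun w hw => by
  have hact : ActsOn P acc q j (incAction q q') := ⟨hq, fun ph σ γ => by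
    simp only [programTrans, hP]⟩
  refine of_carry (T' := T * (2 * W + 3) + 1) hact rfl hw (fun l e hv hl he => ?_)
    (by rw [Nat.add_one_mul T]; omega)
  refine MachineRuns.carry_inc (M := []) hact (fun i => (hw i).space_le) he (by simpa using hl)
    (by simpa [hv] using hlt) fun l' e' hv' hl' he' => ?_
  exact H _ (isCounter_update hw ⟨l', e', rfl, by rw [hv', hv], by simpa using hl', he'⟩)

theorem dec_zero (hq : q ≠ acc) {q₀ q₁ : Q} (hP : P q = .dec j q₀ q₁) (hc : c j = 0)
    (H : ProgramRuns P start acc x X W q₀ h c m T) :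
    ProgramRuns P start acc x X W q h c m (T + 1) := fun w hw => by
  have hact : ActsOn P acc q j (decAction q q₀ q₁) := ⟨hq, fun ph σ γ => by
    simp only [programTrans, hP]⟩
  refine of_carry (T' := T * (2 * W + 3) + 1) hact rfl hw (fun l e hv hl he => ?_)
    (by rw [Nat.add_one_mul T]; omega)
  refine MachineRuns.carry_dec_zero (M := []) hact (fun i => (hw i).space_le) he
    (by simpa using hl) (by omega) ?_
  have := isCounter_update (j := j) hw ⟨l, 1, rfl, hv, hl, le_rfl⟩
  rw [Function.update_eq_self] at this
  exact H _ this

theorem dec_succ (hq : q ≠ acc) {q₀ q₁ : Q} (hP : P q = .dec j q₀ q₁) (hc : c j ≠ 0)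
    (H : ProgramRuns P start acc x X W q₁ h (Function.update c j (c j - 1)) m T) :
    ProgramRuns P start acc x X W q h c m (T + 1) := fun w hw => by
  have hact : ActsOn P acc q j (decAction q q₀ q₁) := ⟨hq, fun ph σ γ => by
    simp only [programTrans, hP]⟩
  refine of_carry (T' := T * (2 * W + 3) + 1) hact rfl hw (fun l e hv hl he => ?_)
    (by rw [Nat.add_one_mul T]; omega)
  refine MachineRuns.carry_dec_succ (M := []) hact (fun i => (hw i).space_le) he
    (by simpa using hl) (by omega) fun l' hv' hl' => ?_
  exact H _ (isCounter_update hw ⟨l', e, rfl, by rw [hv', hv], by omega, he⟩)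

end ProgramRuns

end Execution


/-! ### A counter program for `#STCON` -/

namespace InSym

/-- The symbol is the left end marker. -/
def isLeftEnd : InSym → Bool
  | leftEnd => true
  | _ => false

/-- The symbol is the right end marker. -/
def isRightEnd : InSym → Bool
  | rightEnd => true
  | _ => false

/-- The symbol is the bit `1`. -/
def isOne : InSym → Bool
  | bit true => true
  | _ => false

end InSym

theorem isLeftEnd_readInput {w : List Bool} {h : ℕ} :
    (readInput w h).isLeftEnd = true ↔ h = 0 := by
  rw [← readInput_eq_leftEnd (w := w)]
  cases readInput w h <;> simp [InSym.isLeftEnd]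

theorem isRightEnd_readInput {w : List Bool} {h : ℕ} :
    (readInput w h).isRightEnd = true ↔ w.length + 1 ≤ h := by
  rw [← readInput_eq_rightEnd]
  cases readInput w h <;> simp [InSym.isRightEnd]

theorem isOne_readInput {w : List Bool} {h : ℕ} :
    (readInput w h).isOne = true ↔ ∃ k, h = k + 1 ∧ w[k]? = some true := by
  have : (∃ k, h = k + 1 ∧ w[k]? = some true) ↔ readInput w h = .bit true := by
    rw [readInput_eq_bit]
    exact exists_congr fun k => ⟨fun H => ⟨by omega, H⟩, fun H => H.2⟩
  rw [this]
  rcases readInput w h with _ | (_ | _) | _ <;> simp [InSym.isOne]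

/-- The states of the program for `#STCON`. The states with a Boolean parameter belong to the
subroutine that passes from the counter value `z` to `z + 1` and moves the head on the string by
`2 (z + 1)`; the parameter tells where to return. -/
inductive PathState : Type
  | start | walk | arrive | unwind | test | testLast | hit | hitBranch
  | leave | room | guess | guessBranch | next | nextMove | take
  | rewindString | rewindTarget | reset | accept
  | add (r : Bool) | addLoop (r : Bool) | addCount (r : Bool) | addMove (r : Bool)
  | addMoveAgain (r : Bool) | addRestore (r : Bool) | addRestoreInc (r : Bool)
  | addReturn (r : Bool)

instance : Finite PathState := by
  refine Set.finite_univ_iff.1 ((List.finite_toSet (([.start, .walk, .arrive, .unwind, .test,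
    .testLast, .hit, .hitBranch, .leave, .room, .guess, .guessBranch, .next, .nextMove, .take,
    .rewindString, .rewindTarget, .reset, .accept] : List PathState) ++
    [true, false].flatMap fun r => [.add r, .addLoop r, .addCount r, .addMove r, .addMoveAgain r,
      .addRestore r, .addRestoreInc r, .addReturn r])).subset fun q _ => ?_)
  cases q <;> simp

/-- A family indexed by the input tapes of `#STCON`, which hold `n`, `s`, `t`, `p` and the graph. -/
def tapeFamily {α : Type} (n s t p g : α) : Fin 4 ⊕ Fin 1 → α :=
  Sum.elim ![n, s, t, p] ![g]

open PathState Move in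
/-- The program for `#STCON`. A vertex `v` is represented by the position `v + 1` of the head on
`n`; the head on `p` counts the edges of the path. When a vertex is entered, its number is
transferred to the first counter `z`, while the head on `n` returns to the left end. Then a
successor is guessed by moving the head on `n` to the right again. Throughout, `z` is the sum of
the numbers `u` of the present vertex and `v` of the guessed one, and the head on the string is
kept at the bit `⟨u,v⟩`. -/
def pathProgram : PathState → Instr (Fin 4 ⊕ Fin 1) PathState 2
  | start => .io fun _ => some (walk, tapeFamily right right stay stay stay)
  -- the head on `n` is taken to the cell `s + 1`; no path exists if `n ≤ s`
  | walk => .io fun σ =>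
      if (σ (.inl 1)).isRightEnd then
        if (σ (.inl 0)).isRightEnd then none
        else some (arrive, tapeFamily stay stay stay stay stay)
      else some (walk, tapeFamily right right stay stay stay)
  | arrive => .io fun _ => some (unwind, tapeFamily left stay stay stay right)
  | unwind => .io fun σ =>
      if (σ (.inl 0)).isLeftEnd then some (test, tapeFamily stay stay stay stay stay)
      else some (add true, tapeFamily stay stay right stay stay)
  -- the head on `t` is at `min v (t + 1)`; so `v = t` if it has not reached the right end, but does
  -- so in one more step
  | test => .io fun σ =>
      if (σ (.inl 2)).isRightEnd then some (leave, tapeFamily stay stay stay stay stay)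
      else some (testLast, tapeFamily stay stay right stay stay)
  | testLast => .io fun σ =>
      if (σ (.inl 2)).isRightEnd then some (hit, tapeFamily stay stay stay stay stay)
      else some (leave, tapeFamily stay stay stay stay stay)
  -- if no edge has been taken, then `s = t`, and the value is `0`
  | hit => .io fun σ =>
      if (σ (.inl 3)).isLeftEnd then none
      else some (hitBranch, tapeFamily stay stay stay stay stay)
  -- the path may end at this visit of `t`, or go on
  | hitBranch => .branch accept leave
  | leave => .io fun _ => some (room, tapeFamily right stay stay right stay)
  | room => .io fun σ =>
      if (σ (.inl 3)).isRightEnd then none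
      else some (guess, tapeFamily stay stay stay stay stay)
  | guess => .io fun σ =>
      if (σ (.inl 0)).isRightEnd then none
      else some (guessBranch, tapeFamily stay stay stay stay stay)
  | guessBranch => .branch take next
  -- the step from `⟨u,v⟩` to `⟨u,v+1⟩` is `2 (u + v + 2)`: two cells here, `2 (z + 1)` cells in
  -- `add`
  | next => .io fun _ => some (nextMove, tapeFamily right stay stay stay right)
  | nextMove => .io fun _ => some (add false, tapeFamily stay stay stay stay right)
  | take => .io fun σ =>
      if (σ (.inr 0)).isOne then some (rewindString, tapeFamily stay stay stay stay stay)
      else none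
  | rewindString => .io fun σ =>
      if (σ (.inr 0)).isLeftEnd then some (rewindTarget, tapeFamily stay stay stay stay stay)
      else some (rewindString, tapeFamily stay stay stay stay left)
  | rewindTarget => .io fun σ =>
      if (σ (.inl 2)).isLeftEnd then some (reset, tapeFamily stay stay stay stay stay)
      else some (rewindTarget, tapeFamily stay stay left stay stay)
  | reset => .dec 0 arrive reset
  | accept => .io fun _ => none
  -- the second counter keeps the value of the first, which is used up by counting the moves
  | add r => .inc 0 (addLoop r)
  | addLoop r => .dec 0 (addRestore r) (addCount r)
  | addCount r => .inc 1 (addMove r)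
  | addMove r => .io fun _ => some (addMoveAgain r, tapeFamily stay stay stay stay right)
  | addMoveAgain r => .io fun _ => some (addLoop r, tapeFamily stay stay stay stay right)
  | addRestore r => .dec 1 (addReturn r) (addRestoreInc r)
  | addRestoreInc r => .inc 0 (addRestore r)
  | addReturn true => .io fun _ => some (unwind, tapeFamily left stay stay stay stay)
  | addReturn false => .io fun _ => some (guess, tapeFamily stay stay stay stay stay)

section Program

variable (x : Fin 4 → ℕ) (X : Fin 1 → Finset ℕ) (W : ℕ)

/-- `ProgramRuns` for the program for `#STCON`, with the positions `n, s, t, p, g` of the heads and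
the values `z, y` of the counters. -/
def PathRuns (q : PathState) (n s t p g z y m T : ℕ) : Prop :=
  ProgramRuns pathProgram .start .accept x X W q (tapeFamily n s t p g) ![z, y] m T

/-- The position of the head on the string at the bit `i`, or on the right end marker if there is
no such bit. -/
def stringPos (i : ℕ) : ℕ := min (i + 1) (strLen (X 0) + 1)

/-- The movement of a head on a tape that holds a word of length `l`. -/
def moveHead (l h : ℕ) : Move → ℕ
  | .left => h - 1
  | .stay => h
  | .right => min (h + 1) (l + 1)

variable {x X W}

namespace PathRuns

variable {q q' : PathState} {n s t p g z y m T : ℕ}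

theorem mono (H : PathRuns x X W q n s t p g z y m T) {T' : ℕ} (hT : T ≤ T') :
    PathRuns x X W q n s t p g z y m T' :=
  ProgramRuns.mono H hT

theorem zero_of_io {f : (Fin 4 ⊕ Fin 1 → InSym) → Option (PathState × (Fin 4 ⊕ Fin 1 → Move))}
    (hq : q ≠ .accept) (hP : pathProgram q = .io f)
    (hf : f (fun i => readInput (inputWord x X i) (tapeFamily n s t p g i)) = none) :
    PathRuns x X W q n s t p g z y 0 T :=
  (ProgramRuns.reject hq hP hf).mono (Nat.zero_le _)

theorem io {f : (Fin 4 ⊕ Fin 1 → InSym) → Option (PathState × (Fin 4 ⊕ Fin 1 → Move))}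
    {a b c d e : Move} (hP : pathProgram q = .io f)
    (hf : f (fun i => readInput (inputWord x X i) (tapeFamily n s t p g i)) =
      some (q', tapeFamily a b c d e))
    (H : PathRuns x X W q' (moveHead (x 0) n a) (moveHead (x 1) s b) (moveHead (x 2) t c)
      (moveHead (x 3) p d) (moveHead (strLen (X 0)) g e) z y m T) :
    PathRuns x X W q n s t p g z y m (T + 1) := by
  have hq : q ≠ .accept := by
    rintro rfl
    obtain rfl : (fun _ => none) = f := Instr.io.inj hP
    simp at hf
  refine ProgramRuns.io hq hP hf ?_
  have hmove : ∀ (w : List Bool) (l h : ℕ) (v : Move), w.length = l →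
      moveInput w h v = moveHead l h v := by
    rintro w _ h v rfl
    cases v <;> rfl
  have hfam : (fun i => moveInput (inputWord x X i) (tapeFamily n s t p g i)
      (tapeFamily a b c d e i)) = tapeFamily (moveHead (x 0) n a) (moveHead (x 1) s b)
        (moveHead (x 2) t c) (moveHead (x 3) p d) (moveHead (strLen (X 0)) g e) := by
    funext i
    rcases i with i | i <;> fin_cases i <;> exact hmove _ _ _ _ (by simp [inputWord])
  rw [hfam]
  exact H

theorem update_fst (v : ℕ) : Function.update ![z, y] 0 v = ![v, y] := by
  funext i
  fin_cases i <;> rfl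

theorem update_snd (v : ℕ) : Function.update ![z, y] 1 v = ![z, v] := by
  funext i
  fin_cases i <;> rfl

theorem inc_fst (hP : pathProgram q = .inc 0 q') (hlt : z + 1 < 2 ^ W)
    (H : PathRuns x X W q' n s t p g (z + 1) y m T) : PathRuns x X W q n s t p g z y m (T + 1) := by
  have hq : q ≠ .accept := by
    rintro rfl
    cases hP
  refine ProgramRuns.inc hq hP hlt ?_
  rw [update_fst]
  exact H

theorem inc_snd (hP : pathProgram q = .inc 1 q') (hlt : y + 1 < 2 ^ W)
    (H : PathRuns x X W q' n s t p g z (y + 1) m T) : PathRuns x X W q n s t p g z y m (T + 1) := by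
  have hq : q ≠ .accept := by
    rintro rfl
    cases hP
  refine ProgramRuns.inc hq hP hlt ?_
  rw [update_snd]
  exact H

theorem dec_fst_zero {q₁ : PathState} (hP : pathProgram q = .dec 0 q' q₁)
    (H : PathRuns x X W q' n s t p g 0 y m T) : PathRuns x X W q n s t p g 0 y m (T + 1) := by
  have hq : q ≠ .accept := by
    rintro rfl
    cases hP
  exact ProgramRuns.dec_zero hq hP rfl H

theorem dec_fst_succ {q₀ : PathState} (hP : pathProgram q = .dec 0 q₀ q')
    (H : PathRuns x X W q' n s t p g z y m T) : PathRuns x X W q n s t p g (z + 1) y m (T + 1) := by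
  have hq : q ≠ .accept := by
    rintro rfl
    cases hP
  refine ProgramRuns.dec_succ hq hP (Nat.succ_ne_zero z) ?_
  rw [update_fst]
  exact H

theorem dec_snd_zero {q₁ : PathState} (hP : pathProgram q = .dec 1 q' q₁)
    (H : PathRuns x X W q' n s t p g z 0 m T) : PathRuns x X W q n s t p g z 0 m (T + 1) := by
  have hq : q ≠ .accept := by
    rintro rfl
    cases hP
  exact ProgramRuns.dec_zero hq hP rfl H

theorem dec_snd_succ {q₀ : PathState} (hP : pathProgram q = .dec 1 q₀ q')
    (H : PathRuns x X W q' n s t p g z y m T) : PathRuns x X W q n s t p g z (y + 1) m (T + 1) := by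
  have hq : q ≠ .accept := by
    rintro rfl
    cases hP
  refine ProgramRuns.dec_succ hq hP (Nat.succ_ne_zero y) ?_
  rw [update_snd]
  exact H

theorem branch {q₁ q₂ : PathState} {m₁ m₂ : ℕ} (hP : pathProgram q = .branch q₁ q₂) (hne : q₁ ≠ q₂)
    (H₁ : PathRuns x X W q₁ n s t p g z y m₁ T) (H₂ : PathRuns x X W q₂ n s t p g z y m₂ T) :
    PathRuns x X W q n s t p g z y (m₁ + m₂) (T + 1) := by
  have hq : q ≠ .accept := by
    rintro rfl
    cases hP
  exact ProgramRuns.branch hq hP hne H₁ H₂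

theorem isLeftEnd_iff (i : Fin 4 ⊕ Fin 1) :
    (readInput (inputWord x X i) (tapeFamily n s t p g i)).isLeftEnd = true ↔
      tapeFamily n s t p g i = 0 :=
  isLeftEnd_readInput

theorem isRightEnd_iff (i : Fin 4) :
    (readInput (inputWord x X (.inl i)) (tapeFamily n s t p g (.inl i))).isRightEnd = true ↔
      x i + 1 ≤ tapeFamily n s t p g (.inl i) := by
  rw [isRightEnd_readInput]
  simp [inputWord]

theorem isOne_stringPos_iff {i : ℕ} :
    (readInput (inputWord x X (.inr 0)) (stringPos X i)).isOne = true ↔ i ∈ X 0 := by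
  rw [isOne_readInput]
  unfold stringPos
  constructor
  · rintro ⟨k, hk, hget⟩
    have hlt : k < strLen (X 0) := by
      have := (List.getElem?_eq_some_iff.1 hget).1
      simpa [inputWord] using this
    obtain rfl : i = k := by omega
    simpa [inputWord, hlt] using hget
  · intro hi
    have hlt := lt_strLen_of_mem hi
    exact ⟨i, by omega, by simp [inputWord, hlt, hi]⟩

theorem moveHead_stringPos (i : ℕ) :
    moveHead (strLen (X 0)) (stringPos X i) .right = stringPos X (i + 1) := by
  simp only [moveHead, stringPos]
  omega

/-! ### The subroutine `add` -/

/-- The first counter is restored from the second. -/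
theorem addRestore {r : Bool} : ∀ {y z : ℕ}, z + y < 2 ^ W →
    PathRuns x X W (.addReturn r) n s t p g (z + y) 0 m T →
    PathRuns x X W (.addRestore r) n s t p g z y m (T + 2 * y + 1) := by
  intro y
  induction y with
  | zero => exact fun _ H => dec_snd_zero rfl H
  | succ y ih =>
    intro z hlt H
    refine dec_snd_succ rfl (inc_fst rfl (by omega) (ih (z := z + 1) (by omega) ?_))
    rwa [Nat.add_right_comm]

/-- The value of the first counter is transferred to the second, and the head on the string moves
two cells for each unit. -/
theorem addLoop {r : Bool} : ∀ {z y i : ℕ}, y + z < 2 ^ W →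
    PathRuns x X W (.addRestore r) n s t p (stringPos X (i + 2 * z)) 0 (y + z) m T →
    PathRuns x X W (.addLoop r) n s t p (stringPos X i) z y m (T + 4 * z + 1) := by
  intro z
  induction z with
  | zero => exact fun _ H => dec_fst_zero rfl H
  | succ z ih =>
    intro y i hlt H
    refine dec_fst_succ rfl (inc_snd rfl (by omega) (io rfl rfl (io rfl rfl ?_)))
    rw [moveHead_stringPos, moveHead_stringPos]
    refine ih (by omega) ?_
    rwa [show i + 1 + 1 + 2 * z = i + 2 * (z + 1) by ring, Nat.add_right_comm]

theorem add {r : Bool} {z i : ℕ} (hlt : z + 1 < 2 ^ W)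
    (H : PathRuns x X W (.addReturn r) n s t p (stringPos X (i + 2 * (z + 1))) (z + 1) 0 m T) :
    PathRuns x X W (.add r) n s t p (stringPos X i) z 0 m (T + 6 * (z + 1) + 3) :=
  (inc_fst rfl hlt (addLoop (by omega) (addRestore (by omega) (by simpa using H)))).mono (by omega)

end PathRuns

end Program


/-! ### Correctness of the program -/

/-- The number of nonempty paths from `u` to `t` with at most `r` edges, by recursion on the first
edge. -/
noncomputable def walkCount (n t : ℕ) (G : Finset ℕ) : ℕ → ℕ → ℕ
  | 0, _ => 0
  | r + 1, u => ∑ v ∈ Finset.range n,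
      if pair u v ∈ G then (if v = t then 1 else 0) + walkCount n t G r v else 0

theorem walkCount_eq_zero {n t : ℕ} {G : Finset ℕ} (h : n ≤ t) :
    ∀ r u, walkCount n t G r u = 0 := by
  intro r
  induction r with
  | zero => exact fun _ => rfl
  | succ r ih =>
    intro u
    refine Finset.sum_eq_zero fun v hv => ?_
    have := Finset.mem_range.1 hv
    rw [ih, if_neg (by omega : v ≠ t)]
    simp

namespace PathRuns

variable {x : Fin 4 → ℕ} {X : Fin 1 → Finset ℕ} {W : ℕ} {n s t p g z m T : ℕ}

/-- When the vertex `v` has been entered, its number is transferred to `z`. -/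
theorem unwind {v : ℕ} (hv : v < 2 ^ W)
    (H : PathRuns x X W .test 0 s (min v (x 2 + 1)) p (stringPos X (v * (v + 1))) v 0 m T) :
    ∀ {j i : ℕ}, i + j = v →
    PathRuns x X W .unwind j s (min i (x 2 + 1)) p (stringPos X (i * (i + 1))) i 0 m
      (T + j * (6 * v + 5) + 1) := by
  intro j
  induction j with
  | zero =>
    rintro i rfl
    exact io rfl (if_pos ((isLeftEnd_iff (.inl 0)).2 rfl)) (H.mono (by simp))
  | succ j ih =>
    intro i hi
    have h1 := ih (i := i + 1) (by omega)
    have h2 : PathRuns x X W (.addReturn true) (j + 1) s (min (i + 1) (x 2 + 1)) p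
        (stringPos X (i * (i + 1) + 2 * (i + 1))) (i + 1) 0 m
        (T + j * (6 * v + 5) + 1 + 1) := by
      rw [show i * (i + 1) + 2 * (i + 1) = (i + 1) * (i + 1 + 1) by ring]
      exact io rfl rfl h1
    have h3 := add (by omega) h2
    refine (io rfl (if_neg ((isLeftEnd_iff (.inl 0)).not.2 (Nat.succ_ne_zero j)))
      (T := T + j * (6 * v + 5) + 1 + 1 + 6 * (i + 1) + 3) ?_).mono ?_
    · have h4 : moveHead (x 2) (min i (x 2 + 1)) .right = min (i + 1) (x 2 + 1) := by
        simp only [moveHead]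
        omega
      rw [h4]
      exact h3
    · rw [Nat.add_one_mul j]
      omega

/-- The vertex `v` has been entered, with `z = 0` and the other heads rewound. The number `v` is
transferred to `z` and compared with the target. -/
theorem arrive {v : ℕ} (hv : v < 2 ^ W)
    (hne : v ≠ x 2 → ∀ τ ≤ x 2 + 1,
      PathRuns x X W .leave 0 s τ p (stringPos X (v * (v + 1))) v 0 m T)
    (heq : v = x 2 → PathRuns x X W .hit 0 s (x 2 + 1) p (stringPos X (v * (v + 1))) v 0 m T) :
    PathRuns x X W .arrive (v + 1) s 0 p 0 0 0 m (T + v * (6 * v + 5) + 4) := by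
  have htest : PathRuns x X W .test 0 s (min v (x 2 + 1)) p (stringPos X (v * (v + 1))) v 0 m
      (T + 2) := by
    by_cases hlt : x 2 < v
    · refine (io rfl (if_pos ((isRightEnd_iff 2).2 ?_)) (hne (by omega) _ ?_)).mono
        (Nat.le_succ _)
      · change x 2 + 1 ≤ min v (x 2 + 1)
        omega
      · exact min_le_right _ _
    · refine io rfl (if_neg ((isRightEnd_iff 2).not.2 ?_)) (T := T + 1) ?_
      · change ¬ x 2 + 1 ≤ min v (x 2 + 1)
        omega
      have hmove : moveHead (x 2) (min v (x 2 + 1)) .right = v + 1 := by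
        simp only [moveHead]
        omega
      rw [hmove]
      by_cases hvt : v = x 2
      · refine io rfl (if_pos ((isRightEnd_iff 2).2 ?_)) (T := T) ?_
        · change x 2 + 1 ≤ v + 1
          omega
        · rw [hvt] at heq ⊢
          exact heq rfl
      · refine io rfl (if_neg ((isRightEnd_iff 2).not.2 ?_)) (hne hvt _ ?_)
        · change ¬ x 2 + 1 ≤ v + 1
          omega
        · change v + 1 ≤ x 2 + 1
          omega
  have hun := unwind hv htest (j := v) (i := 0) (zero_add v)
  refine (io rfl rfl (T := T + 2 + v * (6 * v + 5) + 1) ?_).mono (by omega)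
  have h0 : moveHead (strLen (X 0)) 0 .right = stringPos X (0 * (0 + 1)) := by
    simp [moveHead, stringPos]
  rw [h0]
  simpa [moveHead] using hun

theorem rewindString (H : PathRuns x X W .rewindTarget n s t p 0 z 0 m T) :
    ∀ {g : ℕ}, PathRuns x X W .rewindString n s t p g z 0 m (T + g + 1) := by
  intro g
  induction g with
  | zero => exact io rfl (if_pos ((isLeftEnd_iff (.inr 0)).2 rfl)) H
  | succ g ih => exact io rfl (if_neg ((isLeftEnd_iff (.inr 0)).not.2 (Nat.succ_ne_zero g))) ih

theorem rewindTarget (H : PathRuns x X W .reset n s 0 p g z 0 m T) :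
    ∀ {t : ℕ}, PathRuns x X W .rewindTarget n s t p g z 0 m (T + t + 1) := by
  intro t
  induction t with
  | zero => exact io rfl (if_pos ((isLeftEnd_iff (.inl 2)).2 rfl)) H
  | succ t ih => exact io rfl (if_neg ((isLeftEnd_iff (.inl 2)).not.2 (Nat.succ_ne_zero t))) ih

theorem reset (H : PathRuns x X W .arrive n s t p g 0 0 m T) :
    ∀ {z : ℕ}, PathRuns x X W .reset n s t p g z 0 m (T + z + 1) := by
  intro z
  induction z with
  | zero => exact dec_fst_zero rfl H
  | succ z ih => exact dec_fst_succ rfl ih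

/-- If the present guess is a successor, it is entered, after the heads and the counter have been
reset. -/
theorem take {i : ℕ} (hi : i ∈ X 0) (H : PathRuns x X W .arrive n s 0 p 0 0 0 m T) :
    PathRuns x X W .take n s t p (stringPos X i) z 0 m (T + strLen (X 0) + t + z + 5) := by
  refine (io rfl (if_pos (isOne_stringPos_iff.2 hi))
    (rewindString (rewindTarget (reset H (z := z)) (t := t)) (g := stringPos X i))).mono ?_
  have : stringPos X i ≤ strLen (X 0) + 1 := min_le_right _ _
  omega

/-- From the vertex `u`, with `v` the present guess, all successors `v, v + 1, …` are tried. -/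
theorem guess {u : ℕ} {f : ℕ → ℕ} (hu : u < x 0) (hW : 2 * x 0 < 2 ^ W) (ht : t ≤ x 2 + 1)
    (H : ∀ v < x 0, PathRuns x X W .arrive (v + 1) s 0 p 0 0 0 (f v) T) :
    ∀ {d v : ℕ}, v + d = x 0 →
    PathRuns x X W .guess (v + 1) s t p (stringPos X (pair u v)) (u + v) 0
      (∑ i ∈ Finset.range d, if pair u (v + i) ∈ X 0 then f (v + i) else 0)
      (d * (12 * x 0 + 8) + (T + strLen (X 0) + x 2 + 2 * x 0 + 6)) := by
  intro d
  induction d with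
  | zero =>
    intro v hv
    refine zero_of_io (by simp) rfl (if_pos ((isRightEnd_iff 0).2 ?_))
    change x 0 + 1 ≤ v + 1
    omega
  | succ d ih =>
    intro v hv
    have hnext : PathRuns x X W .guess (v + 1 + 1) s t p
        (stringPos X (pair u v + 1 + 1 + 2 * (u + v + 1))) (u + v + 1) 0
        (∑ i ∈ Finset.range d, if pair u (v + (i + 1)) ∈ X 0 then f (v + (i + 1)) else 0)
        (d * (12 * x 0 + 8) + (T + strLen (X 0) + x 2 + 2 * x 0 + 6)) := by
      have h := ih (v := v + 1) (by omega)
      rw [show pair u v + 1 + 1 + 2 * (u + v + 1) = pair u (v + 1) by unfold pair; ring]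
      simpa only [Nat.add_assoc, Nat.add_comm 1] using h
    have hadd : PathRuns x X W .next (v + 1) s t p (stringPos X (pair u v)) (u + v) 0
        (∑ i ∈ Finset.range d, if pair u (v + (i + 1)) ∈ X 0 then f (v + (i + 1)) else 0)
        (d * (12 * x 0 + 8) + (T + strLen (X 0) + x 2 + 2 * x 0 + 6) + 1 +
          6 * (u + v + 1) + 3 + 1 + 1) := by
      refine io rfl rfl (io rfl rfl ?_)
      have hmove : moveHead (x 0) (v + 1) .right = v + 1 + 1 := by
        simp only [moveHead]
        omega
      rw [moveHead_stringPos, moveHead_stringPos, hmove]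
      exact add (by omega) (io rfl rfl hnext)
    have htake : PathRuns x X W .take (v + 1) s t p (stringPos X (pair u v)) (u + v) 0
        (if pair u v ∈ X 0 then f v else 0) (T + strLen (X 0) + t + (u + v) + 5) := by
      split_ifs with h
      · exact take h (H v (by omega))
      · exact zero_of_io (by simp) rfl (if_neg (isOne_stringPos_iff.not.2 h))
    rw [Finset.sum_range_succ', add_comm (Finset.sum _ _)]
    have hbranch := branch (q := .guessBranch) rfl (by simp)
      (htake.mono (T' := d * (12 * x 0 + 8) + (T + strLen (X 0) + x 2 + 2 * x 0 + 6) +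
        12 * x 0 + 6) (by omega))
      (hadd.mono (T' := d * (12 * x 0 + 8) + (T + strLen (X 0) + x 2 + 2 * x 0 + 6) +
        12 * x 0 + 6) (by omega))
    refine (io rfl (if_neg ((isRightEnd_iff 0).not.2 ?_)) hbranch).mono ?_
    · change ¬ x 0 + 1 ≤ v + 1
      omega
    · rw [Nat.add_one_mul d]
      omega

/-- A bound for the number of program steps from one vertex of the path to the next. -/
def roundTime (x : Fin 4 → ℕ) (X : Fin 1 → Finset ℕ) : ℕ :=
  x 0 * (12 * x 0 + 8) + (x 0 * (6 * x 0 + 5) + strLen (X 0) + x 2 + 2 * x 0 + 16)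

/-- The accepting runs that leave `u` after `k` edges correspond to the nonempty paths from `u` to
the target with at most `r = p - k` edges. -/
theorem leave (hW : 2 * x 0 < 2 ^ W) :
    ∀ {r k u τ : ℕ}, k + r = x 3 → u < x 0 → τ ≤ x 2 + 1 →
    PathRuns x X W .leave 0 s τ k (stringPos X (u * (u + 1))) u 0
      (walkCount (x 0) (x 2) (X 0) r u) (r * roundTime x X + 2) := by
  intro r
  induction r with
  | zero =>
    intro k u τ hk hu hτ
    refine (io rfl rfl (T := 0) (zero_of_io (by simp) rfl
      (if_pos ((isRightEnd_iff 3).2 ?_)))).mono (by omega)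
    change x 3 + 1 ≤ min (k + 1) (x 3 + 1)
    omega
  | succ r ih =>
    intro k u τ hk hu hτ
    have harr : ∀ v < x 0, PathRuns x X W .arrive (v + 1) s 0 (k + 1) 0 0 0
        ((if v = x 2 then 1 else 0) + walkCount (x 0) (x 2) (X 0) r v)
        (r * roundTime x X + x 0 * (6 * x 0 + 5) + 8) := by
      intro v hv
      refine (arrive (T := r * roundTime x X + 4) (by omega) (fun hne τ hτ => ?_)
        (fun heq => ?_)).mono ?_
      · rw [if_neg hne, zero_add]
        exact (ih (by omega) hv hτ).mono (by omega)
      · rw [if_pos heq]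
        refine io rfl (if_neg ((isLeftEnd_iff (.inl 3)).not.2 (Nat.succ_ne_zero k)))
          (branch rfl (by simp) ?_ (ih (k := k + 1) (by omega) hv le_rfl))
        exact ProgramRuns.mono ProgramRuns.accept (Nat.zero_le _)
      · have : v * (6 * v + 5) ≤ x 0 * (6 * x 0 + 5) := by gcongr
        omega
    have hguess := guess hu hW hτ harr (d := x 0) (v := 0) (zero_add _)
    rw [show pair u 0 = u * (u + 1) by simp [pair]] at hguess
    simp only [zero_add, add_zero] at hguess
    have h0 : moveHead (x 0) 0 .right = 1 := by
      simp [moveHead]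
    have h3 : moveHead (x 3) k .right = k + 1 := by
      simp only [moveHead]
      omega
    refine (io rfl rfl (T := x 0 * (12 * x 0 + 8) + (r * roundTime x X + x 0 * (6 * x 0 + 5) + 8 +
      strLen (X 0) + x 2 + 2 * x 0 + 6) + 1) ?_).mono ?_
    · rw [h0, h3]
      refine io rfl (if_neg ((isRightEnd_iff 3).not.2 ?_)) hguess
      change ¬ x 3 + 1 ≤ k + 1
      omega
    · rw [Nat.add_one_mul r]
      unfold roundTime
      omega

/-- The head on `n` is taken to the cell of the vertex `s`. -/
theorem walk (H : x 1 < x 0 → PathRuns x X W .arrive (x 1 + 1) (x 1 + 1) 0 0 0 0 0 m T)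
    (H0 : x 0 ≤ x 1 → m = 0) : ∀ {j i : ℕ}, i + j = x 1 + 1 →
    PathRuns x X W .walk (min i (x 0 + 1)) i 0 0 0 0 0 m (T + j + 1) := by
  intro j
  induction j with
  | zero =>
    rintro i rfl
    have hs : (readInput (inputWord x X (.inl 1)) (tapeFamily (min (x 1 + 1) (x 0 + 1)) (x 1 + 1) 0
        0 0 (.inl 1))).isRightEnd = true := (isRightEnd_iff 1).2 le_rfl
    by_cases hlt : x 1 < x 0
    · have hmin : min (x 1 + 1) (x 0 + 1) = x 1 + 1 := by omega
      refine io rfl ((if_pos hs).trans (if_neg ((isRightEnd_iff 0).not.2 ?_))) ?_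
      · change ¬ x 0 + 1 ≤ min (x 1 + 1) (x 0 + 1)
        omega
      · simpa only [moveHead, add_zero, hmin] using H hlt
    · rw [H0 (by omega)]
      refine zero_of_io (by simp) rfl ((if_pos hs).trans (if_pos ((isRightEnd_iff 0).2 ?_)))
      change x 0 + 1 ≤ min (x 1 + 1) (x 0 + 1)
      omega
  | succ j ih =>
    intro i hi
    refine io rfl (if_neg ((isRightEnd_iff 1).not.2 ?_)) (T := T + j + 1) ?_
    · change ¬ x 1 + 1 ≤ i
      omega
    · have h0 : moveHead (x 0) (min i (x 0 + 1)) .right = min (i + 1) (x 0 + 1) := by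
        simp only [moveHead]
        omega
      have h1 : moveHead (x 1) i .right = i + 1 := by
        simp only [moveHead]
        omega
      rw [h0, h1]
      exact ih (by omega)

/-- A bound for the number of program steps. -/
def totalTime (x : Fin 4 → ℕ) (X : Fin 1 → Finset ℕ) : ℕ :=
  x 3 * roundTime x X + x 1 * (6 * x 1 + 5) + x 1 + 8

open Classical in
/-- The number of accepting runs of the program is the value of `#STCON`. -/
theorem start (hW : 2 * x 0 < 2 ^ W) :
    PathRuns x X W .start 0 0 0 0 0 0 0
      (if x 1 < x 0 ∧ x 2 < x 0 ∧ x 1 ≠ x 2 then walkCount (x 0) (x 2) (X 0) (x 3) (x 1) else 0)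
      (totalTime x X) := by
  refine (io rfl rfl (T := x 3 * roundTime x X + 2 + x 1 * (6 * x 1 + 5) + 4 + x 1 + 1) ?_).mono ?_
  swap
  · unfold totalTime
    omega
  refine walk (fun hlt => arrive (by omega) (fun hne τ hτ => ?_) (fun heq => ?_)) (fun hle => ?_)
    (i := 1) (by omega)
  · have h := leave (X := X) (s := x 1 + 1) hW (zero_add (x 3)) hlt hτ
    split_ifs with hc
    · exact h
    · rwa [walkCount_eq_zero (by omega)] at h
  · rw [if_neg (by omega)]
    exact zero_of_io (by simp) rfl (if_pos ((isLeftEnd_iff (.inl 3)).2 rfl))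
  · exact if_neg (by omega)

end PathRuns


/-! ### `#STCON` belongs to `#L` -/

/-- A path from `u` is either the vertex `u` alone or an edge from `u` to some `v` followed by a
path from `v`. -/
theorem stPaths_succ {n t p : ℕ} {G : Finset ℕ} (u : Fin n) :
    stPaths n u t (p + 1) G = {l | l = [u] ∧ u.val = t} ∪
      ⋃ v : Fin n, {l | pair u v ∈ G ∧ l ∈ List.cons u '' stPaths n v t p G} := by
  ext l
  simp only [Set.mem_union, Set.mem_iUnion]
  constructor
  · intro hl
    obtain ⟨h0, h1, hc, hlen⟩ := mem_stPaths.1 hl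
    cases l with
    | nil => simp at h0
    | cons a l =>
      obtain rfl : a = u := Fin.ext (by simpa using h0)
      cases l with
      | nil => exact .inl ⟨rfl, by simpa using h1⟩
      | cons v l =>
        rw [List.map_cons, List.map_cons, List.isChain_cons_cons] at hc
        refine .inr ⟨v, hc.1, v :: l, mem_stPaths.2 ⟨rfl, by simpa using h1, by simpa using hc.2,
          by simpa using hlen⟩, rfl⟩
  · rintro (⟨rfl, ht⟩ | ⟨v, hv, l', hl', rfl⟩)
    · exact mem_stPaths.2 ⟨rfl, by simpa using ht, by simp, by simp⟩
    · obtain ⟨h0, h1, hc, hlen⟩ := mem_stPaths.1 hl'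
      cases l' with
      | nil => simp at h0
      | cons a l =>
        obtain rfl : a = v := Fin.ext (by simpa using h0)
        exact mem_stPaths.2 ⟨rfl, by simpa using h1, by
          rw [List.map_cons, List.map_cons, List.isChain_cons_cons]
          exact ⟨hv, hc⟩, by simpa using hlen⟩

/-- The empty path counts only if `u` is the target. -/
theorem ncard_stPaths {n t : ℕ} {G : Finset ℕ} : ∀ (p : ℕ) (u : Fin n),
    (stPaths n u t p G).ncard = (if u.val = t then 1 else 0) + walkCount n t G p u := by
  have hsingle : ∀ u : Fin n, {l : List (Fin n) | l = [u] ∧ u.val = t}.ncard =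
      if u.val = t then 1 else 0 := by
    intro u
    split_ifs with h
    · simp [h]
    · simp [h]
  intro p
  induction p with
  | zero =>
    intro u
    rw [walkCount, add_zero, ← hsingle]
    congr 1
    ext l
    rw [mem_stPaths]
    constructor
    · rintro ⟨h0, h1, -, hlen⟩
      match l, h0, h1, hlen with
      | [a], h0, h1, _ =>
        obtain rfl : a = u := Fin.ext (by simpa using h0)
        exact ⟨rfl, by simpa using h1⟩
    · rintro ⟨rfl, ht⟩
      exact ⟨rfl, by simpa using ht, by simp, by simp⟩
  | succ p ih =>
    intro u
    have hfin : ∀ v : Fin n,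
        {l | pair u v ∈ G ∧ l ∈ List.cons u '' stPaths n v t p G}.Finite := fun v =>
      ((stPaths_finite n v t p G).image _).subset fun l hl => hl.2
    have hhead : ∀ (v : Fin n) (l : List (Fin n)), l ∈ stPaths n v t p G → l.head? = some v := by
      intro v l hl
      obtain ⟨w, hw, hwv⟩ := Option.map_eq_some_iff.1 (mem_stPaths.1 hl).1
      rw [hw, Fin.ext hwv]
    rw [stPaths_succ, Set.ncard_union_eq ?_ ((Set.finite_singleton [u]).subset fun l hl => hl.1)
      (Set.finite_iUnion hfin), hsingle, Set.ncard_iUnion_of_finite hfin ?_,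
      finsum_eq_sum_of_fintype, walkCount, Finset.sum_range]
    · congr 1
      refine Finset.sum_congr rfl fun v _ => ?_
      split_ifs with h h'
      all_goals simp only [h, true_and, false_and, Set.ofPred_false, Set.ncard_empty]
      all_goals
        change (List.cons u '' stPaths n v t p G).ncard = _
        rw [Set.ncard_image_of_injective _ List.cons_injective, ih]
        simp [h']
    · intro v w hvw
      refine Set.disjoint_left.2 ?_
      rintro _ ⟨-, l, hl, rfl⟩ ⟨-, l', hl', h⟩
      obtain rfl := List.cons_injective h
      exact hvw (Option.some_injective _ ((hhead v _ hl).symm.trans (hhead w _ hl')))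
    · refine Set.disjoint_left.2 ?_
      rintro _ ⟨rfl, -⟩ hl
      obtain ⟨v, -, l', hl', h⟩ := Set.mem_iUnion.1 hl
      obtain rfl : l' = [] := List.cons_injective h
      simpa using hhead v _ hl'

theorem bin_sharpSTCON (x : Fin 4 → ℕ) (X : Fin 1 → Finset ℕ) :
    bin (sharpSTCON x X) = if x 1 < x 0 ∧ x 2 < x 0 ∧ x 1 ≠ x 2 then
      walkCount (x 0) (x 2) (X 0) (x 3) (x 1) else 0 := by
  unfold sharpSTCON
  split_ifs with h
  · rw [bin_toBits, ncard_stPaths (n := x 0) (x 3) ⟨x 1, h.1⟩, if_neg h.2.2, zero_add]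
  · simp [bin]

/-- Polynomial growth in the form required of the running time. -/
theorem mul_pow_le_pow_add (C d N : ℕ) :
    C * (N + 1) ^ d ≤ N ^ (C * 2 ^ d + 2 * d) + (C * 2 ^ d + 2 * d) := by
  rcases Nat.lt_or_ge N 2 with hN | hN
  · have : C * (N + 1) ^ d ≤ C * 2 ^ d := by gcongr; omega
    omega
  · have hC : C ≤ N ^ (C * 2 ^ d) := by
      calc C ≤ C * 2 ^ d := Nat.le_mul_of_pos_right _ (by positivity)
        _ ≤ 2 ^ (C * 2 ^ d) := Nat.lt_two_pow_self.le
        _ ≤ N ^ (C * 2 ^ d) := Nat.pow_le_pow_left hN _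
    have hN' : (N + 1) ^ d ≤ N ^ (2 * d) := by
      rw [pow_mul]
      exact Nat.pow_le_pow_left (by nlinarith) _
    calc C * (N + 1) ^ d ≤ N ^ (C * 2 ^ d) * N ^ (2 * d) := Nat.mul_le_mul hC hN'
      _ = N ^ (C * 2 ^ d + 2 * d) := (pow_add _ _ _).symm
      _ ≤ _ := Nat.le_add_right _ _

theorem totalTime_le {x : Fin 4 → ℕ} {X : Fin 1 → Finset ℕ} {N : ℕ} (hx : ∀ i, x i ≤ N)
    (hX : strLen (X 0) ≤ N) :
    PathRuns.totalTime x X * (2 * (N + 2) + 3) + 1 ≤ 1000 * (N + 1) ^ 4 := by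
  have hround : PathRuns.roundTime x X ≤ 18 * N ^ 2 + 17 * N + 16 := by
    calc PathRuns.roundTime x X
        ≤ N * (12 * N + 8) + (N * (6 * N + 5) + N + N + 2 * N + 16) := by
          unfold PathRuns.roundTime
          gcongr <;> exact hx _
      _ = 18 * N ^ 2 + 17 * N + 16 := by ring
  calc PathRuns.totalTime x X * (2 * (N + 2) + 3) + 1
      ≤ (N * (18 * N ^ 2 + 17 * N + 16) + N * (6 * N + 5) + N + 8) * (2 * (N + 2) + 3) + 1 := by
        unfold PathRuns.totalTime
        gcongr <;> exact hx _
    _ = 36 * N ^ 4 + 172 * N ^ 3 + 205 * N ^ 2 + 170 * N + 57 := by ring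
    _ ≤ 1000 * (N ^ 4 + 4 * N ^ 3 + 6 * N ^ 2 + 4 * N + 1) := by omega
    _ = 1000 * (N + 1) ^ 4 := by ring

/-- Initially the counters are zero. -/
theorem isCounter_init (W : ℕ) : IsCounter W ⟨[], none, []⟩ 0 :=
  ⟨[], 0, rfl, rfl, Nat.zero_le _, Nat.zero_le _⟩

/-- The machine that executes the program for `#STCON`. -/
def pathMachine : Machine 4 1 := compile 4 1 pathProgram .start .accept

theorem hasRuns_pathMachine (x : Fin 4 → ℕ) (X : Fin 1 → Finset ℕ) :
    HasRuns (pathMachine.Step x X) (fun c => c.state = pathMachine.accept)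
      (fun c => ∀ j, (c.work j).space ≤ Nat.log 2 (inputSize x X) + 2 + 2) pathMachine.init
      (bin (sharpSTCON x X))
      (PathRuns.totalTime x X * (2 * (Nat.log 2 (inputSize x X) + 2) + 3) + 1) := by
  have h0 : x 0 ≤ inputSize x X := by
    simpa [inputWord] using Machine.length_inputWord_le x X (.inl 0)
  have hlog : inputSize x X < 2 ^ (Nat.log 2 (inputSize x X) + 1) :=
    Nat.lt_pow_succ_log_self (by norm_num) _
  -- the counters hold at most the sum of two vertices
  have hW : 2 * x 0 < 2 ^ (Nat.log 2 (inputSize x X) + 2) := by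
    rw [pow_succ]
    omega
  have h := PathRuns.start (X := X) hW (fun _ => ⟨[], none, []⟩) fun j => by
    fin_cases j <;> exact isCounter_init _
  have hfam : tapeFamily 0 0 0 0 0 = fun _ => 0 := by
    funext i
    rcases i with i | i <;> fin_cases i <;> rfl
  rw [hfam] at h
  rw [bin_sharpSTCON]
  exact h

theorem sharpSTCON_mem_sharpL : Obj.str sharpSTCON ∈ SharpL := by
  refine ⟨4, 1, sharpSTCON, pathMachine, rfl, ⟨8, fun x X l hl c hc => ?_⟩,
    ⟨1000 * 2 ^ 4 + 2 * 4, fun x X l hl => ?_⟩, fun x X => (hasRuns_pathMachine x X).encard_eq⟩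
  -- two work tapes with at most `log₂ N + 4` cells each
  · have h := (hasRuns_pathMachine x X).ok l hl.1 hl.2 c hc
    have hsum := Finset.sum_le_card_nsmul Finset.univ (fun j => (c.work j).space) _ fun j _ => h j
    have hcard : Fintype.card (Fin pathMachine.tapes) = 2 := rfl
    rw [Finset.card_univ, hcard, smul_eq_mul] at hsum
    omega
  · refine ((hasRuns_pathMachine x X).length_le l hl.1 hl.2).trans
      (le_trans ?_ (mul_pow_le_pow_add 1000 4 (inputSize x X)))
    refine le_trans ?_ (totalTime_le (x := x) (X := X) (N := inputSize x X) (fun i => ?_) ?_)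
    · gcongr
      exact Nat.log_le_self _ _
    · simpa [inputWord] using Machine.length_inputWord_le x X (.inl i)
    · simpa [inputWord] using Machine.length_inputWord_le x X (.inr 0)

end TwoSorted

theorem mainTheorem5 :
    -- `#STCON` is in `#L`
    TwoSorted.Obj.str TwoSorted.sharpSTCON ∈ TwoSorted.SharpL ∧
    -- every function of `#L` is `#STCON(n,0,1,p,H)` for a `Σ₀ᴮ`-bit-definable string function `H`
    -- and number terms `n ≥ 2` and `p` of the base vocabulary
    (∀ {a b : ℕ} (F : TwoSorted.StrFun a b), TwoSorted.Obj.str F ∈ TwoSorted.SharpL →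
      ∃ (H : TwoSorted.StrFun a b) (n p : TwoSorted.NumTerm ∅ a b),
        TwoSorted.SigmaBitDefinable ∅ H ∧
        ∀ x X, 2 ≤ n.eval x X ∧
          F x X = TwoSorted.sharpSTCON ![n.eval x X, 0, 1, p.eval x X] ![H x X]) ∧
    -- `#STCON` is complete for `DET`
    TwoSorted.AC0Complete (TwoSorted.Obj.str TwoSorted.sharpSTCON) TwoSorted.DET :=
  ⟨TwoSorted.sharpSTCON_mem_sharpL, fun F hF => TwoSorted.exists_eq_sharpSTCON F hF,
    TwoSorted.ac0Complete_sharpSTCON TwoSorted.sharpSTCON_mem_sharpL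
      fun F hF => TwoSorted.exists_eq_sharpSTCON F hF⟩
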